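/- **The programming language UPL.** Terms, taken up to $\alpha$-conversion, are $M,N ::= x \mid \lambda x.M \mid M\,N \mid c \mid f$, where $c$ ranges over the constructors $\mathsf U,\mathsf{Nat},\mathsf N_0,\mathsf N_1,\mathsf 0$ (arity 0), $\mathsf S,\mathsf{Inl},\mathsf{Inr}$ (arity 1), $(+),(\times),\mathsf{Fun},\mathsf{Pair}$ (arity 2), and $f$ ranges over the defined constants $\mathsf{vec},\mathsf{get},\mathsf{trim},T,\mathsf{head},\mathsf{tail},(\le),\mathsf{less},\mathsf{Rec},\neg,\mathsf{exit},\Phi,\Psi$. Write $(u,v)$ for $\mathsf{Pair}\,u\,v$, $\Pi x{:}A.B$ for $\mathsf{Fun}\,A\,(\lambda x.B)$, and $A\to B$ for $\Pi x{:}A.B$ when $x$ is not free in $B$. The rewrite rules are as follows; the arity of $f$ is the number of arguments on the left, and $\mathsf{exit}$ has arity 1 and no rule. - $\mathsf{Rec}\,P\,Q\,\mathsf 0=P$; $\ \mathsf{Rec}\,P\,Q\,(\mathsf S\,x)=Q\,x\,(\mathsf{Rec}\,P\,Q\,x)$; $\ \neg A=A\to\mathsf N_0$; $\ T\,P=\Pi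 k{:}\mathsf{Nat}.\,P(\mathsf S\,k)\to P\,k$. - $\mathsf 0\le n=\mathsf N_1$; $\ \mathsf S\,x\le\mathsf 0=\mathsf N_0$; $\ \mathsf S\,x\le\mathsf S\,n=x\le n$. - $\mathsf{less}\,x\,\mathsf 0=\mathsf{Inr}\,\mathsf 0$; $\ \mathsf{less}\,\mathsf 0\,(\mathsf S\,n)=\mathsf{Inl}\,\mathsf 0$; $\ \mathsf{less}\,(\mathsf S\,x)\,(\mathsf S\,n)=\mathsf{less}\,x\,n$. - $\mathsf{vec}\,B\,\mathsf 0=\mathsf N_1$; $\ \mathsf{vec}\,B\,(\mathsf S\,x)=(\mathsf{vec}\,B\,x)\times(B\,x)$; $\ \mathsf{head}\,x\,(v,u)=u$; $\ \mathsf{tail}\,x\,(v,u)=v$. - $\mathsf{trim}\,\mathsf 0\,\mathsf 0\,p\,P\,h\,v=v$; $\ \mathsf{trim}\,\mathsf 0\,(\mathsf S\,m)\,p\,P\,h\,v=\mathsf{trim}\,\mathsf 0\,m\,p\,P\,h\,(h\,m\,v)$; $\ \mathsf{trim}\,(\mathsf S\,n)\,\mathsf 0\,p\,P\,h\,v=\mathsf{exit}\,p$;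 $\ \mathsf{trim}\,(\mathsf S\,n)\,(\mathsf S\,m)\,p\,P\,h\,v=\mathsf{trim}\,n\,m\,p\,(\lambda x.P(\mathsf S\,x))\,(\lambda x.h(\mathsf S\,x))\,v$. - $\mathsf{get}\,B\,n\,x\,p\,v=\mathsf{head}\,x\,(\mathsf{trim}\,(\mathsf S\,x)\,n\,p\,(\mathsf{vec}\,B)\,\mathsf{tail}\,v)$. - $\Phi\,B\,H\,K\,n\,v=K\,(\lambda x.\Psi\,B\,H\,K\,n\,v\,x\,(\mathsf{less}\,x\,n))$; $\ \Psi\,B\,H\,K\,n\,v\,x\,(\mathsf{Inl}\,p)=\mathsf{get}\,B\,n\,x\,p\,v$; $\ \Psi\,B\,H\,K\,n\,v\,x\,(\mathsf{Inr}\,p)=\mathsf{exit}\,(H\,n\,(\lambda y.\Phi\,B\,H\,K\,(\mathsf S\,n)\,(v,y)))$. The relation $=_{\beta,\iota}$ is the convertibility generated by $\beta$ and these rules, applied anywhere in a term. **Type theory.** The judgements $\Gamma\vdash$, $\Gamma\vdash A$, $\Gamma\vdash M:A$ are generated by the following rules. The empty context is well formed, and $\Gamma\vdash A$ gives $\Gamma,x{:}A\vdash$.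 If $\Gamma\vdash$ then $\Gamma\vdash\mathsf U$; $\Gamma\vdash A:\mathsf U$ gives $\Gamma\vdash A$; $\Gamma,x{:}A\vdash B$ gives $\Gamma\vdash\Pi x{:}A.B$. If $\Gamma\vdash$ and $(x{:}A)\in\Gamma$ then $\Gamma\vdash x:A$; $\Gamma,x{:}A\vdash M:B$ gives $\Gamma\vdash\lambda x.M:\Pi x{:}A.B$; $\Gamma\vdash N:\Pi x{:}A.B$ and $\Gamma\vdash M:A$ give $\Gamma\vdash N\,M:B[M]$; $\Gamma\vdash M:A$, $\Gamma\vdash B$ and $A=_{\beta,\iota}B$ give $\Gamma\vdash M:B$; $\Gamma\vdash A:\mathsf U$ and $\Gamma,x{:}A\vdash B:\mathsf U$ give $\Gamma\vdash\Pi x{:}A.B:\mathsf U$. Moreover, in every well-formed context $\Gamma$, for all parameters $A,A',C,B$ with $\Gamma\vdash A,A':\mathsf U$ and $\Gamma\vdash C,B:\mathsf{Nat}\to\mathsf U$, the constants have the types: - $\mathsf{Nat},\mathsf N_0,\mathsf N_1:\mathsf U$; $\ \mathsf 0:\mathsf{Nat}$; $\ \mathsf 0:\mathsf N_1$; $\ \mathsf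 S:\mathsf{Nat}\to\mathsf{Nat}$; $\ (+),(\times):\mathsf U\to\mathsf U\to\mathsf U$; $\ \neg:\mathsf U\to\mathsf U$; $\ (\le):\mathsf{Nat}\to\mathsf{Nat}\to\mathsf U$; $\ \mathsf{vec}:(\mathsf{Nat}\to\mathsf U)\to\mathsf{Nat}\to\mathsf U$; $\ T:(\mathsf{Nat}\to\mathsf U)\to\mathsf U$. - $\mathsf{Inl}:A\to A+A'$; $\ \mathsf{Inr}:A'\to A+A'$; $\ \mathsf{Pair}:A\to A'\to A\times A'$; $\ \mathsf{exit}:\mathsf N_0\to A$; $\ \mathsf{Rec}:C\,\mathsf 0\to(\Pi n{:}\mathsf{Nat}.\,C\,n\to C(\mathsf S\,n))\to\Pi n{:}\mathsf{Nat}.\,C\,n$. - $\mathsf{less}:\Pi x{:}\mathsf{Nat}.\Pi n{:}\mathsf{Nat}.(\mathsf S\,x\le n)+(n\le x)$; $\ \mathsf{head}:\Pi x{:}\mathsf{Nat}.\,\mathsf{vec}\,B\,(\mathsf S\,x)\to B\,x$; $\ \mathsf{tail}:\Pi x{:}\mathsf{Nat}.\,\mathsf{vec}\,B\,(\mathsf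 S\,x)\to\mathsf{vec}\,B\,x$. - $\mathsf{trim}:\Pi n{:}\mathsf{Nat}.\Pi m{:}\mathsf{Nat}.(n\le m)\to\Pi P{:}\mathsf{Nat}\to\mathsf U.\ T\,P\to P\,m\to P\,n$; $\ \mathsf{get}:\Pi B{:}\mathsf{Nat}\to\mathsf U.\Pi n{:}\mathsf{Nat}.\Pi x{:}\mathsf{Nat}.(\mathsf S\,x\le n)\to\mathsf{vec}\,B\,n\to B\,x$. - $\Phi:\Pi B{:}\mathsf{Nat}\to\mathsf U.(\Pi n{:}\mathsf{Nat}.\neg\neg B\,n)\to\neg(\Pi n{:}\mathsf{Nat}.B\,n)\to\Pi n{:}\mathsf{Nat}.\neg\,\mathsf{vec}\,B\,n$. - $\Psi:\Pi B{:}\mathsf{Nat}\to\mathsf U.(\Pi n{:}\mathsf{Nat}.\neg\neg B\,n)\to\neg(\Pi n{:}\mathsf{Nat}.B\,n)\to\Pi n{:}\mathsf{Nat}.\,\mathsf{vec}\,B\,n\to\Pi x{:}\mathsf{Nat}.(\mathsf S\,x\le n)+(n\le x)\to B\,x$. **The domain.** Formal neighbourhoods are $U,V::=\nabla\mid c\,U_1\dots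 U_k\mid U\to V\mid U\cap V$ ($k$ the arity of $c$). Formal inclusion $\subseteq$ is the least preorder for which $\cap$ is a binary meet, constructors are monotone, $\to$ is antitone on the left and monotone on the right, and such that, with $=$ meaning $\subseteq$ in both directions: $\nabla\cap U=\nabla$; $c\,\vec U\cap c'\,\vec V=\nabla$ for $c\ne c'$; $c\,\vec U\cap(V\to W)=\nabla$; $(U\to V_1)\cap(U\to V_2)=U\to(V_1\cap V_2)$; $c\,\vec U\cap c\,\vec V=c\,(U_1\cap V_1)\dots(U_k\cap V_k)$. Let $\mathcal M$ be the poset of neighbourhoods modulo $=$, and let $\mathsf D$ be the set of I-filters of $\mathcal M$, i.e. the (possibly empty) subsets closed upwards and under $\cap$, ordered by inclusion; $\bot=\emptyset$. The judgement $\Gamma\vdash_{\mathcal M}M:U$ is generated by: $\Gamma\vdash_{\mathcal M}x:U$ for $x{:}U\in\Gamma$; $\Gamma\vdash_{\mathcal M}c:U_1\to\dots\to U_k\to c\,U_1\dots U_k$; the usual rules for abstraction and application; $\Gamma\vdash_{\mathcal M}M:U\cap V$ from $\Gamma\vdash_{\mathcal M}M:U$ and $\Gamma\vdash_{\mathcal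 M}M:V$; $\Gamma\vdash_{\mathcal M}M:U$ from $\Gamma\vdash_{\mathcal M}M:V$ and $V\subseteq U$; $\Gamma\vdash_{\mathcal M}f:U_1\to\dots\to U_k\to V$ whenever $f\,p_1\dots p_k=M$ is a rewrite rule with pattern variables $x_1,\dots,x_n$, $p_i(W_1,\dots,W_n)=U_i$ for all $i$, and $\Gamma,x_1{:}W_1,\dots,x_n{:}W_n\vdash_{\mathcal M}M:V$; and $\Gamma\vdash_{\mathcal M}f:U_1\to\dots\to U_k\to\nabla$ whenever no rewrite rule of $f$ matches $U_1,\dots,U_k$ in this sense. For an environment $\rho$ (a map from variables to $\mathsf D$), $[\![M]\!]_\rho\in\mathsf D$ is the set of (classes of) $U$ such that $x_1{:}V_1,\dots,x_n{:}V_n\vdash_{\mathcal M}M:U$ for some $V_i\in\rho(x_i)$, where $\mathrm{FV}(M)=\{x_1,\dots,x_n\}$. It is written $[\![M]\!]$ when $M$ is closed, since it then does not depend on $\rho$. **Statement.** If $\vdash A$ then $[\![A]\!]\neq\bot$. If $\vdash M:A$ then $[\![M]\!]\neq\bot$. -/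

import Mathlib

namespace UPL

/-! ## Constants, terms, substitution -/

/-- The constructors of the untyped programming language. -/
inductive Constr : Type
  | U | Nat | N0 | N1 | zero | S | Inl | Inr | plus | times | Fun | Pair
  deriving DecidableEq

/-- Arity of a constructor. -/
def Constr.arity : Constr → ℕ
  | .U | .Nat | .N0 | .N1 | .zero => 0
  | .S | .Inl | .Inr => 1
  | .plus | .times | .Fun | .Pair => 2

/-- The defined constants of the untyped programming language. -/
inductive DConst : Type
  | vec | get | trim | T | head | tail | le | less | Rec | neg | exit | Phi | Psi
  deriving DecidableEq

/-- Arity of a defined constant. -/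
def DConst.arity : DConst → ℕ
  | .vec => 2
  | .get => 5
  | .trim => 6
  | .T => 1
  | .head => 2
  | .tail => 2
  | .le => 2
  | .less => 2
  | .Rec => 3
  | .neg => 1
  | .exit => 1
  | .Phi => 5
  | .Psi => 7

/-- Terms up to `α`-conversion, in de Bruijn notation. -/
inductive Term : Type
  | var (i : ℕ)
  | lam (M : Term)
  | app (M N : Term)
  | con (c : Constr)
  | fn (f : DConst)

namespace Term

/-- The set of free variables. -/
def fv : Term → Set ℕ
  | var i => {i}
  | lam M => {i | i + 1 ∈ fv M}
  | app M N => fv M ∪ fv N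
  | con _ => ∅
  | fn _ => ∅

/-- Lifting of a renaming under a binder. -/
def liftRen (r : ℕ → ℕ) : ℕ → ℕ
  | 0 => 0
  | i + 1 => r i + 1

/-- Renaming of free variables. -/
def rename : Term → (ℕ → ℕ) → Term
  | var i, r => var (r i)
  | lam M, r => lam (rename M (liftRen r))
  | app M N, r => app (rename M r) (rename N r)
  | con c, _ => con c
  | fn f, _ => fn f

/-- `M.shift k` adds `k` to every free variable. -/
def shift (k : ℕ) (M : Term) : Term := M.rename (fun i => i + k)

/-- Lifting of a substitution under a binder. -/
def liftSub (s : ℕ → Term) : ℕ → Term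
  | 0 => var 0
  | i + 1 => (s i).shift 1

/-- Simultaneous capture-avoiding substitution. -/
def subst : Term → (ℕ → Term) → Term
  | var i, s => s i
  | lam M, s => lam (subst M (liftSub s))
  | app M N, s => app (subst M s) (subst N s)
  | con c, _ => con c
  | fn f, _ => fn f

/-- `B.inst M` is `B[M]`: the variable `0` of `B` is replaced by `M`, the others are lowered. -/
def inst (B M : Term) : Term :=
  B.subst fun i => match i with
    | 0 => M
    | j + 1 => var j

/-- `apps M [N₁, …, Nₖ]` is `M N₁ … Nₖ`. -/
def apps (M : Term) (l : List Term) : Term := l.foldl app M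

/-! Abbreviations for fully applied constants. -/

def tU : Term := con .U
def tNat : Term := con .Nat
def tN0 : Term := con .N0
def tN1 : Term := con .N1
def t0 : Term := con .zero
def tS (M : Term) : Term := app (con .S) M
def tInl (M : Term) : Term := app (con .Inl) M
def tInr (M : Term) : Term := app (con .Inr) M
def tplus (A B : Term) : Term := apps (con .plus) [A, B]
def ttimes (A B : Term) : Term := apps (con .times) [A, B]
def tpair (M N : Term) : Term := apps (con .Pair) [M, N]
def tle (M N : Term) : Term := apps (fn .le) [M, N]
def tvec (B M : Term) : Term := apps (fn .vec) [B, M]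
def tneg (A : Term) : Term := app (fn .neg) A

/-- `Πx:A.B`, i.e. `Fun A (λx.B)`; the variable `0` of `B` is the bound one. -/
def pi (A B : Term) : Term := apps (con .Fun) [A, lam B]

/-- `A → B`, i.e. `Fun A (λx.B)` with `x` not free in `B`. -/
def arr (A B : Term) : Term := pi A (B.shift 1)

end Term

/-! ## Rewrite rules and conversion -/

/-- Constructor patterns in the variables `x₀, …, xₙ₋₁`. -/
inductive Pat (n : ℕ) : Type
  | var (i : Fin n)
  | con (c : Constr) (p : Fin c.arity → Pat n)

/-- The term obtained from a pattern by replacing its variables by terms. -/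
def Pat.toTerm {n : ℕ} (s : Fin n → Term) : Pat n → Term
  | .var i => s i
  | .con c p => Term.apps (.con c) (List.ofFn fun i => (p i).toTerm s)

namespace Pat
def p0 {n : ℕ} : Pat n := .con .zero ![]
def pS {n : ℕ} (p : Pat n) : Pat n := .con .S ![p]
def pInl {n : ℕ} (p : Pat n) : Pat n := .con .Inl ![p]
def pInr {n : ℕ} (p : Pat n) : Pat n := .con .Inr ![p]
def ppair {n : ℕ} (p q : Pat n) : Pat n := .con .Pair ![p, q]
end Pat

/-- A rewrite rule `f p₁ … pₖ = M`, where `k` is the arity of `f`. Its pattern variables are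
`x₀, …, xₙ₋₁`, and the free variable `i` of `rhs` stands for `xᵢ`. -/
structure Rule (f : DConst) where
  n : ℕ
  lhs : Fin f.arity → Pat n
  rhs : Term

section
open Term Pat

/-- The rewrite rules of each defined constant. The pattern variables are numbered from left to
right; the named form of each rule is given next to it. -/
def rules : (f : DConst) → List (Rule f)
  | .Rec =>
    [ -- Rec P Q 0 = P
      ⟨2, ![.var 0, .var 1, p0], var 0⟩,
      -- Rec P Q (S x) = Q x (Rec P Q x)
      ⟨3, ![.var 0, .var 1, pS (.var 2)],
        apps (var 1) [var 2, apps (fn .Rec) [var 0, var 1, var 2]]⟩ ]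
  | .exit => []
  | .neg =>
    [ -- ¬ A = A → N₀
      ⟨1, ![.var 0], arr (var 0) tN0⟩ ]
  | .le =>
    [ -- 0 ≤ n = N₁
      ⟨1, ![p0, .var 0], tN1⟩,
      -- S x ≤ 0 = N₀
      ⟨1, ![pS (.var 0), p0], tN0⟩,
      -- S x ≤ S n = x ≤ n
      ⟨2, ![pS (.var 0), pS (.var 1)], tle (var 0) (var 1)⟩ ]
  | .less =>
    [ -- less x 0 = Inr 0
      ⟨1, ![.var 0, p0], tInr t0⟩,
      -- less 0 (S n) = Inl 0
      ⟨1, ![p0, pS (.var 0)], tInl t0⟩,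
      -- less (S x) (S n) = less x n
      ⟨2, ![pS (.var 0), pS (.var 1)], apps (fn .less) [var 0, var 1]⟩ ]
  | .vec =>
    [ -- vec B 0 = N₁
      ⟨1, ![.var 0, p0], tN1⟩,
      -- vec B (S x) = (vec B x) × (B x)
      ⟨2, ![.var 0, pS (.var 1)], ttimes (tvec (var 0) (var 1)) (app (var 0) (var 1))⟩ ]
  | .head =>
    [ -- head x (v, u) = u
      ⟨3, ![.var 0, ppair (.var 1) (.var 2)], var 2⟩ ]
  | .tail =>
    [ -- tail x (v, u) = v
      ⟨3, ![.var 0, ppair (.var 1) (.var 2)], var 1⟩ ]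
  | .T =>
    [ -- T P = Π k:Nat. P (S k) → P k
      ⟨1, ![.var 0], pi tNat (arr (app (var 1) (tS (var 0))) (app (var 1) (var 0)))⟩ ]
  | .trim =>
    [ -- trim 0 0 p P h v = v
      ⟨4, ![p0, p0, .var 0, .var 1, .var 2, .var 3], var 3⟩,
      -- trim 0 (S m) p P h v = trim 0 m p P h (h m v)
      ⟨5, ![p0, pS (.var 0), .var 1, .var 2, .var 3, .var 4],
        apps (fn .trim) [t0, var 0, var 1, var 2, var 3, apps (var 3) [var 0, var 4]]⟩,
      -- trim (S n) 0 p P h v = exit p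
      ⟨5, ![pS (.var 0), p0, .var 1, .var 2, .var 3, .var 4], app (fn .exit) (var 1)⟩,
      -- trim (S n) (S m) p P h v = trim n m p (λx. P (S x)) (λx. h (S x)) v
      ⟨6, ![pS (.var 0), pS (.var 1), .var 2, .var 3, .var 4, .var 5],
        apps (fn .trim) [var 0, var 1, var 2, lam (app (var 4) (tS (var 0))),
          lam (app (var 5) (tS (var 0))), var 5]⟩ ]
  | .get =>
    [ -- get B n x p v = head x (trim (S x) n p (vec B) tail v)
      ⟨5, ![.var 0, .var 1, .var 2, .var 3, .var 4],
        apps (fn .head) [var 2,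
          apps (fn .trim) [tS (var 2), var 1, var 3, app (fn .vec) (var 0), fn .tail, var 4]]⟩ ]
  | .Phi =>
    [ -- Φ B H K n v = K (λx. Ψ B H K n v x (less x n))
      ⟨5, ![.var 0, .var 1, .var 2, .var 3, .var 4],
        app (var 2) (lam (apps (fn .Psi)
          [var 1, var 2, var 3, var 4, var 5, var 0, apps (fn .less) [var 0, var 4]]))⟩ ]
  | .Psi =>
    [ -- Ψ B H K n v x (Inl p) = get B n x p v
      ⟨7, ![.var 0, .var 1, .var 2, .var 3, .var 4, .var 5, pInl (.var 6)],
        apps (fn .get) [var 0, var 3, var 5, var 6, var 4]⟩,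
      -- Ψ B H K n v x (Inr p) = exit (H n (λy. Φ B H K (S n) (v, y)))
      ⟨7, ![.var 0, .var 1, .var 2, .var 3, .var 4, .var 5, pInr (.var 6)],
        app (fn .exit) (apps (var 1) [var 3, lam (apps (fn .Phi)
          [var 1, var 2, var 3, tS (var 4), tpair (var 5) (var 0)])])⟩ ]

end

/-- The substitution that replaces the pattern variables `0, …, n-1` by `s` (and lowers the other
variables, which do not occur in right-hand sides). -/
def patSub {n : ℕ} (s : Fin n → Term) (i : ℕ) : Term :=
  if h : i < n then s ⟨i, h⟩ else .var (i - n)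

/-- One step of `β,ι`-reduction, anywhere in a term. -/
inductive Step : Term → Term → Prop
  | beta (M N : Term) : Step (.app (.lam M) N) (M.inst N)
  | iota {f : DConst} (r : Rule f) (hr : r ∈ rules f) (s : Fin r.n → Term) :
      Step (Term.apps (.fn f) (List.ofFn fun i => (r.lhs i).toTerm s)) (r.rhs.subst (patSub s))
  | lam {M M' : Term} : Step M M' → Step (.lam M) (.lam M')
  | appL {M M' N : Term} : Step M M' → Step (.app M N) (.app M' N)
  | appR {M N N' : Term} : Step N N' → Step (.app M N) (.app M N')

/-- `β,ι`-convertibility. -/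
def Conv : Term → Term → Prop := Relation.EqvGen Step

/-! ## Type theory -/

section
open Term

/-- `ConstTy h Δ A` says that the constant `h` is declared with type `A`, with the parameters
`[x₀ : Δ₀, x₁ : Δ₁, …]`; the parameter `xᵢ` is the free variable `i` of `A`, and the types `Δᵢ`
are closed. -/
inductive ConstTy : Term → List Term → Term → Prop
  | Nat : ConstTy tNat [] tU
  | zero : ConstTy t0 [] tNat
  | S : ConstTy (con .S) [] (arr tNat tNat)
  /-- `Rec : C 0 → (Π n:Nat. C n → C (S n)) → Π n:Nat. C n  [C : Nat → U]` -/
  | Rec : ConstTy (fn .Rec) [arr tNat tU]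
      (arr (app (var 0) t0)
        (arr (pi tNat (arr (app (var 1) (var 0)) (app (var 1) (tS (var 0)))))
          (pi tNat (app (var 1) (var 0)))))
  | plus : ConstTy (con .plus) [] (arr tU (arr tU tU))
  /-- `Inl : A → A + B  [A, B : U]` -/
  | Inl : ConstTy (con .Inl) [tU, tU] (arr (var 0) (tplus (var 0) (var 1)))
  /-- `Inr : B → A + B  [A, B : U]` -/
  | Inr : ConstTy (con .Inr) [tU, tU] (arr (var 1) (tplus (var 0) (var 1)))
  | times : ConstTy (con .times) [] (arr tU (arr tU tU))
  /-- `Pair : A → B → A × B  [A, B : U]` -/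
  | Pair : ConstTy (con .Pair) [tU, tU] (arr (var 0) (arr (var 1) (ttimes (var 0) (var 1))))
  | N0 : ConstTy tN0 [] tU
  /-- `exit : N₀ → A  [A : U]` -/
  | exit : ConstTy (fn .exit) [tU] (arr tN0 (var 0))
  | neg : ConstTy (fn .neg) [] (arr tU tU)
  | N1 : ConstTy tN1 [] tU
  | zero' : ConstTy t0 [] tN1
  | le : ConstTy (fn .le) [] (arr tNat (arr tNat tU))
  /-- `less : Π x:Nat. Π n:Nat. (S x ≤ n) + (n ≤ x)` -/
  | less : ConstTy (fn .less) []
      (pi tNat (pi tNat (tplus (tle (tS (var 1)) (var 0)) (tle (var 0) (var 1)))))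
  | vec : ConstTy (fn .vec) [] (arr (arr tNat tU) (arr tNat tU))
  /-- `head : Π x:Nat. vec B (S x) → B x  [B : Nat → U]` -/
  | head : ConstTy (fn .head) [arr tNat tU]
      (pi tNat (arr (tvec (var 1) (tS (var 0))) (app (var 1) (var 0))))
  /-- `tail : Π x:Nat. vec B (S x) → vec B x  [B : Nat → U]` -/
  | tail : ConstTy (fn .tail) [arr tNat tU]
      (pi tNat (arr (tvec (var 1) (tS (var 0))) (tvec (var 1) (var 0))))
  | T : ConstTy (fn .T) [] (arr (arr tNat tU) tU)
  /-- `trim : Π n:Nat. Π m:Nat. (n ≤ m) → Π P:Nat → U. T P → P m → P n` -/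
  | trim : ConstTy (fn .trim) []
      (pi tNat (pi tNat (arr (tle (var 1) (var 0))
        (pi (arr tNat tU) (arr (app (fn .T) (var 0))
          (arr (app (var 0) (var 1)) (app (var 0) (var 2))))))))
  /-- `get : Π B:Nat → U. Π n:Nat. Π x:Nat. (S x ≤ n) → vec B n → B x` -/
  | get : ConstTy (fn .get) []
      (pi (arr tNat tU) (pi tNat (pi tNat (arr (tle (tS (var 0)) (var 1))
        (arr (tvec (var 2) (var 1)) (app (var 2) (var 0)))))))
  /-- `Φ : Π B:Nat → U. (Π n:Nat. ¬¬ B n) → ¬ (Π n:Nat. B n) → Π n:Nat. ¬ vec B n` -/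
  | Phi : ConstTy (fn .Phi) []
      (pi (arr tNat tU) (arr (pi tNat (tneg (tneg (app (var 1) (var 0)))))
        (arr (tneg (pi tNat (app (var 1) (var 0))))
          (pi tNat (tneg (tvec (var 1) (var 0)))))))
  /-- `Ψ : Π B:Nat → U. (Π n:Nat. ¬¬ B n) → ¬ (Π n:Nat. B n) →
    Π n:Nat. vec B n → Π x:Nat. (S x ≤ n) + (n ≤ x) → B x` -/
  | Psi : ConstTy (fn .Psi) []
      (pi (arr tNat tU) (arr (pi tNat (tneg (tneg (app (var 1) (var 0)))))
        (arr (tneg (pi tNat (app (var 1) (var 0))))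
          (pi tNat (arr (tvec (var 1) (var 0))
            (pi tNat (arr (tplus (tle (tS (var 0)) (var 1)) (tle (var 1) (var 0)))
              (app (var 2) (var 0)))))))))

mutual

/-- `Γ ⊢`. Contexts are lists whose head is the most recent variable. -/
inductive WfCtx : List Term → Prop
  | nil : WfCtx []
  | cons {Γ : List Term} {A : Term} : IsType Γ A → WfCtx (A :: Γ)

/-- `Γ ⊢ A`. -/
inductive IsType : List Term → Term → Prop
  | univ {Γ : List Term} : WfCtx Γ → IsType Γ tU
  | el {Γ : List Term} {A : Term} : HasType Γ A tU → IsType Γ A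
  | pi {Γ : List Term} {A B : Term} : IsType (A :: Γ) B → IsType Γ (pi A B)

/-- `Γ ⊢ M : A`. -/
inductive HasType : List Term → Term → Term → Prop
  | var {Γ : List Term} {i : ℕ} {A : Term} :
      Γ[i]? = some A → WfCtx Γ → HasType Γ (var i) (A.shift (i + 1))
  | lam {Γ : List Term} {A B M : Term} :
      HasType (A :: Γ) M B → HasType Γ (lam M) (pi A B)
  | app {Γ : List Term} {A B M N : Term} :
      HasType Γ N (pi A B) → HasType Γ M A → HasType Γ (app N M) (B.inst M)
  | conv {Γ : List Term} {A B M : Term} :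
      HasType Γ M A → IsType Γ B → Conv A B → HasType Γ M B
  | piU {Γ : List Term} {A B : Term} :
      HasType Γ A tU → HasType (A :: Γ) B tU → HasType Γ (pi A B) tU
  /-- The declared type of a constant, its parameters being instantiated by terms `s i`. -/
  | const {Γ : List Term} {h A : Term} {Δ : List Term} (s : ℕ → Term) :
      ConstTy h Δ A → WfCtx Γ → (∀ (i : ℕ) (D : Term), Δ[i]? = some D → HasType Γ (s i) D) →
      HasType Γ h (A.subst s)

end

end

/-! ## Formal neighbourhoods -/

/-- Formal neighbourhoods. -/
inductive Nbhd : Type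
  | nabla
  | con (c : Constr) (U : Fin c.arity → Nbhd)
  | arrow (U V : Nbhd)
  | inter (U V : Nbhd)

/-- Formal inclusion. The five equations of its definition are stated in their nontrivial
direction; the equations are derived below. -/
inductive Incl : Nbhd → Nbhd → Prop
  | nabla_inter (U : Nbhd) : Incl .nabla (.inter .nabla U)
  | con_con_ne {c c' : Constr} (U : Fin c.arity → Nbhd) (V : Fin c'.arity → Nbhd) :
      c ≠ c' → Incl (.inter (.con c U) (.con c' V)) .nabla
  | con_arrow {c : Constr} (U : Fin c.arity → Nbhd) (V W : Nbhd) :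
      Incl (.inter (.con c U) (.arrow V W)) .nabla
  | arrow_inter (U V₁ V₂ : Nbhd) :
      Incl (.inter (.arrow U V₁) (.arrow U V₂)) (.arrow U (.inter V₁ V₂))
  | con_inter {c : Constr} (U V : Fin c.arity → Nbhd) :
      Incl (.inter (.con c U) (.con c V)) (.con c fun i => .inter (U i) (V i))
  | trans {U₁ U₂ U₃ : Nbhd} : Incl U₁ U₂ → Incl U₂ U₃ → Incl U₁ U₃
  | con {c : Constr} {U V : Fin c.arity → Nbhd} :
      (∀ i, Incl (U i) (V i)) → Incl (.con c U) (.con c V)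
  | refl (U : Nbhd) : Incl U U
  | le_inter {U V₁ V₂ : Nbhd} : Incl U V₁ → Incl U V₂ → Incl U (.inter V₁ V₂)
  | inter_left (V₁ V₂ : Nbhd) : Incl (.inter V₁ V₂) V₁
  | inter_right (V₁ V₂ : Nbhd) : Incl (.inter V₁ V₂) V₂
  | arrow {U₁ V₁ U₂ V₂ : Nbhd} :
      Incl U₂ U₁ → Incl V₁ V₂ → Incl (.arrow U₁ V₁) (.arrow U₂ V₂)

/-- Formal equality. -/
def FEq (U V : Nbhd) : Prop := Incl U V ∧ Incl V U

theorem Incl.nabla_le (U : Nbhd) : Incl .nabla U :=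
  (Incl.nabla_inter U).trans (.inter_right _ _)

theorem Incl.inter_mono {U U' V V' : Nbhd} (h : Incl U U') (h' : Incl V V') :
    Incl (.inter U V) (.inter U' V') :=
  .le_inter ((Incl.inter_left _ _).trans h) ((Incl.inter_right _ _).trans h')

theorem FEq.nabla_inter (U : Nbhd) : FEq (.inter .nabla U) .nabla :=
  ⟨.inter_left _ _, .nabla_inter _⟩

theorem FEq.con_con_ne {c c' : Constr} (U : Fin c.arity → Nbhd) (V : Fin c'.arity → Nbhd)
    (h : c ≠ c') : FEq (.inter (.con c U) (.con c' V)) .nabla :=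
  ⟨.con_con_ne U V h, .nabla_le _⟩

theorem FEq.con_arrow {c : Constr} (U : Fin c.arity → Nbhd) (V W : Nbhd) :
    FEq (.inter (.con c U) (.arrow V W)) .nabla :=
  ⟨.con_arrow U V W, .nabla_le _⟩

theorem FEq.arrow_inter (U V₁ V₂ : Nbhd) :
    FEq (.inter (.arrow U V₁) (.arrow U V₂)) (.arrow U (.inter V₁ V₂)) :=
  ⟨.arrow_inter U V₁ V₂, .le_inter (.arrow (.refl _) (.inter_left _ _))
    (.arrow (.refl _) (.inter_right _ _))⟩

theorem FEq.con_inter {c : Constr} (U V : Fin c.arity → Nbhd) :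
    FEq (.inter (.con c U) (.con c V)) (.con c fun i => .inter (U i) (V i)) :=
  ⟨.con_inter U V, .le_inter (.con fun _ => .inter_left _ _) (.con fun _ => .inter_right _ _)⟩

instance : Preorder Nbhd where
  le := Incl
  le_refl := Incl.refl
  le_trans _ _ _ := Incl.trans

/-- The poset `𝓜` of neighbourhoods up to formal equality. -/
abbrev Nb : Type := Antisymmetrization Nbhd (· ≤ ·)

/-- The class of a neighbourhood. -/
def Nb.mk (U : Nbhd) : Nb := toAntisymmetrization (· ≤ ·) U

/-- The operation `∩` on `𝓜`. -/
def Nb.meet : Nb → Nb → Nb :=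
  Quotient.map₂ Nbhd.inter fun _ _ h _ _ h' =>
    ⟨Incl.inter_mono h.1 h'.1, Incl.inter_mono h.2 h'.2⟩

/-! ## The type system of neighbourhoods -/

/-- The neighbourhood `p(W₀, …, Wₙ₋₁)`. -/
def Pat.toNbhd {n : ℕ} (W : Fin n → Nbhd) : Pat n → Nbhd
  | .var i => W i
  | .con c p => .con c fun i => (p i).toNbhd W

/-- `U₁ → … → Uₖ → V`. -/
def arrows {k : ℕ} (U : Fin k → Nbhd) (V : Nbhd) : Nbhd := (List.ofFn U).foldr Nbhd.arrow V

/-- The left-hand side of the rule `r` matches `U₁, …, Uₖ`, with its variables standing for `W`. -/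
def Rule.Matches {f : DConst} (r : Rule f) (W : Fin r.n → Nbhd) (U : Fin f.arity → Nbhd) : Prop :=
  ∀ i, FEq ((r.lhs i).toNbhd W) (U i)

/-- Contexts assign neighbourhoods to some of the variables. -/
abbrev NCtx : Type := ℕ → Option Nbhd

/-- The context extended by `n` new variables of types `W`, which get the numbers `0, …, n-1`. -/
def NCtx.ext (Γ : NCtx) {n : ℕ} (W : Fin n → Nbhd) : NCtx := fun i =>
  if h : i < n then some (W ⟨i, h⟩) else Γ (i - n)

/-- The judgement `Γ ⊢ M : U` of the type system of neighbourhoods. -/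
inductive NTy : NCtx → Term → Nbhd → Prop
  | var {Γ : NCtx} {i : ℕ} {U : Nbhd} : Γ i = some U → NTy Γ (.var i) U
  | con (Γ : NCtx) (c : Constr) (U : Fin c.arity → Nbhd) : NTy Γ (.con c) (arrows U (.con c U))
  | lam {Γ : NCtx} {M : Term} {U V : Nbhd} :
      NTy (Γ.ext ![U]) M V → NTy Γ (.lam M) (.arrow U V)
  | app {Γ : NCtx} {M N : Term} {U V : Nbhd} :
      NTy Γ N (.arrow U V) → NTy Γ M U → NTy Γ (.app N M) V
  | inter {Γ : NCtx} {M : Term} {U V : Nbhd} :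
      NTy Γ M U → NTy Γ M V → NTy Γ M (.inter U V)
  | sub {Γ : NCtx} {M : Term} {U V : Nbhd} : NTy Γ M V → Incl V U → NTy Γ M U
  | rule {Γ : NCtx} {f : DConst} {r : Rule f} {U : Fin f.arity → Nbhd} {W : Fin r.n → Nbhd}
      {V : Nbhd} :
      r ∈ rules f → r.Matches W U → NTy (Γ.ext W) r.rhs V → NTy Γ (.fn f) (arrows U V)
  | noRule {Γ : NCtx} {f : DConst} {U : Fin f.arity → Nbhd} :
      (∀ r ∈ rules f, ∀ W, ¬ r.Matches W U) → NTy Γ (.fn f) (arrows U .nabla)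

/-- Assigning smaller neighbourhoods to the variables preserves typing. -/
theorem NTy.mono {Γ Γ' : NCtx} {M : Term} {U : Nbhd} (h : NTy Γ M U)
    (hΓ : ∀ i V, Γ i = some V → ∃ V', Γ' i = some V' ∧ Incl V' V) : NTy Γ' M U := by
  have key : ∀ {Γ Γ' : NCtx}, (∀ i V, Γ i = some V → ∃ V', Γ' i = some V' ∧ Incl V' V) →
      ∀ {n : ℕ} (W : Fin n → Nbhd) (i : ℕ) (V : Nbhd), Γ.ext W i = some V →
        ∃ V', Γ'.ext W i = some V' ∧ Incl V' V := by
    intro Γ Γ' hΓ n W i V hV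
    unfold NCtx.ext at hV ⊢
    split_ifs at hV ⊢ with hi
    · exact ⟨V, hV, .refl _⟩
    · exact hΓ _ _ hV
  induction h generalizing Γ' with
  | var h =>
    obtain ⟨V', h1, h2⟩ := hΓ _ _ h
    exact .sub (.var h1) h2
  | con Γ c U => exact .con _ c U
  | lam _ ih => exact .lam (ih (key hΓ _))
  | app _ _ ih₁ ih₂ => exact .app (ih₁ hΓ) (ih₂ hΓ)
  | inter _ _ ih₁ ih₂ => exact .inter (ih₁ hΓ) (ih₂ hΓ)
  | sub _ h ih => exact .sub (ih hΓ) h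
  | rule hr hm _ ih => exact .rule hr hm (ih (key hΓ _))
  | noRule h => exact .noRule h

/-! ## The filter domain and the denotational semantics -/

/-- I-filters over `𝓜` (possibly empty): the elements of the domain `D`. -/
@[ext]
structure IFilter where
  carrier : Set Nb
  meet_mem : ∀ {u v : Nb}, u ∈ carrier → v ∈ carrier → u.meet v ∈ carrier
  up_mem : ∀ {u v : Nb}, u ∈ carrier → u ≤ v → v ∈ carrier

instance : SetLike IFilter Nb where
  coe := IFilter.carrier
  coe_injective _ _ h := IFilter.ext h

/-- I-filters are ordered by inclusion. -/
instance : PartialOrder IFilter := PartialOrder.ofSetLike IFilter Nb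

/-- The least I-filter is the empty one. -/
instance : OrderBot IFilter where
  bot := ⟨∅, fun h => h.elim, fun h => h.elim⟩
  bot_le _ _ h := h.elim

/-- Environments. -/
abbrev Env : Type := ℕ → IFilter

/-- The denotation of `M` in the environment `ρ`: all `U` such that
`x₁ : V₁, …, xₙ : Vₙ ⊢ M : U` for some `Vᵢ ∈ ρ(xᵢ)`, where `FV(M) = {x₁, …, xₙ}`. -/
def sem (M : Term) (ρ : Env) : IFilter where
  carrier := {u | ∃ (Γ : NCtx) (U : Nbhd), (∀ i, (Γ i).isSome ↔ i ∈ M.fv) ∧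
    (∀ i V, Γ i = some V → Nb.mk V ∈ ρ i) ∧ NTy Γ M U ∧ Nb.mk U = u}
  meet_mem := by
    rintro _ _ ⟨Γ, U, hd, hρ, hU, rfl⟩ ⟨Γ', U', hd', hρ', hU', rfl⟩
    have hex : ∀ i V, Γ i = some V → ∃ V', Γ' i = some V' := fun i V h =>
      Option.isSome_iff_exists.1 ((hd' i).2 ((hd i).1 (by simp [h])))
    have hex' : ∀ i V, Γ' i = some V → ∃ V', Γ i = some V' := fun i V h =>
      Option.isSome_iff_exists.1 ((hd i).2 ((hd' i).1 (by simp [h])))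
    refine ⟨fun i => (Γ i).bind fun V => (Γ' i).map fun V' => .inter V V', .inter U U',
      fun i => ?_, fun i V h => ?_, .inter (hU.mono fun i V h => ?_) (hU'.mono fun i V h => ?_),
      rfl⟩
    · rw [← hd i]
      constructor
      · intro h
        cases h1 : Γ i <;> simp_all
      · intro h
        obtain ⟨V, hV⟩ := Option.isSome_iff_exists.1 h
        obtain ⟨V', hV'⟩ := hex i V hV
        simp [hV, hV']
    · cases h1 : Γ i with
      | none => simp [h1] at h
      | some V₁ =>
        obtain ⟨V₂, h2⟩ := hex i V₁ h1
        simp only [h1, h2, Option.bind_some, Option.map_some, Option.some.injEq] at h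
        subst h
        exact (ρ i).meet_mem (hρ i V₁ h1) (hρ' i V₂ h2)
    · obtain ⟨V', hV'⟩ := hex i V h
      exact ⟨.inter V V', by simp [h, hV'], .inter_left _ _⟩
    · obtain ⟨V', hV'⟩ := hex' i V h
      exact ⟨.inter V' V, by simp [h, hV'], .inter_right _ _⟩
  up_mem := by
    rintro _ v ⟨Γ, U, hd, hρ, hU, rfl⟩ hle
    induction v using Quotient.inductionOn with
    | _ V => exact ⟨Γ, V, hd, hρ, .sub hU hle, rfl⟩

end UPL

/-!
The strict semantics `sem` has to be shown nonempty, but it cannot interpret types by itself: since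
`β` and `ι` may discard a subterm denoting `⊥`, convertible types need not have the same strict
denotation. Types are therefore interpreted in a second model, in which nothing is strict: values
are sets of tokens, terms denote Scott continuous functions, and the defined constants are the least
fixed point of the rewrite rules. This graph model validates conversion (`den_conv`).

A term denotes a pair of a strict and a lazy value, and a type is interpreted by a totality
predicate on pairs (`Ty`, `El`), which only depends on the lazy value of the type. Such a predicate
is closed upwards in the strict component, contains all pairs with `∇` in the strict and nothing in
the lazy component (such as the value of `exit` at an argument other than `⊥`), and its elements are
different from `⊥` in the strict component (`Total`). By the closure upwards, only lower bounds for
the strict semantics are needed; the rules of the type system of the domain provide them directly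
(`le_val_app`, `le_val_lam_app`, `val_rhs_le_apps`, `nabla_mem_apps`).

All constants are total (`const_mem`). For `trim`, `get` and the arithmetical constants this is an
induction on the numbers involved. For `Φ` it is bar recursion. If `Φ B H K n v` were not total,
then the vector `v` could be extended by a total element so that `Φ` is not total at the extension
(`safe_of_extensions`), and dependent choice would give an infinite sequence of such extensions. The
functions that `Φ` passes to `K` along this sequence converge to a total function `f`, which
enumerates the components of the vectors. As `K f` is total, a single neighbourhood of `f` makes it
so, and this neighbourhood already contains the functions that occur late in the sequence, which is
a contradiction (`eventually_safe`). If the length `n` is not a numeral, then `less x n` never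
answers `Inr`, and there is no recursive call (`num_le_or_less`).

An induction on derivations shows that well-typed terms denote total elements (`HasType.total`).
In particular a closed one has a nonempty strict denotation.
-/

namespace UPL

/-! ### A graph model of convertibility -/

/-- Tokens of the graph model: the head constructor `c` of a value, a token `t` of the `i`-th
argument of a value with head `c`, and a step function with finite input `l` and output `t`. -/
inductive Tok : Type
  | tag (c : Constr)
  | arg (c : Constr) (i : ℕ) (t : Tok)
  | fn (l : List Tok) (t : Tok)

/-- Values of the graph model: sets of tokens. The least value is `∅`. -/
abbrev LVal : Type := Set Tok

/-- The environment `η` preceded by `a`. -/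
def scons {α : Type} (a : α) (η : ℕ → α) : ℕ → α
  | 0 => a
  | i + 1 => η i

/-- The finite environment listed by `l`. -/
def finEnv (l : List (ℕ × Tok)) : ℕ → LVal := fun i => {x | (i, x) ∈ l}

theorem finEnv_append_left (l l' : List (ℕ × Tok)) : finEnv l ≤ finEnv (l ++ l') :=
  fun _ _ h => List.mem_append_left _ h

theorem finEnv_append_right (l l' : List (ℕ × Tok)) : finEnv l' ≤ finEnv (l ++ l') :=
  fun _ _ h => List.mem_append_right _ h

theorem finEnv_append_le {l l' : List (ℕ × Tok)} {η : ℕ → LVal} (h : finEnv l ≤ η)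
    (h' : finEnv l' ≤ η) : finEnv (l ++ l') ≤ η :=
  fun i _ hx => (List.mem_append.1 hx).elim (fun hx => h i hx) (fun hx => h' i hx)

/-- A Scott-open property of environments: it is preserved by enlarging the environment, and only
depends on finitely many tokens of it. -/
structure ScottOpen (P : (ℕ → LVal) → Prop) : Prop where
  mono : ∀ {η η'}, η ≤ η' → P η → P η'
  fin : ∀ {η}, P η → ∃ l, finEnv l ≤ η ∧ P (finEnv l)

/-- Scott continuity of a function of an environment. -/
def Cont (g : (ℕ → LVal) → LVal) : Prop := ∀ t, ScottOpen fun η => t ∈ g η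

theorem Cont.le {g : (ℕ → LVal) → LVal} (hg : Cont g) {η η' : ℕ → LVal} (h : η ≤ η') :
    g η ≤ g η' := fun t ht => (hg t).mono h ht

namespace ScottOpen

theorem const (p : Prop) : ScottOpen fun _ => p :=
  ⟨fun _ h => h, fun h => ⟨[], fun _ _ hx => by simp [finEnv] at hx, h⟩⟩

theorem coord (i : ℕ) (t : Tok) : ScottOpen fun η => t ∈ η i :=
  ⟨fun h ht => h i ht, fun {η} ht => ⟨[(i, t)], fun j x hx => by
    simp only [finEnv, List.mem_singleton, Prod.mk.injEq, Set.mem_ofPred_eq] at hx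
    obtain ⟨rfl, rfl⟩ := hx
    exact ht, by simp [finEnv]⟩⟩

theorem and {P Q : (ℕ → LVal) → Prop} (hP : ScottOpen P) (hQ : ScottOpen Q) :
    ScottOpen fun η => P η ∧ Q η :=
  ⟨fun h hPQ => ⟨hP.mono h hPQ.1, hQ.mono h hPQ.2⟩, fun h => by
    obtain ⟨l, hl, hp⟩ := hP.fin h.1
    obtain ⟨l', hl', hq⟩ := hQ.fin h.2
    exact ⟨l ++ l', finEnv_append_le hl hl', hP.mono (finEnv_append_left _ _) hp,
      hQ.mono (finEnv_append_right _ _) hq⟩⟩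

theorem exists_ {ι : Sort*} {P : ι → (ℕ → LVal) → Prop} (hP : ∀ i, ScottOpen (P i)) :
    ScottOpen fun η => ∃ i, P i η :=
  ⟨fun h ⟨i, hi⟩ => ⟨i, (hP i).mono h hi⟩, fun ⟨i, hi⟩ =>
    let ⟨l, hl, hp⟩ := (hP i).fin hi
    ⟨l, hl, i, hp⟩⟩

theorem forall_mem {ι : Type*} {P : ι → (ℕ → LVal) → Prop} (hP : ∀ i, ScottOpen (P i))
    (l : List ι) : ScottOpen fun η => ∀ i ∈ l, P i η := by
  induction l with
  | nil => simpa using const True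
  | cons i l ih => simpa using (hP i).and ih

theorem forall_fin {k : ℕ} {P : Fin k → (ℕ → LVal) → Prop} (hP : ∀ i, ScottOpen (P i)) :
    ScottOpen fun η => ∀ i, P i η := by
  simpa using forall_mem hP (List.finRange k)

theorem comp {P : (ℕ → LVal) → Prop} (hP : ScottOpen P) {h : ℕ → (ℕ → LVal) → LVal}
    (hh : ∀ j, Cont (h j)) : ScottOpen fun η => P fun j => h j η :=
  ⟨fun hη hp => hP.mono (fun j => (hh j).le hη) hp, fun hp => by
    obtain ⟨l, hl, hp⟩ := hP.fin hp
    obtain ⟨l', hl', hp'⟩ := (forall_mem (P := fun (q : ℕ × Tok) η => q.2 ∈ h q.1 η)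
      (fun q => hh q.1 q.2) l).fin (fun q hq => hl q.1 hq)
    exact ⟨l', hl', hP.mono (fun j x hx => hp' (j, x) hx) hp⟩⟩

end ScottOpen

theorem Cont.scons {h : (ℕ → LVal) → LVal} (hh : Cont h) :
    ∀ j, Cont fun η => UPL.scons (h η) η j
  | 0 => hh
  | j + 1 => fun t => ScottOpen.coord j t

namespace LVal

/-- Application in the graph model. -/
def app (a b : LVal) : LVal := {t | ∃ l : List Tok, (∀ x ∈ l, x ∈ b) ∧ Tok.fn l t ∈ a}

/-- Iterated application. -/
def apps (a : LVal) (l : List LVal) : LVal := l.foldl app a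

/-- The value with head constructor `c` and arguments `a`. -/
def con (c : Constr) (a : Fin c.arity → LVal) : LVal :=
  {t | t = .tag c ∨ ∃ i : Fin c.arity, ∃ x ∈ a i, t = .arg c i x}

/-- The `i`-th argument of a value with head constructor `c`. -/
def proj (c : Constr) (i : ℕ) (a : LVal) : LVal := {t | .arg c i t ∈ a}

/-- Abstraction of the variable `0`. -/
def lam (g : (ℕ → LVal) → LVal) (η : ℕ → LVal) : LVal :=
  {t | ∃ (l : List Tok) (b : Tok), t = .fn l b ∧ b ∈ g (scons {x | x ∈ l} η)}

/-- Abstraction of the variables `0, …, k-1`; the first argument is the variable `k-1`. -/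
def lamN : ℕ → ((ℕ → LVal) → LVal) → (ℕ → LVal) → LVal
  | 0, g => g
  | k + 1, g => lam (lamN k g)

@[simp] theorem proj_con (c : Constr) (i : Fin c.arity) (a : Fin c.arity → LVal) :
    proj c i (con c a) = a i := by
  ext t
  simp only [proj, con, Set.mem_ofPred_eq, reduceCtorEq, false_or, Tok.arg.injEq, true_and]
  constructor
  · rintro ⟨j, x, hx, hij, rfl⟩
    rwa [Fin.ext hij]
  · exact fun h => ⟨i, t, h, rfl, rfl⟩

@[simp] theorem tag_mem_con {c c' : Constr} {a : Fin c.arity → LVal} :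
    Tok.tag c' ∈ con c a ↔ c' = c := by
  simp [con]

theorem con_injective (c : Constr) : Function.Injective (con c) := fun a b h => by
  funext i
  rw [← proj_con c i a, h, proj_con]

@[simp] theorem empty_app (b : LVal) : app ∅ b = ∅ := by
  ext; simp [app]

theorem app_mono {a a' b b' : LVal} (ha : a ≤ a') (hb : b ≤ b') : app a b ≤ app a' b' :=
  fun _ ⟨l, hl, ht⟩ => ⟨l, fun x hx => hb (hl x hx), ha ht⟩

theorem app_lam {g : (ℕ → LVal) → LVal} (hg : Cont g) (η : ℕ → LVal) (a : LVal) :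
    app (lam g η) a = g (scons a η) := by
  ext t
  constructor
  · rintro ⟨l, hl, l', b, h, hb⟩
    cases h
    refine hg.le ?_ hb
    rintro (_ | i)
    · exact hl
    · exact le_rfl
  · intro ht
    obtain ⟨l, hl, ht⟩ := (hg t).fin ht
    refine ⟨(l.filter fun q => q.1 = 0).map Prod.snd, ?_, _, _, rfl, hg.le ?_ ht⟩
    · intro x hx
      simp only [List.mem_map, List.mem_filter, decide_eq_true_eq] at hx
      obtain ⟨⟨_, _⟩, ⟨h, rfl⟩, rfl⟩ := hx
      exact hl 0 h
    · rintro (_ | i) x hx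
      · have hx : (0, x) ∈ l := hx
        simpa [scons] using hx
      · exact hl (i + 1) hx

end LVal

theorem Cont.lam {g : (ℕ → LVal) → LVal} (hg : Cont g) : Cont (LVal.lam g) := fun _ =>
  .exists_ fun l => .exists_ fun b => .and (.const _)
    ((hg b).comp (h := fun j η => UPL.scons {x | x ∈ l} η j) (Cont.scons fun _ => .const _))

theorem Cont.lamN {g : (ℕ → LVal) → LVal} (hg : Cont g) : ∀ k, Cont (LVal.lamN k g)
  | 0 => hg
  | k + 1 => (hg.lamN k).lam

theorem Cont.app {g h : (ℕ → LVal) → LVal} (hg : Cont g) (hh : Cont h) :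
    Cont fun η => LVal.app (g η) (h η) := fun _ =>
  .exists_ fun l => .and (.forall_mem (fun x => hh x) l) (hg _)

/-- The environment `η` preceded by the arguments `l`, the last of which becomes the variable
`0`. -/
def pushes (η : ℕ → LVal) (l : List LVal) : ℕ → LVal := l.foldl (fun η a => scons a η) η

theorem pushes_apply (η : ℕ → LVal) (l : List LVal) (i : ℕ) (hi : i < l.length) :
    pushes η l (l.length - 1 - i) = l[i] := by
  induction l using List.reverseRecOn with
  | nil => simp at hi
  | append_singleton l a ih =>
    simp only [pushes, List.foldl_append, List.foldl_cons, List.foldl_nil] at ih ⊢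
    simp only [List.length_append, List.length_singleton] at hi ⊢
    rcases Nat.lt_succ_iff_lt_or_eq.1 hi with h | rfl
    · rw [show l.length + 1 - 1 - i = (l.length - 1 - i) + 1 by omega, List.getElem_append_left h]
      exact ih h
    · simp [scons]

theorem LVal.apps_lamN {g : (ℕ → LVal) → LVal} (hg : Cont g) (η : ℕ → LVal) (l : List LVal) :
    apps (lamN l.length g η) l = g (pushes η l) := by
  induction l generalizing η with
  | nil => rfl
  | cons a l ih =>
    simp only [apps, pushes, List.length_cons, List.foldl_cons, lamN] at ih ⊢
    rw [app_lam (hg.lamN _), ih]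

/-- The values of the arguments of an abstraction of `k` variables. -/
def args (k : ℕ) (η : ℕ → LVal) : Fin k → LVal := fun i => η (k - 1 - i)

theorem LVal.apps_lamN_ofFn {k : ℕ} {g : (Fin k → LVal) → LVal}
    (hg : Cont fun η => g (args k η)) (η : ℕ → LVal) (a : Fin k → LVal) :
    apps (lamN k (fun η => g (args k η)) η) (List.ofFn a) = g a := by
  have h := apps_lamN hg η (List.ofFn a)
  rw [List.length_ofFn] at h
  rw [h]
  congr 1
  funext i
  have h' := pushes_apply η (List.ofFn a) i (by simp)
  simpa [args] using h'

theorem cont_args (k : ℕ) (i : Fin k) : Cont fun η => args k η i := fun t => .coord _ t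

namespace Pat

variable {n : ℕ}

/-- The value of a pattern. -/
def lval (w : Fin n → LVal) : Pat n → LVal
  | .var i => w i
  | .con c p => .con c fun i => (p i).lval w

/-- The value `a` has the constructors that the pattern asks for. -/
def Fits : Pat n → LVal → Prop
  | .var _, _ => True
  | .con c p, a => .tag c ∈ a ∧ ∀ i, (p i).Fits (.proj c i a)

/-- The part of `a` that is matched by the pattern variable `j`. -/
def bind : Pat n → LVal → Fin n → LVal
  | .var i, a, j => {t | i = j ∧ t ∈ a}
  | .con c p, a, j => {t | ∃ i, t ∈ (p i).bind (.proj c i a) j}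

/-- The variable `j` occurs in the pattern. -/
def occ (j : Fin n) : Pat n → Bool
  | .var i => i = j
  | .con _ p => decide (∃ i, (p i).occ j = true)

/-- The patterns have different constructors at some position. -/
def clash {m : ℕ} : Pat n → Pat m → Bool
  | .con c p, .con c' q =>
    if h : c = c' then decide (∃ i, (p i).clash (q (h ▸ i)) = true) else true
  | _, _ => false

theorem fits_lval (w : Fin n → LVal) (p : Pat n) : p.Fits (p.lval w) := by
  induction p with
  | var i => trivial
  | con c p ih => exact ⟨by simp [lval], fun i => by simpa [lval] using ih i⟩

theorem bind_lval_le (w : Fin n → LVal) (p : Pat n) (j : Fin n) : p.bind (p.lval w) j ≤ w j := by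
  induction p with
  | var i =>
    rintro t ⟨rfl, h⟩
    exact h
  | con c p ih =>
    rintro t ⟨i, h⟩
    simp only [lval, LVal.proj_con] at h
    exact ih i h

theorem le_bind_lval (w : Fin n → LVal) (p : Pat n) (j : Fin n) (h : p.occ j = true) :
    w j ≤ p.bind (p.lval w) j := by
  induction p with
  | var i =>
    intro t ht
    have h : i = j := by simpa [occ] using h
    exact ⟨h, h ▸ ht⟩
  | con c p ih =>
    simp only [occ, decide_eq_true_eq] at h
    obtain ⟨i, hi⟩ := h
    intro t ht
    refine ⟨i, ?_⟩
    simp only [lval, LVal.proj_con]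
    exact ih i hi ht

theorem not_fits_of_clash {m : ℕ} (w : Fin n → LVal) (p : Pat n) (q : Pat m)
    (h : p.clash q = true) : ¬ q.Fits (p.lval w) := by
  induction p generalizing q with
  | var i => simp [clash] at h
  | con c p ih =>
    cases q with
    | var i => simp [clash] at h
    | con c' q =>
      rintro ⟨h1, h2⟩
      simp only [lval, LVal.tag_mem_con] at h1
      subst h1
      simp only [clash, dite_true, decide_eq_true_eq] at h
      obtain ⟨i, hi⟩ := h
      refine ih i _ hi ?_
      simpa [lval] using h2 i

theorem scottOpen_fits (p : Pat n) {a : (ℕ → LVal) → LVal} (ha : Cont a) :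
    ScottOpen fun η => p.Fits (a η) := by
  induction p generalizing a with
  | var i => exact .const True
  | con c p ih => exact (ha _).and (.forall_fin fun i => ih i fun t => ha (.arg c i t))

theorem cont_bind (p : Pat n) (j : Fin n) {a : (ℕ → LVal) → LVal} (ha : Cont a) :
    Cont fun η => p.bind (a η) j := by
  induction p generalizing a with
  | var i => exact fun t => .and (.const _) (ha t)
  | con c p ih => exact fun t => .exists_ fun i => ih i (fun t => ha (.arg c i t)) t

end Pat

/-- The environment of the right-hand side of a rule; the variables that are not pattern variables
get the value `d`. -/
def envOf {α : Type} (d : α) {n : ℕ} (w : Fin n → α) : ℕ → α :=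
  fun j => if h : j < n then w ⟨j, h⟩ else d

/-- The value of a constructor as a function of its arguments. -/
def conVal (c : Constr) : LVal :=
  .lamN c.arity (fun η => .con c (args c.arity η)) fun _ => ∅

theorem cont_con (c : Constr) : Cont fun η => LVal.con c (args c.arity η) := fun _ => by
  refine ⟨fun h => ?_, fun {η} h => ?_⟩
  · rintro (rfl | ⟨i, x, hx, rfl⟩)
    · exact Or.inl rfl
    · exact Or.inr ⟨i, x, (cont_args _ i).le h hx, rfl⟩
  · rcases h with rfl | ⟨i, x, hx, rfl⟩
    · exact ⟨[], fun _ _ hx => by simp [finEnv] at hx, Or.inl rfl⟩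
    · obtain ⟨l, hl, hx⟩ := (cont_args _ i x).fin hx
      exact ⟨l, hl, Or.inr ⟨i, x, hx, rfl⟩⟩

/-- The interpretation of terms in the graph model, for a given interpretation `φ` of the defined
constants. -/
def denOf (φ : DConst → LVal) : Term → (ℕ → LVal) → LVal
  | .var i, η => η i
  | .lam M, η => .lam (denOf φ M) η
  | .app M N, η => .app (denOf φ M η) (denOf φ N η)
  | .con c, _ => conVal c
  | .fn f, _ => φ f

theorem cont_denOf (φ : DConst → LVal) (M : Term) : Cont (denOf φ M) := by
  induction M with
  | var i => exact fun t => .coord i t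
  | lam M ih => exact ih.lam
  | app M N ih ih' => exact ih.app ih'
  | con c => exact fun t => .const _
  | fn f => exact fun t => .const _

/-- The value of `f` at the arguments `a`: the union of the right-hand sides of the rules whose
patterns fit. -/
def fnBody (φ : DConst → LVal) (f : DConst) (a : Fin f.arity → LVal) : LVal :=
  {t | ∃ r ∈ rules f, (∀ i, (r.lhs i).Fits (a i)) ∧
    t ∈ denOf φ r.rhs (envOf ∅ fun j => {t | ∃ i, t ∈ (r.lhs i).bind (a i) j})}

theorem cont_fnBody (φ : DConst → LVal) (f : DConst) :
    Cont fun η => fnBody φ f (args f.arity η) := fun t =>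
  .exists_ fun r => .and (.const _) <| .and
    (.forall_fin fun i => (r.lhs i).scottOpen_fits (cont_args _ i)) <|
    (cont_denOf φ r.rhs t).comp
      (h := fun j η => envOf ∅ (fun j => {t | ∃ i, t ∈ (r.lhs i).bind (args f.arity η i) j}) j)
      fun j => by
        unfold envOf
        split_ifs with h
        · exact fun t => .exists_ fun i => (r.lhs i).cont_bind _ (cont_args _ i) t
        · exact fun t => .const _

theorem denOf_mono {φ φ' : DConst → LVal} (h : φ ≤ φ') (M : Term) : denOf φ M ≤ denOf φ' M := by
  induction M with
  | var i => exact le_rfl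
  | lam M ih =>
    rintro η _ ⟨l, b, rfl, hb⟩
    exact ⟨l, b, rfl, ih _ hb⟩
  | app M N ih ih' => exact fun η => LVal.app_mono (ih η) (ih' η)
  | con c => exact le_rfl
  | fn f => exact fun η => h f

theorem LVal.lamN_mono {g g' : (ℕ → LVal) → LVal} (h : g ≤ g') : ∀ k, lamN k g ≤ lamN k g'
  | 0 => h
  | k + 1 => by
    rintro η _ ⟨l, b, rfl, hb⟩
    exact ⟨l, b, rfl, lamN_mono h k _ hb⟩

/-- The rewrite rules as a monotone operator on interpretations of the defined constants. -/
def ruleOp : (DConst → LVal) →o (DConst → LVal) where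
  toFun φ f := .lamN f.arity (fun η => fnBody φ f (args f.arity η)) fun _ => ∅
  monotone' φ φ' h f := LVal.lamN_mono
    (by rintro η t ⟨r, hr, hf, ht⟩; exact ⟨r, hr, hf, denOf_mono h _ _ ht⟩) _ _

/-- The interpretation of the defined constants: the least fixed point of the rewrite rules. -/
def fnVal : DConst → LVal := OrderHom.lfp ruleOp

/-- The interpretation of terms in the graph model. -/
def den : Term → (ℕ → LVal) → LVal := denOf fnVal

@[simp] theorem den_app (M N : Term) (η : ℕ → LVal) :
    den (.app M N) η = .app (den M η) (den N η) := rfl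
@[simp] theorem den_con (c : Constr) (η : ℕ → LVal) : den (.con c) η = conVal c := rfl
@[simp] theorem den_fn (f : DConst) (η : ℕ → LVal) : den (.fn f) η = fnVal f := rfl
theorem den_lam (M : Term) (η : ℕ → LVal) : den (.lam M) η = .lam (den M) η := rfl

@[simp] theorem app_den_lam (M : Term) (η : ℕ → LVal) (a : LVal) :
    LVal.app (den (.lam M) η) a = den M (scons a η) :=
  LVal.app_lam (cont_denOf _ M) η a

theorem den_apps (M : Term) (l : List Term) (η : ℕ → LVal) :
    den (.apps M l) η = .apps (den M η) (l.map fun N => den N η) := by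
  induction l generalizing M with
  | nil => rfl
  | cons N l ih => exact ih (.app M N)

theorem apps_conVal (c : Constr) (a : Fin c.arity → LVal) :
    LVal.apps (conVal c) (List.ofFn a) = .con c a :=
  LVal.apps_lamN_ofFn (cont_con c) _ a

theorem apps_fnVal (f : DConst) (a : Fin f.arity → LVal) :
    LVal.apps (fnVal f) (List.ofFn a) = fnBody fnVal f a := by
  have h : fnVal f = ruleOp fnVal f := by rw [fnVal, OrderHom.map_lfp]
  rw [h]
  exact LVal.apps_lamN_ofFn (cont_fnBody fnVal f) _ a

/-! ### Soundness of the graph model for conversion -/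

theorem den_congr {M : Term} {η η' : ℕ → LVal} (h : ∀ i ∈ M.fv, η i = η' i) :
    den M η = den M η' := by
  induction M generalizing η η' with
  | var i => exact h i rfl
  | lam M ih =>
    have h' : ∀ a, den M (scons a η) = den M (scons a η') := fun a => ih fun i hi => by
      cases i with
      | zero => rfl
      | succ i => exact h i hi
    ext t
    simp only [den_lam, LVal.lam, h']
  | app M N ih ih' =>
    simp only [den_app, ih fun i hi => h i (.inl hi), ih' fun i hi => h i (.inr hi)]
  | con c => rfl
  | fn f => rfl

theorem den_rename (M : Term) (r : ℕ → ℕ) (η : ℕ → LVal) :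
    den (M.rename r) η = den M fun i => η (r i) := by
  induction M generalizing r η with
  | var i => rfl
  | lam M ih =>
    simp only [Term.rename, den_lam, LVal.lam, ih]
    have h : ∀ a : LVal, (fun i => scons a η (Term.liftRen r i)) = scons a fun i => η (r i) :=
      fun a => by funext i; cases i <;> rfl
    simp only [h]
  | app M N ih ih' => simp only [Term.rename, den_app, ih, ih']
  | con c => rfl
  | fn f => rfl

@[simp] theorem den_shift (M : Term) (k : ℕ) (η : ℕ → LVal) :
    den (M.shift k) η = den M fun i => η (i + k) := den_rename M _ η

theorem den_subst (M : Term) (s : ℕ → Term) (η : ℕ → LVal) :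
    den (M.subst s) η = den M fun i => den (s i) η := by
  induction M generalizing s η with
  | var i => rfl
  | lam M ih =>
    simp only [Term.subst, den_lam, LVal.lam, ih]
    have h : ∀ a : LVal, (fun i => den (Term.liftSub s i) (scons a η)) =
        scons a fun i => den (s i) η := fun a => by
      funext i
      cases i with
      | zero => rfl
      | succ i => exact den_shift _ _ _
    simp only [h]
  | app M N ih ih' => simp only [Term.subst, den_app, ih, ih']
  | con c => rfl
  | fn f => rfl

theorem den_inst (B M : Term) (η : ℕ → LVal) : den (B.inst M) η = den B (scons (den M η) η) := by
  rw [Term.inst, den_subst]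
  congr 1
  funext i
  cases i <;> rfl

theorem occ_lhs (f : DConst) : ∀ r ∈ rules f, ∀ j : Fin r.n, ∃ i, (r.lhs i).occ j = true := by
  cases f <;> decide

/-- The rules of a constant are mutually exclusive. -/
theorem lhs_clash (f : DConst) :
    (rules f).Pairwise fun r r' => ∃ i, (r.lhs i).clash (r'.lhs i) = true ∧
      (r'.lhs i).clash (r.lhs i) = true := by
  cases f <;> decide

/-- The free variables of the term are less than `n`. -/
def Term.closedAt : ℕ → Term → Bool
  | n, .var i => i < n
  | n, .lam M => closedAt (n + 1) M
  | n, .app M N => closedAt n M && closedAt n N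
  | _, .con _ => true
  | _, .fn _ => true

theorem Term.lt_of_closedAt {n : ℕ} {M : Term} (h : M.closedAt n = true) {i : ℕ} (hi : i ∈ M.fv) :
    i < n := by
  induction M generalizing n i with
  | var j =>
    rw [Set.mem_singleton_iff.1 hi]
    simpa [closedAt] using h
  | lam M ih => exact Nat.lt_of_succ_lt_succ (ih h hi)
  | app M N ih ih' =>
    simp only [closedAt, Bool.and_eq_true] at h
    exact hi.elim (ih h.1) (ih' h.2)
  | con c => exact hi.elim
  | fn f => exact hi.elim

theorem closedAt_rhs (f : DConst) : ∀ r ∈ rules f, r.rhs.closedAt r.n = true := by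
  cases f <;> decide

/-- The graph model satisfies the rewrite rules: no other rule fits the same arguments. -/
theorem apps_fnVal_rule {f : DConst} {r : Rule f} (hr : r ∈ rules f) (w : Fin r.n → LVal) :
    LVal.apps (fnVal f) (List.ofFn fun i => (r.lhs i).lval w) = den r.rhs (envOf ∅ w) := by
  rw [apps_fnVal]
  have hw : (fun j => {t | ∃ i, t ∈ (r.lhs i).bind ((r.lhs i).lval w) j}) = w := by
    funext j
    obtain ⟨i, hi⟩ := occ_lhs f r hr j
    exact Set.Subset.antisymm (fun t ⟨i, ht⟩ => (r.lhs i).bind_lval_le w j ht)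
      fun t ht => ⟨i, (r.lhs i).le_bind_lval w j hi ht⟩
  ext t
  constructor
  · rintro ⟨r', hr', hf, ht⟩
    have h : r = r' := by
      by_contra hne
      have : Std.Symm fun r r' : Rule f => ∃ i, (r.lhs i).clash (r'.lhs i) = true ∧
          (r'.lhs i).clash (r.lhs i) = true := ⟨fun _ _ ⟨i, hi⟩ => ⟨i, hi.symm⟩⟩
      obtain ⟨i, hi, -⟩ := (lhs_clash f).forall hr hr' hne
      exact Pat.not_fits_of_clash w _ _ hi (hf i)
    subst h
    rw [hw] at ht
    exact ht
  · intro ht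
    refine ⟨r, hr, fun i => (r.lhs i).fits_lval w, ?_⟩
    rw [hw]
    exact ht

theorem apps_fnVal_stuck {f : DConst} {a : Fin f.arity → LVal}
    (h : ∀ r ∈ rules f, ∃ i, ¬ (r.lhs i).Fits (a i)) : LVal.apps (fnVal f) (List.ofFn a) = ∅ := by
  rw [apps_fnVal]
  refine Set.eq_empty_of_forall_notMem ?_
  rintro t ⟨r, hr, hf, -⟩
  obtain ⟨i, hi⟩ := h r hr
  exact hi (hf i)

theorem den_toTerm {n : ℕ} (s : Fin n → Term) (p : Pat n) (η : ℕ → LVal) :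
    den (p.toTerm s) η = p.lval fun i => den (s i) η := by
  induction p with
  | var i => rfl
  | con c p ih =>
    simp only [Pat.toTerm, Pat.lval, den_apps, List.map_ofFn, den_con, ← apps_conVal]
    congr 2
    funext i
    exact ih i

theorem den_step {M N : Term} (h : Step M N) : ∀ η, den M η = den N η := by
  induction h with
  | beta M N => exact fun η => by rw [den_app, app_den_lam, den_inst]
  | @iota f r hr s =>
    intro η
    rw [den_apps, List.map_ofFn, den_fn, den_subst]
    have h : ((fun N => den N η) ∘ fun i => (r.lhs i).toTerm s) =
        fun i => (r.lhs i).lval fun j => den (s j) η := funext fun i => den_toTerm s _ η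
    rw [h, apps_fnVal_rule hr]
    refine den_congr fun i hi => ?_
    have hi := Term.lt_of_closedAt (closedAt_rhs f r hr) hi
    simp [envOf, patSub, hi]
  | lam _ ih => exact fun η => by simp only [den_lam, LVal.lam, ih]
  | appL _ ih => exact fun η => by simp only [den_app, ih]
  | appR _ ih => exact fun η => by simp only [den_app, ih]

theorem den_conv {A B : Term} (h : Conv A B) (η : ℕ → LVal) : den A η = den B η := by
  induction h with
  | rel _ _ h => exact den_step h η
  | refl _ => rfl
  | symm _ _ _ ih => exact ih.symm
  | trans _ _ _ _ _ ih ih' => exact ih.trans ih'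

/-! ### Lower bounds for the strict semantics -/

/-- Possibly empty filters of formal neighbourhoods. They are the I-filters of the domain, with
neighbourhoods instead of their classes. -/
@[ext]
structure Filt where
  carrier : Set Nbhd
  inter_mem : ∀ {U V : Nbhd}, U ∈ carrier → V ∈ carrier → .inter U V ∈ carrier
  up_mem : ∀ {U V : Nbhd}, U ∈ carrier → Incl U V → V ∈ carrier

namespace Filt

instance : SetLike Filt Nbhd where
  coe := Filt.carrier
  coe_injective _ _ h := Filt.ext h

instance : PartialOrder Filt := PartialOrder.ofSetLike Filt Nbhd

instance : OrderBot Filt where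
  bot := ⟨∅, fun h => h.elim, fun h => h.elim⟩
  bot_le _ _ h := h.elim

instance : OrderTop Filt where
  top := ⟨Set.univ, fun _ _ => trivial, fun _ _ => trivial⟩
  le_top _ _ _ := trivial

/-- The filter has an element, i.e. it is not the least one. -/
def Nonempty (d : Filt) : Prop := ∃ U, U ∈ d

/-- Application, which is strict in both arguments. -/
def app (a b : Filt) : Filt where
  carrier := {V | ∃ U ∈ b, .arrow U V ∈ a}
  inter_mem := by
    rintro V V' ⟨U, hU, h⟩ ⟨U', hU', h'⟩
    exact ⟨.inter U U', b.inter_mem hU hU', a.up_mem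
      (a.inter_mem (a.up_mem h (.arrow (.inter_left _ _) (.refl _)))
        (a.up_mem h' (.arrow (.inter_right _ _) (.refl _)))) (.arrow_inter _ _ _)⟩
  up_mem := by
    rintro V V' ⟨U, hU, h⟩ hV
    exact ⟨U, hU, a.up_mem h (.arrow (.refl _) hV)⟩

/-- Iterated application. -/
def apps (a : Filt) (l : List Filt) : Filt := l.foldl app a

theorem app_mono {a a' b b' : Filt} (ha : a ≤ a') (hb : b ≤ b') : app a b ≤ app a' b' :=
  fun _ ⟨U, hU, h⟩ => ⟨U, hb hU, ha h⟩

/-- The filter with head constructor `c` and arguments `a`. -/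
def con (c : Constr) (a : Fin c.arity → Filt) : Filt where
  carrier := {V | ∃ U : Fin c.arity → Nbhd, (∀ i, U i ∈ a i) ∧ Incl (.con c U) V}
  inter_mem := by
    rintro V V' ⟨U, hU, h⟩ ⟨U', hU', h'⟩
    exact ⟨fun i => .inter (U i) (U' i), fun i => (a i).inter_mem (hU i) (hU' i),
      .le_inter (.trans (.con fun i => .inter_left _ _) h)
        (.trans (.con fun i => .inter_right _ _) h')⟩
  up_mem := by
    rintro V V' ⟨U, hU, h⟩ hV
    exact ⟨U, hU, h.trans hV⟩

theorem con_mono {c : Constr} {a a' : Fin c.arity → Filt} (h : ∀ i, a i ≤ a' i) :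
    con c a ≤ con c a' := fun _ ⟨U, hU, hV⟩ => ⟨U, fun i => h i (hU i), hV⟩

/-- The principal filter of a neighbourhood. -/
def prin (U : Nbhd) : Filt where
  carrier := {V | Incl U V}
  inter_mem := .le_inter
  up_mem := .trans

theorem mem_apps_of_arrows {d : Filt} {k : ℕ} {U : Fin k → Nbhd} {V : Nbhd}
    {a : Fin k → Filt} (h : arrows U V ∈ d) (hU : ∀ i, U i ∈ a i) :
    V ∈ d.apps (List.ofFn a) := by
  induction k generalizing d with
  | zero => simpa [apps, arrows] using h
  | succ k ih =>
    simp only [List.ofFn_succ, apps, List.foldl_cons, arrows, List.foldr_cons] at h ⊢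
    exact ih ⟨_, hU 0, h⟩ fun i => hU i.succ

end Filt

/-- The contexts `Γ` and `Γ'` taken together. -/
def NCtx.merge (Γ Γ' : NCtx) : NCtx := fun i => (Γ i).merge Nbhd.inter (Γ' i)

theorem NTy.merge_left {Γ Γ' : NCtx} {M : Term} {U : Nbhd} (h : NTy Γ M U) :
    NTy (Γ.merge Γ') M U := h.mono fun i V hV => by
  cases h' : Γ' i with
  | none => exact ⟨V, by simp [NCtx.merge, hV, h'], .refl _⟩
  | some V' => exact ⟨.inter V V', by simp [NCtx.merge, hV, h'], .inter_left _ _⟩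

theorem NTy.merge_right {Γ Γ' : NCtx} {M : Term} {U : Nbhd} (h : NTy Γ' M U) :
    NTy (Γ.merge Γ') M U := h.mono fun i V hV => by
  cases h' : Γ i with
  | none => exact ⟨V, by simp [NCtx.merge, hV, h'], .refl _⟩
  | some V' => exact ⟨.inter V' V, by simp [NCtx.merge, hV, h'], .inter_right _ _⟩

/-- The neighbourhoods of the context belong to the environment. -/
def NCtx.Within (Γ : NCtx) (ρ : ℕ → Filt) : Prop := ∀ i V, Γ i = some V → V ∈ ρ i

theorem NCtx.Within.merge {Γ Γ' : NCtx} {ρ : ℕ → Filt} (h : Γ.Within ρ) (h' : Γ'.Within ρ) :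
    (Γ.merge Γ').Within ρ := fun i V hV => by
  cases h1 : Γ i with
  | none => cases h2 : Γ' i with
    | none => simp [NCtx.merge, h1, h2] at hV
    | some V' =>
      simp only [NCtx.merge, h1, h2, Option.merge_none_left, Option.some.injEq] at hV
      exact hV ▸ h' i V' h2
  | some V' => cases h2 : Γ' i with
    | none =>
      simp only [NCtx.merge, h1, h2, Option.merge_none_right, Option.some.injEq] at hV
      exact hV ▸ h i V' h1
    | some V'' =>
      simp only [NCtx.merge, h1, h2, Option.merge_some_some, Option.some.injEq] at hV
      exact hV ▸ (ρ i).inter_mem (h i V' h1) (h' i V'' h2)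

/-- The strict denotation of a term. In contrast to `sem`, the contexts may also mention variables
that are not free in the term, and may omit some that are. -/
def val (M : Term) (ρ : ℕ → Filt) : Filt where
  carrier := {U | ∃ Γ : NCtx, Γ.Within ρ ∧ NTy Γ M U}
  inter_mem := by
    rintro U V ⟨Γ, hΓ, h⟩ ⟨Γ', hΓ', h'⟩
    exact ⟨Γ.merge Γ', hΓ.merge hΓ', .inter h.merge_left h'.merge_right⟩
  up_mem := by
    rintro U V ⟨Γ, hΓ, h⟩ hV
    exact ⟨Γ, hΓ, .sub h hV⟩

theorem val_mono (M : Term) {ρ ρ' : ℕ → Filt} (h : ρ ≤ ρ') : val M ρ ≤ val M ρ' :=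
  fun _ ⟨Γ, hΓ, hU⟩ => ⟨Γ, fun i V hV => h i (hΓ i V hV), hU⟩

theorem le_val_var (i : ℕ) (ρ : ℕ → Filt) : ρ i ≤ val (.var i) ρ := fun U hU => by
  refine ⟨fun j => if j = i then some U else none, fun j V hV => ?_, .var (by simp)⟩
  by_cases h : j = i <;> simp_all

theorem le_val_app (M N : Term) (ρ : ℕ → Filt) :
    (val M ρ).app (val N ρ) ≤ val (.app M N) ρ := by
  rintro V ⟨U, ⟨Γ, hΓ, h⟩, Γ', hΓ', h'⟩
  exact ⟨Γ.merge Γ', hΓ.merge hΓ', .app h'.merge_right h.merge_left⟩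

theorem arrow_mem_val_lam {M : Term} {ρ : ℕ → Filt} {U V : Nbhd}
    (h : V ∈ val M (scons (.prin U) ρ)) : .arrow U V ∈ val (.lam M) ρ := by
  obtain ⟨Γ, hΓ, h⟩ := h
  refine ⟨fun i => Γ (i + 1), fun i V hV => hΓ (i + 1) V hV, .lam (h.mono fun i V hV => ?_)⟩
  cases i with
  | zero => exact ⟨U, by simp [NCtx.ext], hΓ 0 V hV⟩
  | succ i => exact ⟨V, by simp [NCtx.ext, hV], .refl _⟩

/-- Half of the `β`-rule. It fails for `d = ⊥`, since application is strict and the variable need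
not occur in `M`. -/
theorem le_val_lam_app (M : Term) (ρ : ℕ → Filt) {d : Filt} (hd : d.Nonempty) :
    val M (scons d ρ) ≤ (val (.lam M) ρ).app d := by
  rintro V ⟨Γ, hΓ, h⟩
  obtain ⟨U, hU, hΓU⟩ : ∃ U ∈ d, ∀ V, Γ 0 = some V → V = U := by
    cases h0 : Γ 0 with
    | none => exact ⟨hd.choose, hd.choose_spec, fun V hV => by simp at hV⟩
    | some U => exact ⟨U, hΓ 0 U h0, fun V hV => by simpa using hV.symm⟩
  refine ⟨U, hU, arrow_mem_val_lam ⟨Γ, ?_, h⟩⟩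
  rintro (_ | i) V hV
  · rw [hΓU V hV]
    exact Incl.refl U
  · exact hΓ (i + 1) V hV

/-- The strict value of a constructor. -/
def conFilt (c : Constr) : Filt := val (.con c) fun _ => ⊥

/-- The strict value of a defined constant. -/
def fnFilt (f : DConst) : Filt := val (.fn f) fun _ => ⊥

theorem con_le_apps (c : Constr) (a : Fin c.arity → Filt) :
    Filt.con c a ≤ (conFilt c).apps (List.ofFn a) := by
  rintro V ⟨U, hU, hV⟩
  refine Filt.up_mem _ (Filt.mem_apps_of_arrows ?_ hU) hV
  exact ⟨fun _ => none, fun i V hV => by simp at hV, .con _ c U⟩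

/-- The filter of a pattern. -/
def Pat.filt {n : ℕ} (w : Fin n → Filt) : Pat n → Filt
  | .var i => w i
  | .con c p => .con c fun i => (p i).filt w

theorem Pat.toNbhd_mem_filt {n : ℕ} {w : Fin n → Filt} {W : Fin n → Nbhd} (h : ∀ j, W j ∈ w j)
    (p : Pat n) : p.toNbhd W ∈ p.filt w := by
  induction p with
  | var i => exact h i
  | con c p ih => exact ⟨_, ih, .refl _⟩

theorem val_rhs_le_apps {f : DConst} {r : Rule f} (hr : r ∈ rules f) {w : Fin r.n → Filt}
    (hw : ∀ j, (w j).Nonempty) {a : Fin f.arity → Filt} (ha : ∀ i, (r.lhs i).filt w ≤ a i) :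
    val r.rhs (envOf ⊥ w) ≤ (fnFilt f).apps (List.ofFn a) := by
  rintro V ⟨Γ, hΓ, h⟩
  let W : Fin r.n → Nbhd := fun j => (Γ j).getD (hw j).choose
  have hW : ∀ j, W j ∈ w j := fun j => by
    cases h0 : Γ j with
    | none => simpa [W, h0] using (hw j).choose_spec
    | some U => simpa [W, h0, envOf] using hΓ j U h0
  refine Filt.mem_apps_of_arrows (U := fun i => (r.lhs i).toNbhd W) ?_
    fun i => ha i (Pat.toNbhd_mem_filt hW _)
  refine ⟨fun _ => none, fun i V hV => by simp at hV,
    .rule hr (fun i => ⟨.refl _, .refl _⟩) (h.mono fun i V hV => ?_)⟩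
  by_cases hi : i < r.n
  · exact ⟨W ⟨i, hi⟩, by simp [NCtx.ext, hi], by simp [W, hV, Incl.refl]⟩
  · have := hΓ i V hV
    simp only [envOf, hi, dite_false] at this
    exact this.elim

/-- The head of a neighbourhood: `none` for `∇`, `some (some c)` for a constructor and `some none`
for a function. -/
def Nbhd.kind : Nbhd → Option (Option Constr)
  | .nabla => none
  | .con c _ => some (some c)
  | .arrow _ _ => some none
  | .inter U V => if U.kind = V.kind then U.kind else none

theorem Incl.kind {U V : Nbhd} (h : Incl U V) : U.kind = none ∨ U.kind = V.kind := by
  induction h with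
  | nabla_inter => exact .inl rfl
  | con_con_ne U V h => simp [Nbhd.kind, h]
  | con_arrow => simp [Nbhd.kind]
  | arrow_inter => simp [Nbhd.kind]
  | con_inter => simp [Nbhd.kind]
  | trans _ _ ih ih' =>
    rcases ih with ih | ih
    · exact .inl ih
    · rwa [ih]
  | con => exact .inr rfl
  | refl => exact .inr rfl
  | le_inter _ _ ih ih' =>
    rcases ih with ih | ih
    · exact .inl ih
    rcases ih' with ih' | ih'
    · exact .inl ih'
    · simp only [Nbhd.kind, ← ih, ← ih', if_true, or_true]
  | inter_left V₁ V₂ => simp only [Nbhd.kind]; split_ifs <;> simp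
  | inter_right V₁ V₂ => simp only [Nbhd.kind]; split_ifs with h <;> simp [h]
  | arrow => exact .inr rfl

theorem FEq.kind_eq {U V : Nbhd} (h : FEq U V) : U.kind = V.kind := by
  rcases h.1.kind with h1 | h1
  · rcases h.2.kind with h2 | h2
    · rw [h1, h2]
    · exact h2.symm
  · exact h1

/-- The neighbourhood does not have the head constructor that the pattern asks for. -/
def Pat.Rejects {n : ℕ} : Pat n → Nbhd → Prop
  | .var _, _ => False
  | .con c _, U => U.kind ≠ some (some c)

theorem nabla_mem_apps {f : DConst} {U : Fin f.arity → Nbhd} {a : Fin f.arity → Filt}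
    (hU : ∀ i, U i ∈ a i) (h : ∀ r ∈ rules f, ∃ i, (r.lhs i).Rejects (U i)) :
    Nbhd.nabla ∈ (fnFilt f).apps (List.ofFn a) := by
  refine Filt.mem_apps_of_arrows ?_ hU
  refine ⟨fun _ => none, fun i V hV => by simp at hV, .noRule fun r hr W hm => ?_⟩
  obtain ⟨i, hi⟩ := h r hr
  have hk := (hm i).kind_eq
  cases hp : r.lhs i with
  | var j => rwa [hp] at hi
  | con c p =>
    rw [hp] at hi hk
    exact hi hk.symm

/-! ### Pairs of a strict and a lazy value -/

/-- A strict value together with a value in the graph model. -/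
structure Point where
  strict : Filt
  lazy : LVal

namespace Point

/-- `p ≤ q` if `q` has the same lazy value as `p` and a larger strict value. -/
instance : Preorder Point where
  le p q := p.strict ≤ q.strict ∧ p.lazy = q.lazy
  le_refl _ := ⟨le_rfl, rfl⟩
  le_trans _ _ _ h h' := ⟨h.1.trans h'.1, h.2.trans h'.2⟩

/-- Application of pairs. -/
def app (p q : Point) : Point := ⟨p.strict.app q.strict, p.lazy.app q.lazy⟩

infixl:80 " ⬝ " => Point.app

/-- Iterated application. -/
def apps (p : Point) (l : List Point) : Point := l.foldl app p

/-- The pair with head constructor `c` and arguments `a`. -/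
def con (c : Constr) (a : Fin c.arity → Point) : Point :=
  ⟨.con c fun i => (a i).strict, .con c fun i => (a i).lazy⟩

/-- The pair of least values. -/
def bot : Point := ⟨⊥, ∅⟩

theorem app_mono {p p' q q' : Point} (hp : p ≤ p') (hq : q ≤ q') : p ⬝ q ≤ p' ⬝ q' :=
  ⟨Filt.app_mono hp.1 hq.1, by simp only [app, hp.2, hq.2]⟩

theorem con_mono {c : Constr} {a a' : Fin c.arity → Point} (h : ∀ i, a i ≤ a' i) :
    con c a ≤ con c a' :=
  ⟨Filt.con_mono fun i => (h i).1, by simp only [con, fun i => (h i).2]⟩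

theorem strict_apps (p : Point) (l : List Point) :
    (p.apps l).strict = p.strict.apps (l.map strict) := by
  induction l generalizing p with
  | nil => rfl
  | cons q l ih => exact ih (p ⬝ q)

theorem lazy_apps (p : Point) (l : List Point) :
    (p.apps l).lazy = p.lazy.apps (l.map lazy) := by
  induction l generalizing p with
  | nil => rfl
  | cons q l ih => exact ih (p ⬝ q)

end Point

/-- The strict values of an environment. -/
def stricts (ρ : ℕ → Point) : ℕ → Filt := fun i => (ρ i).strict

/-- The lazy values of an environment. -/
def lazies (ρ : ℕ → Point) : ℕ → LVal := fun i => (ρ i).lazy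

@[simp] theorem stricts_scons (p : Point) (ρ : ℕ → Point) :
    stricts (scons p ρ) = scons p.strict (stricts ρ) := by
  funext i; cases i <;> rfl

@[simp] theorem lazies_scons (p : Point) (ρ : ℕ → Point) :
    lazies (scons p ρ) = scons p.lazy (lazies ρ) := by
  funext i; cases i <;> rfl

/-- The two denotations of a term. -/
def pval (M : Term) (ρ : ℕ → Point) : Point := ⟨val M (stricts ρ), den M (lazies ρ)⟩

/-- The two values of a constructor. -/
def conPt (c : Constr) : Point := ⟨conFilt c, conVal c⟩

/-- The two values of a defined constant. -/
def fnPt (f : DConst) : Point := ⟨fnFilt f, fnVal f⟩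

theorem le_pval_app (M N : Term) (ρ : ℕ → Point) : pval M ρ ⬝ pval N ρ ≤ pval (.app M N) ρ :=
  ⟨le_val_app _ _ _, rfl⟩

theorem le_pval_lam_app (M : Term) (ρ : ℕ → Point) {p : Point} (hp : p.strict.Nonempty) :
    pval M (scons p ρ) ≤ pval (.lam M) ρ ⬝ p :=
  ⟨by
    have h := le_val_lam_app M (stricts ρ) hp
    rw [← stricts_scons] at h
    exact h, by simp [pval, Point.app]⟩

theorem le_pval_con (c : Constr) (ρ : ℕ → Point) : conPt c ≤ pval (.con c) ρ :=
  ⟨val_mono _ fun _ => bot_le, rfl⟩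

theorem le_pval_fn (f : DConst) (ρ : ℕ → Point) : fnPt f ≤ pval (.fn f) ρ :=
  ⟨val_mono _ fun _ => bot_le, rfl⟩

/-- A lower bound for the denotation of a term, computed by recursion outside abstractions. On the
right-hand side of a rule it unfolds to an application of the constants to the arguments. -/
def lowVal : Term → (ℕ → Point) → Point
  | .var i, ρ => ρ i
  | .lam M, ρ => pval (.lam M) ρ
  | .app M N, ρ => lowVal M ρ ⬝ lowVal N ρ
  | .con c, _ => conPt c
  | .fn f, _ => fnPt f

theorem lowVal_le (M : Term) (ρ : ℕ → Point) : lowVal M ρ ≤ pval M ρ := by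
  induction M with
  | var i => exact ⟨le_val_var i (stricts ρ), rfl⟩
  | lam M => exact le_rfl
  | app M N ih ih' => exact (Point.app_mono ih ih').trans (le_pval_app _ _ _)
  | con c => exact le_pval_con c ρ
  | fn f => exact le_pval_fn f ρ

theorem lowVal_le_lam_app (M : Term) (ρ : ℕ → Point) {p : Point} (hp : p.strict.Nonempty) :
    lowVal M (scons p ρ) ≤ pval (.lam M) ρ ⬝ p :=
  (lowVal_le _ _).trans (le_pval_lam_app M ρ hp)

theorem con_le_conPt_apps (c : Constr) (a : Fin c.arity → Point) :
    Point.con c a ≤ (conPt c).apps (List.ofFn a) := by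
  constructor
  · rw [Point.strict_apps, List.map_ofFn]
    exact con_le_apps c _
  · rw [Point.lazy_apps, List.map_ofFn]
    exact (apps_conVal c _).symm

/-- The pair of values of a pattern. -/
def Pat.point {n : ℕ} (w : Fin n → Point) : Pat n → Point
  | .var i => w i
  | .con c p => .con c fun i => (p i).point w

theorem Pat.strict_point {n : ℕ} (w : Fin n → Point) (p : Pat n) :
    (p.point w).strict = p.filt fun i => (w i).strict := by
  induction p with
  | var i => rfl
  | con c p ih => simp only [point, Point.con, filt, ih]

theorem Pat.lazy_point {n : ℕ} (w : Fin n → Point) (p : Pat n) :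
    (p.point w).lazy = p.lval fun i => (w i).lazy := by
  induction p with
  | var i => rfl
  | con c p ih => simp only [point, Point.con, lval, ih]

/-- A defined constant applied to arguments that match one of its rules. -/
theorem lowVal_rhs_le_apps {f : DConst} {r : Rule f} (hr : r ∈ rules f) (w : Fin r.n → Point)
    (a : Fin f.arity → Point) (hw : ∀ j, (w j).strict.Nonempty)
    (ha : ∀ i, (r.lhs i).point w ≤ a i) :
    lowVal r.rhs (envOf .bot w) ≤ (fnPt f).apps (List.ofFn a) := by
  refine (lowVal_le _ _).trans ⟨?_, ?_⟩
  · rw [Point.strict_apps, List.map_ofFn]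
    refine le_trans (val_mono _ ?_) (val_rhs_le_apps hr (w := fun j => (w j).strict) hw fun i => ?_)
    · intro j
      simp only [stricts, envOf]
      split_ifs <;> exact le_rfl
    · rw [← Pat.strict_point]
      exact (ha i).1
  · rw [Point.lazy_apps, List.map_ofFn]
    have h := apps_fnVal_rule hr fun j => (w j).lazy
    simp only [← Pat.lazy_point, (ha _).2] at h
    refine Eq.trans ?_ h.symm
    refine den_congr fun j _ => ?_
    simp only [lazies, envOf]
    split_ifs <;> rfl

/-- The pairs of an undefined lazy value and the largest strict value. They belong to every type. -/
def topPts : Set Point := {p | Nbhd.nabla ∈ p.strict ∧ p.lazy = ∅}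

/-- A defined constant applied to arguments none of its rules matches. -/
theorem apps_mem_topPts {f : DConst} (U : Fin f.arity → Nbhd) {a : Fin f.arity → Point}
    (hU : ∀ i, U i ∈ (a i).strict)
    (h : ∀ r ∈ rules f, ∃ i, (r.lhs i).Rejects (U i) ∧ ¬ (r.lhs i).Fits (a i).lazy) :
    (fnPt f).apps (List.ofFn a) ∈ topPts := by
  constructor
  · rw [Point.strict_apps, List.map_ofFn]
    exact nabla_mem_apps (U := U) hU fun r hr => (h r hr).imp fun _ h => h.1
  · rw [Point.lazy_apps, List.map_ofFn]
    exact apps_fnVal_stuck fun r hr => (h r hr).imp fun _ h => h.2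

/-! ### Totality predicates and the interpretation of types -/

/-- Totality predicates. Their elements are different from `⊥`. -/
structure Total (X : Set Point) : Prop where
  up : ∀ {p q}, p ≤ q → p ∈ X → q ∈ X
  top : topPts ⊆ X
  nonempty : ∀ {p}, p ∈ X → p.strict.Nonempty

theorem topPts_up {p q : Point} (h : p ≤ q) (hp : p ∈ topPts) : q ∈ topPts :=
  ⟨h.1 hp.1, h.2 ▸ hp.2⟩

theorem topPts_nonempty {p : Point} (hp : p ∈ topPts) : p.strict.Nonempty := ⟨_, hp.1⟩

theorem top_mem_topPts : (⟨⊤, ∅⟩ : Point) ∈ topPts := ⟨trivial, rfl⟩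

theorem app_mem_topPts {p q : Point} (hp : p ∈ topPts) (hq : q.strict.Nonempty) :
    p ⬝ q ∈ topPts := by
  obtain ⟨U, hU⟩ := hq
  exact ⟨⟨U, hU, p.strict.up_mem hp.1 (.nabla_le _)⟩, by simp [Point.app, hp.2]⟩

theorem con_nonempty {c : Constr} {a : Fin c.arity → Point} (h : ∀ i, (a i).strict.Nonempty) :
    (Point.con c a).strict.Nonempty :=
  ⟨_, fun i => (h i).choose, fun i => (h i).choose_spec, .refl _⟩

theorem Filt.Nonempty.mono {d d' : Filt} (h : d.Nonempty) (hd : d ≤ d') : d'.Nonempty :=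
  let ⟨U, hU⟩ := h
  ⟨U, hd hU⟩

/-- `0` -/
def ptZero : Point := .con .zero ![]
/-- `S p` -/
def ptS (p : Point) : Point := .con .S ![p]
/-- `Inl p` -/
def ptInl (p : Point) : Point := .con .Inl ![p]
/-- `Inr p` -/
def ptInr (p : Point) : Point := .con .Inr ![p]
/-- `(p, q)` -/
def ptPair (p q : Point) : Point := .con .Pair ![p, q]

theorem ptZero_nonempty : ptZero.strict.Nonempty := con_nonempty (by simp [Constr.arity])
theorem ptS_nonempty {p : Point} (h : p.strict.Nonempty) : (ptS p).strict.Nonempty :=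
  con_nonempty (by simpa [Constr.arity] using h)
theorem ptInl_nonempty {p : Point} (h : p.strict.Nonempty) : (ptInl p).strict.Nonempty :=
  con_nonempty (by simpa [Constr.arity] using h)
theorem ptInr_nonempty {p : Point} (h : p.strict.Nonempty) : (ptInr p).strict.Nonempty :=
  con_nonempty (by simpa [Constr.arity] using h)
theorem ptPair_nonempty {p q : Point} (h : p.strict.Nonempty) (h' : q.strict.Nonempty) :
    (ptPair p q).strict.Nonempty :=
  con_nonempty (by simpa [Constr.arity, Fin.forall_fin_two] using ⟨h, h'⟩)

/-- The total natural numbers `Sᵏ 0` and `Sᵏ ∇`. -/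
inductive NatEl : Point → Prop
  | top {p : Point} : p ∈ topPts → NatEl p
  | zero {p : Point} : ptZero ≤ p → NatEl p
  | succ {p q : Point} : NatEl q → ptS q ≤ p → NatEl p

/-- The total elements of an empty type. The lazy value is arbitrary, since no rule inspects an
element of an empty type. -/
def emptyEl : Set Point := {p | Nbhd.nabla ∈ p.strict}

/-- The total elements of the unit type; nothing ever depends on their lazy values. -/
def unitEl : Set Point := {p | p.strict.Nonempty}

/-- The total elements of a sum type. -/
def sumEl (X Y : Set Point) : Set Point :=
  {p | p ∈ topPts ∨ (∃ q ∈ X, ptInl q ≤ p) ∨ ∃ q ∈ Y, ptInr q ≤ p}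

/-- The total elements of a product type. -/
def prodEl (X Y : Set Point) : Set Point :=
  {p | p ∈ topPts ∨ ∃ q ∈ X, ∃ q' ∈ Y, ptPair q q' ≤ p}

/-- The total elements of a dependent function type. -/
def piEl (X : Set Point) (Y : LVal → Set Point) : Set Point :=
  {p | ∀ q ∈ X, p ⬝ q ∈ Y q.lazy}

/-- `Ty u e X` says that the lazy value `e` is a type, whose total elements are those of `X`. A
value without head constructor is an empty type, since the pairs in `topPts` are total elements of
the universe. The parameter `u` gives the possible interpretations of the universe: none for small
types, and only the predicate `univEl` for all types. -/
inductive Ty (u : Set Point → Prop) : LVal → Set Point → Prop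
  | univ {e : LVal} {X : Set Point} : e = .con .U ![] → u X → Ty u e X
  | stuck {e : LVal} : (∀ c, Tok.tag c ∉ e) → Ty u e emptyEl
  | N0 {e : LVal} : e = .con .N0 ![] → Ty u e emptyEl
  | N1 {e : LVal} : e = .con .N1 ![] → Ty u e unitEl
  | Nat {e : LVal} : e = .con .Nat ![] → Ty u e {p | NatEl p}
  | plus {e a b : LVal} {X Y : Set Point} :
      e = .con .plus ![a, b] → Ty u a X → Ty u b Y → Ty u e (sumEl X Y)
  | times {e a b : LVal} {X Y : Set Point} :
      e = .con .times ![a, b] → Ty u a X → Ty u b Y → Ty u e (prodEl X Y)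
  | pi {e a b : LVal} {X : Set Point} {Y : LVal → Set Point} :
      e = .con .Fun ![a, b] → Ty u a X → (∀ p ∈ X, Ty u (b.app p.lazy) (Y p.lazy)) →
      Ty u e (piEl X Y)

theorem natEl_total : Total {p | NatEl p} where
  up := fun h hp => by
    cases hp with
    | top hp => exact .top (topPts_up h hp)
    | zero hp => exact .zero (hp.trans h)
    | succ hq hp => exact .succ hq (hp.trans h)
  top _ hp := .top hp
  nonempty := fun hp => by
    induction hp with
    | top hp => exact topPts_nonempty hp
    | zero hp => exact ptZero_nonempty.mono hp.1
    | succ _ hp ih => exact (ptS_nonempty ih).mono hp.1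

theorem emptyEl_total : Total emptyEl :=
  ⟨fun h hp => h.1 hp, fun _ hp => hp.1, fun hp => ⟨_, hp⟩⟩

theorem unitEl_total : Total unitEl :=
  ⟨fun h hp => hp.mono h.1, fun _ hp => topPts_nonempty hp, fun hp => hp⟩

theorem sumEl_total {X Y : Set Point} (hX : Total X) (hY : Total Y) : Total (sumEl X Y) where
  up := by
    rintro p q h (hp | ⟨q', hq, hp⟩ | ⟨q', hq, hp⟩)
    · exact .inl (topPts_up h hp)
    · exact .inr (.inl ⟨q', hq, hp.trans h⟩)
    · exact .inr (.inr ⟨q', hq, hp.trans h⟩)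
  top _ hp := .inl hp
  nonempty := by
    rintro p (hp | ⟨q', hq, hp⟩ | ⟨q', hq, hp⟩)
    · exact topPts_nonempty hp
    · exact (ptInl_nonempty (hX.nonempty hq)).mono hp.1
    · exact (ptInr_nonempty (hY.nonempty hq)).mono hp.1

theorem prodEl_total {X Y : Set Point} (hX : Total X) (hY : Total Y) : Total (prodEl X Y) where
  up := by
    rintro p q h (hp | ⟨a, ha, b, hb, hp⟩)
    · exact .inl (topPts_up h hp)
    · exact .inr ⟨a, ha, b, hb, hp.trans h⟩
  top _ hp := .inl hp
  nonempty := by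
    rintro p (hp | ⟨a, ha, b, hb, hp⟩)
    · exact topPts_nonempty hp
    · exact (ptPair_nonempty (hX.nonempty ha) (hY.nonempty hb)).mono hp.1

/-- A total function differs from `⊥`, since its value at a top element does. -/
theorem piEl_total {X : Set Point} {Y : LVal → Set Point} (hX : Total X)
    (hY : ∀ p ∈ X, Total (Y p.lazy)) : Total (piEl X Y) where
  up h hp q hq := (hY q hq).up (Point.app_mono h le_rfl) (hp q hq)
  top p hp q hq := (hY q hq).top (app_mem_topPts hp (hX.nonempty hq))
  nonempty hp := by
    obtain ⟨_, U, _, h⟩ :=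
      (hY _ (hX.top top_mem_topPts)).nonempty (hp _ (hX.top top_mem_topPts))
    exact ⟨_, h⟩

theorem Ty.total {u : Set Point → Prop} (hu : ∀ X, u X → Total X) {e : LVal} {X : Set Point}
    (h : Ty u e X) : Total X := by
  induction h with
  | univ _ h => exact hu _ h
  | stuck _ => exact emptyEl_total
  | N0 _ => exact emptyEl_total
  | N1 _ => exact unitEl_total
  | Nat _ => exact natEl_total
  | plus _ _ _ ih ih' => exact sumEl_total ih ih'
  | times _ _ _ ih ih' => exact prodEl_total ih ih'
  | pi _ _ _ ih ih' => exact piEl_total ih ih'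

theorem LVal.head_eq {c c' : Constr} {a : Fin c.arity → LVal} {a' : Fin c'.arity → LVal}
    (h : con c a = con c' a') : c = c' := by
  rw [← tag_mem_con (a := a'), ← h, tag_mem_con]

theorem LVal.not_headless {c : Constr} {e : LVal} {a : Fin c.arity → LVal} (h : e = con c a)
    (h' : ∀ c, Tok.tag c ∉ e) : False := h' c (h ▸ tag_mem_con.2 rfl)

/-- A value is a type in at most one way. -/
theorem Ty.unique {u : Set Point → Prop} (hu : ∀ X X', u X → u X' → X = X') {e : LVal}
    {X X' : Set Point} (h : Ty u e X) (h' : Ty u e X') : X = X' := by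
  induction h generalizing X' with
  | univ h hX =>
    cases h' with
    | univ h' hX' => exact hu _ _ hX hX'
    | stuck h' => exact (LVal.not_headless h h').elim
    | _ h' => cases LVal.head_eq (h.symm.trans h')
  | stuck h =>
    cases h' with
    | stuck h' => rfl
    | _ h' => exact (LVal.not_headless h' h).elim
  | N0 h =>
    cases h' with
    | N0 h' => rfl
    | stuck h' => exact (LVal.not_headless h h').elim
    | _ h' => cases LVal.head_eq (h.symm.trans h')
  | N1 h =>
    cases h' with
    | N1 h' => rfl
    | stuck h' => exact (LVal.not_headless h h').elim
    | _ h' => cases LVal.head_eq (h.symm.trans h')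
  | Nat h =>
    cases h' with
    | Nat h' => rfl
    | stuck h' => exact (LVal.not_headless h h').elim
    | _ h' => cases LVal.head_eq (h.symm.trans h')
  | plus h _ _ ih ih' =>
    cases h' with
    | plus h' ha hb =>
      have := LVal.con_injective _ (h.symm.trans h')
      obtain rfl := congrFun this 0
      obtain rfl := congrFun this 1
      rw [ih ha, ih' hb]
    | stuck h' => exact (LVal.not_headless h h').elim
    | _ h' => cases LVal.head_eq (h.symm.trans h')
  | times h _ _ ih ih' =>
    cases h' with
    | times h' ha hb =>
      have := LVal.con_injective _ (h.symm.trans h')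
      obtain rfl := congrFun this 0
      obtain rfl := congrFun this 1
      rw [ih ha, ih' hb]
    | stuck h' => exact (LVal.not_headless h h').elim
    | _ h' => cases LVal.head_eq (h.symm.trans h')
  | pi h _ _ ih ih' =>
    cases h' with
    | pi h' ha hb =>
      have := LVal.con_injective _ (h.symm.trans h')
      obtain rfl := congrFun this 0
      obtain rfl := congrFun this 1
      obtain rfl := ih ha
      ext p
      exact forall₂_congr fun q hq => by rw [ih' q hq (hb q hq)]
    | stuck h' => exact (LVal.not_headless h h').elim
    | _ h' => cases LVal.head_eq (h.symm.trans h')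

theorem Ty.mono {u u' : Set Point → Prop} (hu : ∀ X, u X → u' X) {e : LVal} {X : Set Point}
    (h : Ty u e X) : Ty u' e X := by
  induction h with
  | univ h hX => exact .univ h (hu _ hX)
  | stuck h => exact .stuck h
  | N0 h => exact .N0 h
  | N1 h => exact .N1 h
  | Nat h => exact .Nat h
  | plus h _ _ ih ih' => exact .plus h ih ih'
  | times h _ _ ih ih' => exact .times h ih ih'
  | pi h _ _ ih ih' => exact .pi h ih ih'

/-- The value `e` is a small type, i.e. an element of the universe. -/
def IsSmall (e : LVal) : Prop := ∃ X, Ty (fun _ => False) e X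

/-- The total elements of the universe. -/
def univEl : Set Point := {p | p.strict.Nonempty ∧ IsSmall p.lazy}

theorem univEl_total : Total univEl :=
  ⟨fun h hp => ⟨hp.1.mono h.1, h.2 ▸ hp.2⟩,
    fun p hp => ⟨topPts_nonempty hp, emptyEl, .stuck fun c => by simp [hp.2]⟩, fun hp => hp.1⟩

/-- The value `e` is a type. -/
def IsTy (e : LVal) : Prop := ∃ X, Ty (· = univEl) e X

/-- The total elements of the type `e`; there are none if `e` is not a type. -/
def El (e : LVal) : Set Point := {p | ∃ X, Ty (· = univEl) e X ∧ p ∈ X}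

theorem Ty.el_eq {e : LVal} {X : Set Point} (h : Ty (· = univEl) e X) : El e = X := by
  ext p
  exact ⟨fun ⟨X', h', hp⟩ => h.unique (fun _ _ h h' => h.trans h'.symm) h' ▸ hp,
    fun hp => ⟨X, h, hp⟩⟩

theorem IsTy.ty {e : LVal} (h : IsTy e) : Ty (· = univEl) e (El e) := by
  obtain ⟨X, hX⟩ := h
  rwa [hX.el_eq]

theorem IsTy.total {e : LVal} (h : IsTy e) : Total (El e) :=
  h.ty.total fun _ h => by rw [h]; exact univEl_total

theorem isTy_of_mem {e : LVal} {p : Point} (h : p ∈ El e) : IsTy e :=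
  let ⟨X, hX, _⟩ := h
  ⟨X, hX⟩

theorem el_up {e : LVal} {p q : Point} (h : p ≤ q) (hp : p ∈ El e) : q ∈ El e :=
  (isTy_of_mem hp).total.up h hp

theorem el_nonempty {e : LVal} {p : Point} (hp : p ∈ El e) : p.strict.Nonempty :=
  (isTy_of_mem hp).total.nonempty hp

theorem el_top {e : LVal} (h : IsTy e) {p : Point} (hp : p ∈ topPts) : p ∈ El e :=
  h.total.top hp

theorem IsSmall.ty {e : LVal} (h : IsSmall e) : Ty (fun _ => False) e (El e) := by
  obtain ⟨X, hX⟩ := h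
  have h' : Ty (· = univEl) e X := hX.mono fun _ h => h.elim
  rwa [h'.el_eq]

theorem IsSmall.isTy {e : LVal} (h : IsSmall e) : IsTy e :=
  ⟨_, h.ty.mono fun _ h => h.elim⟩

theorem isTy_U : IsTy (.con .U ![]) := ⟨_, .univ rfl rfl⟩

theorem el_U : El (.con .U ![]) = univEl := Ty.el_eq (.univ rfl rfl)

theorem isSmall_N0 : IsSmall (.con .N0 ![]) := ⟨_, .N0 rfl⟩

theorem el_N0 : El (.con .N0 ![]) = emptyEl := Ty.el_eq (.N0 rfl)

theorem isSmall_N1 : IsSmall (.con .N1 ![]) := ⟨_, .N1 rfl⟩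

theorem el_N1 : El (.con .N1 ![]) = unitEl := Ty.el_eq (.N1 rfl)

theorem isSmall_Nat : IsSmall (.con .Nat ![]) := ⟨_, .Nat rfl⟩

theorem el_Nat : El (.con .Nat ![]) = {p | NatEl p} := Ty.el_eq (.Nat rfl)

theorem isSmall_plus {a b : LVal} (ha : IsSmall a) (hb : IsSmall b) :
    IsSmall (.con .plus ![a, b]) := ⟨_, .plus rfl ha.ty hb.ty⟩

theorem el_plus {a b : LVal} (ha : IsTy a) (hb : IsTy b) :
    El (.con .plus ![a, b]) = sumEl (El a) (El b) := Ty.el_eq (.plus rfl ha.ty hb.ty)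

theorem isSmall_times {a b : LVal} (ha : IsSmall a) (hb : IsSmall b) :
    IsSmall (.con .times ![a, b]) := ⟨_, .times rfl ha.ty hb.ty⟩

theorem el_times {a b : LVal} (ha : IsTy a) (hb : IsTy b) :
    El (.con .times ![a, b]) = prodEl (El a) (El b) := Ty.el_eq (.times rfl ha.ty hb.ty)

theorem isSmall_pi {a b : LVal} (ha : IsSmall a) (hb : ∀ p ∈ El a, IsSmall (b.app p.lazy)) :
    IsSmall (.con .Fun ![a, b]) :=
  ⟨_, .pi (Y := fun x => El (b.app x)) rfl ha.ty fun p hp => (hb p hp).ty⟩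

theorem isTy_pi {a b : LVal} (ha : IsTy a) (hb : ∀ p ∈ El a, IsTy (b.app p.lazy)) :
    IsTy (.con .Fun ![a, b]) :=
  ⟨_, .pi (Y := fun x => El (b.app x)) rfl ha.ty fun p hp => (hb p hp).ty⟩

theorem mem_el_pi {a b : LVal} {p : Point} : p ∈ El (.con .Fun ![a, b]) ↔
    IsTy a ∧ ∀ q ∈ El a, p ⬝ q ∈ El (b.app q.lazy) := by
  constructor
  · rintro ⟨X, hX, hp⟩
    cases hX with
    | pi h ha hb =>
      have := LVal.con_injective _ h
      obtain rfl := congrFun this 0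
      obtain rfl := congrFun this 1
      refine ⟨⟨_, ha⟩, fun q hq => ?_⟩
      have hq' : q ∈ _ := ha.el_eq ▸ hq
      exact ⟨_, hb q hq', hp q hq'⟩
    | stuck h => exact (LVal.not_headless rfl h).elim
    | _ h => cases LVal.head_eq h
  · rintro ⟨ha, h⟩
    exact ⟨_, .pi (Y := fun x => El (b.app x)) rfl ha.ty
      fun q hq => (isTy_of_mem (h q hq)).ty, h⟩

/-! ### Computation rules for pairs of values -/

section
variable {n : ℕ} (w : Fin n → Point)

@[simp] theorem Pat.point_var (i : Fin n) : (Pat.var i).point w = w i := rfl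

@[simp] theorem Pat.point_p0 : Pat.p0.point w = ptZero := by
  simp only [p0, point, ptZero]
  congr 1
  exact Subsingleton.elim (α := Fin 0 → Point) _ _

theorem funext_fin_one {α : Type*} {a b : Fin 1 → α} (h : a 0 = b 0) : a = b :=
  funext fun i => by rwa [Subsingleton.elim i 0]

@[simp] theorem Pat.point_pS (p : Pat n) : p.pS.point w = ptS (p.point w) := by
  simp only [pS, point, ptS]
  congr 1
  exact funext_fin_one rfl

@[simp] theorem Pat.point_pInl (p : Pat n) : p.pInl.point w = ptInl (p.point w) := by
  simp only [pInl, point, ptInl]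
  congr 1
  exact funext_fin_one rfl

@[simp] theorem Pat.point_pInr (p : Pat n) : p.pInr.point w = ptInr (p.point w) := by
  simp only [pInr, point, ptInr]
  congr 1
  exact funext_fin_one rfl

@[simp] theorem Pat.point_ppair (p q : Pat n) :
    (p.ppair q).point w = ptPair (p.point w) (q.point w) := by
  simp only [ppair, point, ptPair]
  congr 1
  funext i
  revert i
  exact Fin.forall_fin_two.2 ⟨rfl, rfl⟩

end

theorem ptS_mono {p q : Point} (h : p ≤ q) : ptS p ≤ ptS q :=
  Point.con_mono (by change ∀ i : Fin 1, _; simpa using h)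

theorem conPt_le_of_arity_zero {c : Constr} (h : c.arity = 0) (a : Fin c.arity → Point) :
    Point.con c a ≤ conPt c := by
  have h' := con_le_conPt_apps c a
  have h'' : List.ofFn a = [] := by simpa using h
  rwa [h''] at h'

theorem ptS_le (p : Point) : ptS p ≤ conPt .S ⬝ p := con_le_conPt_apps .S ![p]
theorem ptInl_le (p : Point) : ptInl p ≤ conPt .Inl ⬝ p := con_le_conPt_apps .Inl ![p]
theorem ptInr_le (p : Point) : ptInr p ≤ conPt .Inr ⬝ p := con_le_conPt_apps .Inr ![p]
theorem ptPair_le (p q : Point) : ptPair p q ≤ conPt .Pair ⬝ p ⬝ q :=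
  con_le_conPt_apps .Pair ![p, q]
theorem ptZero_le : ptZero ≤ conPt .zero := con_le_conPt_apps .zero ![]

theorem Filt.Nonempty.some_mem {d : Filt} (h : d.Nonempty) : h.choose ∈ d := h.choose_spec

theorem mem_of_ptS_le {p q : Point} (h : ptS p ≤ q) {U : Nbhd} (hU : U ∈ p.strict) :
    .con .S ![U] ∈ q.strict :=
  h.1 ⟨![U], by change ∀ i : Fin 1, _; simpa using hU, .refl _⟩

/-- The term `Ψ B H K n v x (less x n)`, where `x` is the variable `0`. -/
def phiBody : Term :=
  .apps (.fn .Psi) [.var 1, .var 2, .var 3, .var 4, .var 5, .var 0,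
    .apps (.fn .less) [.var 0, .var 4]]

/-- The term `Φ B H K (S n) (v, y)`, where `y` is the variable `0`. -/
def psiBody : Term :=
  .apps (.fn .Phi) [.var 1, .var 2, .var 3, .tS (.var 4), .tpair (.var 5) (.var 0)]

theorem rec_zero {P Q n : Point} (hP : P.strict.Nonempty) (hQ : Q.strict.Nonempty)
    (hn : ptZero ≤ n) :
    P ≤ fnPt .Rec ⬝ P ⬝ Q ⬝ n := by
  refine lowVal_rhs_le_apps (f := .Rec) (.head _) ![P, Q] ![P, Q, n] ?_ ?_
  -- The arities reduce to numerals, which `Fin.forall_fin_succ` needs to see.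
  · change ∀ j : Fin 2, _
    simp [Fin.forall_fin_succ, *]
  · change ∀ j : Fin 3, _
    simp [Fin.forall_fin_succ, *]

theorem rec_succ {P Q x n : Point} (hP : P.strict.Nonempty) (hQ : Q.strict.Nonempty)
    (hx : x.strict.Nonempty) (hn : ptS x ≤ n) :
    Q ⬝ x ⬝ (fnPt .Rec ⬝ P ⬝ Q ⬝ x) ≤ fnPt .Rec ⬝ P ⬝ Q ⬝ n := by
  refine lowVal_rhs_le_apps (f := .Rec) (.tail _ (.head _)) ![P, Q, x] ![P, Q, n] ?_ ?_
  · change ∀ j : Fin 3, _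
    simp [Fin.forall_fin_succ, *]
  · change ∀ j : Fin 3, _
    simp [Fin.forall_fin_succ, *]

theorem rec_top {P Q n : Point} (hP : P.strict.Nonempty) (hQ : Q.strict.Nonempty)
    (hn : n ∈ topPts) : fnPt .Rec ⬝ P ⬝ Q ⬝ n ∈ topPts := by
  refine apps_mem_topPts (f := .Rec) ![hP.choose, hQ.choose, .nabla]
    (a := ![P, Q, n]) ?_ ?_
  · change ∀ j : Fin 3, _
    simp [Fin.forall_fin_succ, Filt.Nonempty.some_mem, hn.1]
  · intro r hr
    refine ⟨(2 : Fin 3), ?_⟩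
    revert r
    simp [rules, Pat.p0, Pat.pS, Pat.Rejects, Pat.Fits, Nbhd.kind, hn.2]

theorem neg_le {A : Point} (hA : A.strict.Nonempty) :
    conPt .Fun ⬝ A ⬝ pval (.lam Term.tN0) (envOf .bot ![A]) ≤ fnPt .neg ⬝ A := by
  refine lowVal_rhs_le_apps (f := .neg) (.head _) ![A] ![A] ?_ ?_
  · change ∀ j : Fin 1, _
    simp [*]
  · change ∀ j : Fin 1, _
    simp [*]

theorem T_le {P : Point} (hP : P.strict.Nonempty) :
    conPt .Fun ⬝ conPt .Nat
      ⬝ pval (.lam (.arr (.app (.var 1) (.tS (.var 0))) (.app (.var 1) (.var 0))))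
        (envOf .bot ![P]) ≤ fnPt .T ⬝ P := by
  refine lowVal_rhs_le_apps (f := .T) (.head _) ![P] ![P] ?_ ?_
  · change ∀ j : Fin 1, _
    simp [*]
  · change ∀ j : Fin 1, _
    simp [*]

theorem le_zero {n m : Point} (hn : n.strict.Nonempty) (hm : ptZero ≤ m) :
    conPt .N1 ≤ fnPt .le ⬝ m ⬝ n := by
  refine lowVal_rhs_le_apps (f := .le) (.head _) ![n] ![m, n] ?_ ?_
  · change ∀ j : Fin 1, _
    simp [*]
  · change ∀ j : Fin 2, _
    simp [Fin.forall_fin_succ, *]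

theorem le_succ_zero {x m n : Point} (hx : x.strict.Nonempty) (hm : ptS x ≤ m) (hn : ptZero ≤ n) :
    conPt .N0 ≤ fnPt .le ⬝ m ⬝ n := by
  refine lowVal_rhs_le_apps (f := .le) (.tail _ (.head _)) ![x] ![m, n] ?_ ?_
  · change ∀ j : Fin 1, _
    simp [*]
  · change ∀ j : Fin 2, _
    simp [Fin.forall_fin_succ, *]

theorem le_succ_succ {x y m n : Point} (hx : x.strict.Nonempty) (hy : y.strict.Nonempty)
    (hm : ptS x ≤ m) (hn : ptS y ≤ n) :
    fnPt .le ⬝ x ⬝ y ≤ fnPt .le ⬝ m ⬝ n := by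
  refine lowVal_rhs_le_apps (f := .le) (.tail _ (.tail _ (.head _))) ![x, y] ![m, n] ?_ ?_
  · change ∀ j : Fin 2, _
    simp [Fin.forall_fin_succ, *]
  · change ∀ j : Fin 2, _
    simp [Fin.forall_fin_succ, *]

theorem le_top {n m : Point} (hm : m.strict.Nonempty) (hn : n ∈ topPts) :
    fnPt .le ⬝ n ⬝ m ∈ topPts := by
  refine apps_mem_topPts (f := .le) ![.nabla, hm.choose]
    (a := ![n, m]) ?_ ?_
  · change ∀ j : Fin 2, _
    simp [Fin.forall_fin_succ, Filt.Nonempty.some_mem, hn.1]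
  · intro r hr
    refine ⟨(0 : Fin 2), ?_⟩
    revert r
    simp [rules, Pat.p0, Pat.pS, Pat.Rejects, Pat.Fits, Nbhd.kind, hn.2]

theorem le_succ_top {m n x : Point} (hne : x.strict.Nonempty) (hx : ptS x ≤ m) (hn : n ∈ topPts) :
    fnPt .le ⬝ m ⬝ n ∈ topPts := by
  refine apps_mem_topPts (f := .le) ![.con .S ![hne.choose], .nabla]
    (a := ![m, n]) ?_ ?_
  · change ∀ j : Fin 2, _
    simp [Fin.forall_fin_succ, hn.1, mem_of_ptS_le hx hne.some_mem]
  · simp only [rules, List.forall_mem_cons]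
    refine ⟨⟨(0 : Fin 2), ?_⟩, ⟨(1 : Fin 2), ?_⟩, ⟨(1 : Fin 2), ?_⟩, nofun⟩ <;>
      simp [Pat.p0, Pat.pS, Pat.Rejects, Pat.Fits, Nbhd.kind, hn.2, ← hx.2, ptS, Point.con]

theorem less_zero {m n : Point} (hm : m.strict.Nonempty) (hn : ptZero ≤ n) :
    ptInr ptZero ≤ fnPt .less ⬝ m ⬝ n := by
  refine (Point.con_mono (by change ∀ j : Fin 1, _; simpa using ptZero_le)).trans <|
    (ptInr_le (conPt .zero)).trans ?_
  refine lowVal_rhs_le_apps (f := .less) (.head _) ![m] ![m, n] ?_ ?_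
  · change ∀ j : Fin 1, _
    simp [*]
  · change ∀ j : Fin 2, _
    simp [Fin.forall_fin_succ, *]

theorem less_zero_succ {y m n : Point} (hy : y.strict.Nonempty) (hm : ptZero ≤ m) (hn : ptS y ≤ n) :
    ptInl ptZero ≤ fnPt .less ⬝ m ⬝ n := by
  refine (Point.con_mono (by change ∀ j : Fin 1, _; simpa using ptZero_le)).trans <|
    (ptInl_le (conPt .zero)).trans ?_
  refine lowVal_rhs_le_apps (f := .less) (.tail _ (.head _)) ![y] ![m, n] ?_ ?_
  · change ∀ j : Fin 1, _
    simp [*]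
  · change ∀ j : Fin 2, _
    simp [Fin.forall_fin_succ, *]

theorem less_succ_succ {x y m n : Point} (hx : x.strict.Nonempty) (hy : y.strict.Nonempty)
    (hm : ptS x ≤ m) (hn : ptS y ≤ n) :
    fnPt .less ⬝ x ⬝ y ≤ fnPt .less ⬝ m ⬝ n := by
  refine lowVal_rhs_le_apps (f := .less) (.tail _ (.tail _ (.head _))) ![x, y] ![m, n] ?_ ?_
  · change ∀ j : Fin 2, _
    simp [Fin.forall_fin_succ, *]
  · change ∀ j : Fin 2, _
    simp [Fin.forall_fin_succ, *]

theorem less_top {m n : Point} (hm : m.strict.Nonempty) (hn : n ∈ topPts) :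
    fnPt .less ⬝ m ⬝ n ∈ topPts := by
  refine apps_mem_topPts (f := .less) ![hm.choose, .nabla]
    (a := ![m, n]) ?_ ?_
  · change ∀ j : Fin 2, _
    simp [Fin.forall_fin_succ, Filt.Nonempty.some_mem, hn.1]
  · intro r hr
    refine ⟨(1 : Fin 2), ?_⟩
    revert r
    simp [rules, Pat.p0, Pat.pS, Pat.Rejects, Pat.Fits, Nbhd.kind, hn.2]

theorem less_top_succ {n m x : Point} (hne : x.strict.Nonempty) (hx : ptS x ≤ m) (hn : n ∈ topPts) :
    fnPt .less ⬝ n ⬝ m ∈ topPts := by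
  refine apps_mem_topPts (f := .less) ![.nabla, .con .S ![hne.choose]]
    (a := ![n, m]) ?_ ?_
  · change ∀ j : Fin 2, _
    simp [Fin.forall_fin_succ, hn.1, mem_of_ptS_le hx hne.some_mem]
  · simp only [rules, List.forall_mem_cons]
    refine ⟨⟨(1 : Fin 2), ?_⟩, ⟨(0 : Fin 2), ?_⟩, ⟨(0 : Fin 2), ?_⟩, nofun⟩ <;>
      simp [Pat.p0, Pat.pS, Pat.Rejects, Pat.Fits, Nbhd.kind, hn.2, ← hx.2, ptS, Point.con]

theorem vec_zero {B n : Point} (hB : B.strict.Nonempty) (hn : ptZero ≤ n) :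
    conPt .N1 ≤ fnPt .vec ⬝ B ⬝ n := by
  refine lowVal_rhs_le_apps (f := .vec) (.head _) ![B] ![B, n] ?_ ?_
  · change ∀ j : Fin 1, _
    simp [*]
  · change ∀ j : Fin 2, _
    simp [Fin.forall_fin_succ, *]

theorem vec_succ {B x n : Point} (hB : B.strict.Nonempty) (hx : x.strict.Nonempty)
    (hn : ptS x ≤ n) :
    conPt .times ⬝ (fnPt .vec ⬝ B ⬝ x) ⬝ (B ⬝ x) ≤ fnPt .vec ⬝ B ⬝ n := by
  refine lowVal_rhs_le_apps (f := .vec) (.tail _ (.head _)) ![B, x] ![B, n] ?_ ?_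
  · change ∀ j : Fin 2, _
    simp [Fin.forall_fin_succ, *]
  · change ∀ j : Fin 2, _
    simp [Fin.forall_fin_succ, *]

theorem vec_top {B n : Point} (hB : B.strict.Nonempty) (hn : n ∈ topPts) :
    fnPt .vec ⬝ B ⬝ n ∈ topPts := by
  refine apps_mem_topPts (f := .vec) ![hB.choose, .nabla]
    (a := ![B, n]) ?_ ?_
  · change ∀ j : Fin 2, _
    simp [Fin.forall_fin_succ, Filt.Nonempty.some_mem, hn.1]
  · intro r hr
    refine ⟨(1 : Fin 2), ?_⟩
    revert r
    simp [rules, Pat.p0, Pat.pS, Pat.Rejects, Pat.Fits, Nbhd.kind, hn.2]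

theorem head_pair {x v u p : Point} (hx : x.strict.Nonempty) (hv : v.strict.Nonempty)
    (hu : u.strict.Nonempty) (hp : ptPair v u ≤ p) :
    u ≤ fnPt .head ⬝ x ⬝ p := by
  refine lowVal_rhs_le_apps (f := .head) (.head _) ![x, v, u] ![x, p] ?_ ?_
  · change ∀ j : Fin 3, _
    simp [Fin.forall_fin_succ, *]
  · change ∀ j : Fin 2, _
    simp [Fin.forall_fin_succ, *]

theorem head_top {x n : Point} (hx : x.strict.Nonempty) (hn : n ∈ topPts) :
    fnPt .head ⬝ x ⬝ n ∈ topPts := by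
  refine apps_mem_topPts (f := .head) ![hx.choose, .nabla]
    (a := ![x, n]) ?_ ?_
  · change ∀ j : Fin 2, _
    simp [Fin.forall_fin_succ, Filt.Nonempty.some_mem, hn.1]
  · intro r hr
    refine ⟨(1 : Fin 2), ?_⟩
    revert r
    simp [rules, Pat.ppair, Pat.Rejects, Pat.Fits, Nbhd.kind, hn.2]

theorem tail_pair {x v u p : Point} (hx : x.strict.Nonempty) (hv : v.strict.Nonempty)
    (hu : u.strict.Nonempty) (hp : ptPair v u ≤ p) :
    v ≤ fnPt .tail ⬝ x ⬝ p := by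
  refine lowVal_rhs_le_apps (f := .tail) (.head _) ![x, v, u] ![x, p] ?_ ?_
  · change ∀ j : Fin 3, _
    simp [Fin.forall_fin_succ, *]
  · change ∀ j : Fin 2, _
    simp [Fin.forall_fin_succ, *]

theorem tail_top {x n : Point} (hx : x.strict.Nonempty) (hn : n ∈ topPts) :
    fnPt .tail ⬝ x ⬝ n ∈ topPts := by
  refine apps_mem_topPts (f := .tail) ![hx.choose, .nabla]
    (a := ![x, n]) ?_ ?_
  · change ∀ j : Fin 2, _
    simp [Fin.forall_fin_succ, Filt.Nonempty.some_mem, hn.1]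
  · intro r hr
    refine ⟨(1 : Fin 2), ?_⟩
    revert r
    simp [rules, Pat.ppair, Pat.Rejects, Pat.Fits, Nbhd.kind, hn.2]

theorem exit_top {p : Point} (hp : p.strict.Nonempty) :
    fnPt .exit ⬝ p ∈ topPts := by
  refine apps_mem_topPts (f := .exit) ![hp.choose]
    (a := ![p]) ?_ ?_
  · change ∀ j : Fin 1, _
    simp [Filt.Nonempty.some_mem]
  · intro r hr
    refine ⟨(0 : Fin 1), ?_⟩
    revert r
    simp [rules]

theorem trim_zero_zero {p P h v n m : Point} (hp : p.strict.Nonempty) (hP : P.strict.Nonempty)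
    (hh : h.strict.Nonempty) (hv : v.strict.Nonempty) (hn : ptZero ≤ n) (hm : ptZero ≤ m) :
    v ≤ fnPt .trim ⬝ n ⬝ m ⬝ p ⬝ P ⬝ h ⬝ v := by
  refine lowVal_rhs_le_apps (f := .trim) (.head _) ![p, P, h, v] ![n, m, p, P, h, v] ?_ ?_
  · change ∀ j : Fin 4, _
    simp [Fin.forall_fin_succ, *]
  · change ∀ j : Fin 6, _
    simp [Fin.forall_fin_succ, *]

theorem trim_zero_succ {y p P h v n m : Point} (hy : y.strict.Nonempty) (hp : p.strict.Nonempty)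
    (hP : P.strict.Nonempty) (hh : h.strict.Nonempty) (hv : v.strict.Nonempty) (hn : ptZero ≤ n)
    (hm : ptS y ≤ m) :
    fnPt .trim ⬝ conPt .zero ⬝ y ⬝ p ⬝ P ⬝ h ⬝ (h ⬝ y ⬝ v) ≤
      fnPt .trim ⬝ n ⬝ m ⬝ p ⬝ P ⬝ h ⬝ v := by
  refine lowVal_rhs_le_apps (f := .trim)
    (.tail _ (.head _)) ![y, p, P, h, v] ![n, m, p, P, h, v] ?_ ?_
  · change ∀ j : Fin 5, _
    simp [Fin.forall_fin_succ, *]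
  · change ∀ j : Fin 6, _
    simp [Fin.forall_fin_succ, *]

theorem trim_succ_zero {x p P h v n m : Point} (hx : x.strict.Nonempty) (hp : p.strict.Nonempty)
    (hP : P.strict.Nonempty) (hh : h.strict.Nonempty) (hv : v.strict.Nonempty) (hn : ptS x ≤ n)
    (hm : ptZero ≤ m) :
    fnPt .exit ⬝ p ≤ fnPt .trim ⬝ n ⬝ m ⬝ p ⬝ P ⬝ h ⬝ v := by
  refine lowVal_rhs_le_apps (f := .trim)
    (.tail _ (.tail _ (.head _))) ![x, p, P, h, v] ![n, m, p, P, h, v] ?_ ?_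
  · change ∀ j : Fin 5, _
    simp [Fin.forall_fin_succ, *]
  · change ∀ j : Fin 6, _
    simp [Fin.forall_fin_succ, *]

theorem trim_succ_succ {x y p P h v n m : Point} (hx : x.strict.Nonempty) (hy : y.strict.Nonempty)
    (hp : p.strict.Nonempty) (hP : P.strict.Nonempty) (hh : h.strict.Nonempty)
    (hv : v.strict.Nonempty) (hn : ptS x ≤ n) (hm : ptS y ≤ m) :
    fnPt .trim ⬝ x ⬝ y ⬝ p
      ⬝ pval (.lam (.app (.var 4) (.tS (.var 0)))) (envOf .bot ![x, y, p, P, h, v])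
      ⬝ pval (.lam (.app (.var 5) (.tS (.var 0)))) (envOf .bot ![x, y, p, P, h, v]) ⬝ v ≤
      fnPt .trim ⬝ n ⬝ m ⬝ p ⬝ P ⬝ h ⬝ v := by
  refine lowVal_rhs_le_apps (f := .trim)
    (.tail _ (.tail _ (.tail _ (.head _)))) ![x, y, p, P, h, v] ![n, m, p, P, h, v] ?_ ?_
  · change ∀ j : Fin 6, _
    simp [Fin.forall_fin_succ, *]
  · change ∀ j : Fin 6, _
    simp [Fin.forall_fin_succ, *]

theorem trim_top_left {n m p P h v : Point} (hm : m.strict.Nonempty) (hp : p.strict.Nonempty)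
    (hP : P.strict.Nonempty) (hh : h.strict.Nonempty) (hv : v.strict.Nonempty) (hn : n ∈ topPts) :
    fnPt .trim ⬝ n ⬝ m ⬝ p ⬝ P ⬝ h ⬝ v ∈ topPts := by
  refine apps_mem_topPts
    (f := .trim) ![.nabla, hm.choose, hp.choose, hP.choose, hh.choose, hv.choose]
    (a := ![n, m, p, P, h, v]) ?_ ?_
  · change ∀ j : Fin 6, _
    simp [Fin.forall_fin_succ, Filt.Nonempty.some_mem, hn.1]
  · intro r hr
    refine ⟨(0 : Fin 6), ?_⟩
    revert r
    simp [rules, Pat.p0, Pat.pS, Pat.Rejects, Pat.Fits, Nbhd.kind, hn.2]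

theorem trim_top_right {m n p P h v : Point} (hm : m.strict.Nonempty) (hp : p.strict.Nonempty)
    (hP : P.strict.Nonempty) (hh : h.strict.Nonempty) (hv : v.strict.Nonempty) (hn : n ∈ topPts) :
    fnPt .trim ⬝ m ⬝ n ⬝ p ⬝ P ⬝ h ⬝ v ∈ topPts := by
  refine apps_mem_topPts
    (f := .trim) ![hm.choose, .nabla, hp.choose, hP.choose, hh.choose, hv.choose]
    (a := ![m, n, p, P, h, v]) ?_ ?_
  · change ∀ j : Fin 6, _
    simp [Fin.forall_fin_succ, Filt.Nonempty.some_mem, hn.1]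
  · intro r hr
    refine ⟨(1 : Fin 6), ?_⟩
    revert r
    simp [rules, Pat.p0, Pat.pS, Pat.Rejects, Pat.Fits, Nbhd.kind, hn.2]

theorem get_le {B n x p v : Point} (hB : B.strict.Nonempty) (hn : n.strict.Nonempty)
    (hx : x.strict.Nonempty) (hp : p.strict.Nonempty) (hv : v.strict.Nonempty) :
    fnPt .head ⬝ x ⬝ (fnPt .trim ⬝ (conPt .S ⬝ x) ⬝ n ⬝ p ⬝ (fnPt .vec ⬝ B) ⬝ fnPt .tail ⬝ v) ≤
      fnPt .get ⬝ B ⬝ n ⬝ x ⬝ p ⬝ v := by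
  refine lowVal_rhs_le_apps (f := .get) (.head _) ![B, n, x, p, v] ![B, n, x, p, v] ?_ ?_
  · change ∀ j : Fin 5, _
    simp [Fin.forall_fin_succ, *]
  · change ∀ j : Fin 5, _
    simp [Fin.forall_fin_succ, *]

theorem Phi_le {B H K n v : Point} (hB : B.strict.Nonempty) (hH : H.strict.Nonempty)
    (hK : K.strict.Nonempty) (hn : n.strict.Nonempty) (hv : v.strict.Nonempty) :
    K ⬝ pval (.lam phiBody) (envOf .bot ![B, H, K, n, v]) ≤ fnPt .Phi ⬝ B ⬝ H ⬝ K ⬝ n ⬝ v := by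
  refine lowVal_rhs_le_apps (f := .Phi) (.head _) ![B, H, K, n, v] ![B, H, K, n, v] ?_ ?_
  · change ∀ j : Fin 5, _
    simp [Fin.forall_fin_succ, *]
  · change ∀ j : Fin 5, _
    simp [Fin.forall_fin_succ, *]

theorem Psi_inl {B H K n v x p s : Point} (hB : B.strict.Nonempty) (hH : H.strict.Nonempty)
    (hK : K.strict.Nonempty) (hn : n.strict.Nonempty) (hv : v.strict.Nonempty)
    (hx : x.strict.Nonempty) (hp : p.strict.Nonempty) (hs : ptInl p ≤ s) :
    fnPt .get ⬝ B ⬝ n ⬝ x ⬝ p ⬝ v ≤ fnPt .Psi ⬝ B ⬝ H ⬝ K ⬝ n ⬝ v ⬝ x ⬝ s := by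
  refine lowVal_rhs_le_apps (f := .Psi)
    (.head _) ![B, H, K, n, v, x, p] ![B, H, K, n, v, x, s] ?_ ?_
  · change ∀ j : Fin 7, _
    simp [Fin.forall_fin_succ, *]
  · change ∀ j : Fin 7, _
    simp [Fin.forall_fin_succ, *]

theorem Psi_inr {B H K n v x p s : Point} (hB : B.strict.Nonempty) (hH : H.strict.Nonempty)
    (hK : K.strict.Nonempty) (hn : n.strict.Nonempty) (hv : v.strict.Nonempty)
    (hx : x.strict.Nonempty) (hp : p.strict.Nonempty) (hs : ptInr p ≤ s) :
    fnPt .exit ⬝ (H ⬝ n ⬝ pval (.lam psiBody) (envOf .bot ![B, H, K, n, v, x, p])) ≤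
      fnPt .Psi ⬝ B ⬝ H ⬝ K ⬝ n ⬝ v ⬝ x ⬝ s := by
  refine lowVal_rhs_le_apps (f := .Psi)
    (.tail _ (.head _)) ![B, H, K, n, v, x, p] ![B, H, K, n, v, x, s] ?_ ?_
  · change ∀ j : Fin 7, _
    simp [Fin.forall_fin_succ, *]
  · change ∀ j : Fin 7, _
    simp [Fin.forall_fin_succ, *]

theorem Psi_top {B H K m v x n : Point} (hB : B.strict.Nonempty) (hH : H.strict.Nonempty)
    (hK : K.strict.Nonempty) (hm : m.strict.Nonempty) (hv : v.strict.Nonempty)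
    (hx : x.strict.Nonempty) (hn : n ∈ topPts) :
    fnPt .Psi ⬝ B ⬝ H ⬝ K ⬝ m ⬝ v ⬝ x ⬝ n ∈ topPts := by
  refine apps_mem_topPts
    (f := .Psi) ![hB.choose, hH.choose, hK.choose, hm.choose, hv.choose, hx.choose, .nabla]
    (a := ![B, H, K, m, v, x, n]) ?_ ?_
  · change ∀ j : Fin 7, _
    simp [Fin.forall_fin_succ, Filt.Nonempty.some_mem, hn.1]
  · intro r hr
    refine ⟨(6 : Fin 7), ?_⟩
    revert r
    simp [rules, Pat.pInl, Pat.pInr, Pat.Rejects, Pat.Fits, Nbhd.kind, hn.2]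

/-! ### Totality of the arithmetical and vector constants -/

theorem conVal_of_arity_zero {c : Constr} (h : c.arity = 0) (a : Fin c.arity → LVal) :
    conVal c = .con c a := by
  rw [← apps_conVal c a, show List.ofFn a = [] by simpa using h]
  rfl

theorem lazy_times (p q : Point) :
    (conPt .times ⬝ p ⬝ q).lazy = .con .times ![p.lazy, q.lazy] :=
  apps_conVal .times ![p.lazy, q.lazy]

theorem conPt_nonempty {c : Constr} (h : c.arity = 0) : (conPt c).strict.Nonempty :=
  (con_nonempty (a := fun i => (Fin.cast h i).elim0) fun i => (Fin.cast h i).elim0).mono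
    (conPt_le_of_arity_zero h _).1

theorem nonempty_of_app {p q : Point} (h : (p ⬝ q).strict.Nonempty) : p.strict.Nonempty :=
  let ⟨_, _, _, h⟩ := h
  ⟨_, h⟩

theorem times_nonempty {p q : Point} (hp : p.strict.Nonempty) (hq : q.strict.Nonempty) :
    (conPt .times ⬝ p ⬝ q).strict.Nonempty :=
  (con_nonempty (by change ∀ i : Fin 2, _; simp [Fin.forall_fin_two, hp, hq])).mono
    (con_le_conPt_apps .times ![p, q]).1

theorem fun_nonempty {p q : Point} (hp : p.strict.Nonempty) (hq : q.strict.Nonempty) :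
    (conPt .Fun ⬝ p ⬝ q).strict.Nonempty :=
  (con_nonempty (by change ∀ i : Fin 2, _; simp [Fin.forall_fin_two, hp, hq])).mono
    (con_le_conPt_apps .Fun ![p, q]).1

theorem NatEl.nonempty {n : Point} (h : NatEl n) : n.strict.Nonempty := natEl_total.nonempty h

theorem NatEl.ptS {n : Point} (h : NatEl n) : NatEl (ptS n) := .succ h le_rfl

theorem univEl_up {p q : Point} (h : p ≤ q) (hp : p ∈ univEl) : q ∈ univEl := univEl_total.up h hp

theorem conPt_N0_mem : conPt .N0 ∈ univEl :=
  ⟨conPt_nonempty rfl, by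
    change IsSmall (conVal _)
    rw [conVal_of_arity_zero rfl ![]]
    exact isSmall_N0⟩

theorem conPt_N1_mem : conPt .N1 ∈ univEl :=
  ⟨conPt_nonempty rfl, by
    change IsSmall (conVal _)
    rw [conVal_of_arity_zero rfl ![]]
    exact isSmall_N1⟩

theorem conPt_Nat_mem : conPt .Nat ∈ univEl :=
  ⟨conPt_nonempty rfl, by
    change IsSmall (conVal _)
    rw [conVal_of_arity_zero rfl ![]]
    exact isSmall_Nat⟩

theorem el_conPt_N0 : El (conPt .N0).lazy = emptyEl := by
  change El (conVal _) = _
  rw [conVal_of_arity_zero rfl ![], el_N0]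

theorem el_conPt_N1 : El (conPt .N1).lazy = unitEl := by
  change El (conVal _) = _
  rw [conVal_of_arity_zero rfl ![], el_N1]

theorem el_conPt_Nat : El (conPt .Nat).lazy = {p | NatEl p} := by
  change El (conVal _) = _
  rw [conVal_of_arity_zero rfl ![], el_Nat]

theorem le_mem {m n : Point} (hm : NatEl m) (hn : NatEl n) : fnPt .le ⬝ m ⬝ n ∈ univEl := by
  induction hm generalizing n with
  | top hm => exact univEl_total.top (le_top hn.nonempty hm)
  | zero hm => exact univEl_up (le_zero hn.nonempty hm) conPt_N1_mem
  | succ hx hm ih =>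
    cases hn with
    | top hn => exact univEl_total.top (le_succ_top hx.nonempty hm hn)
    | zero hn => exact univEl_up (le_succ_zero hx.nonempty hm hn) conPt_N0_mem
    | succ hy hn => exact univEl_up (le_succ_succ hx.nonempty hy.nonempty hm hn) (ih hy)

theorem el_le_zero {m n : Point} (hm : ptZero ≤ m) (hn : NatEl n) :
    El (fnPt .le ⬝ m ⬝ n).lazy = unitEl := by
  rw [← (le_zero hn.nonempty hm).2, el_conPt_N1]

theorem el_le_succ_succ {m n x y : Point} (hx : NatEl x) (hy : NatEl y) (hm : ptS x ≤ m)
    (hn : ptS y ≤ n) : El (fnPt .le ⬝ m ⬝ n).lazy = El (fnPt .le ⬝ x ⬝ y).lazy := by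
  rw [← (le_succ_succ hx.nonempty hy.nonempty hm hn).2]

theorem ptZero_mem_unitEl : ptZero ∈ unitEl := ptZero_nonempty

/-- The total elements of the type of `less m n`. -/
def lessEl (m n : Point) : Set Point :=
  sumEl (El (fnPt .le ⬝ ptS m ⬝ n).lazy) (El (fnPt .le ⬝ n ⬝ m).lazy)

theorem lessEl_total {m n : Point} (hm : NatEl m) (hn : NatEl n) : Total (lessEl m n) :=
  sumEl_total (le_mem hm.ptS hn).2.isTy.total (le_mem hn hm).2.isTy.total

theorem less_mem {m n : Point} (hm : NatEl m) (hn : NatEl n) :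
    fnPt .less ⬝ m ⬝ n ∈ lessEl m n := by
  induction hn generalizing m with
  | top hn => exact .inl (less_top hm.nonempty hn)
  | @zero n hn =>
    refine .inr (.inr ⟨ptZero, ?_, less_zero hm.nonempty hn⟩)
    rw [el_le_zero hn hm]
    exact ptZero_mem_unitEl
  | @succ n y hy hn ih =>
    have hn' : NatEl n := .succ hy hn
    cases id hm with
    | top hm' => exact .inl (less_top_succ hy.nonempty hn hm')
    | zero hm' =>
      refine .inr (.inl ⟨ptZero, ?_, less_zero_succ hy.nonempty hm' hn⟩)
      rw [el_le_succ_succ hm hy le_rfl hn, el_le_zero hm' hy]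
      exact ptZero_mem_unitEl
    | succ hx hm' =>
      rename_i x
      refine (lessEl_total hm hn').up (less_succ_succ hx.nonempty hy.nonempty hm' hn) ?_
      have h := ih hx
      have h1 : (fnPt .le ⬝ m ⬝ y).lazy = (fnPt .le ⬝ ptS x ⬝ y).lazy := by
        simp only [Point.app, hm'.2]
      rwa [lessEl, ← h1, ← el_le_succ_succ hm hy le_rfl hn,
        ← el_le_succ_succ hy hx hn hm'] at h

/-- A family of small types over the natural numbers. -/
def Fam (B : Point) : Prop := ∀ n, NatEl n → B ⬝ n ∈ univEl

theorem natEl_top : NatEl ⟨⊤, ∅⟩ := .top top_mem_topPts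

theorem Fam.nonempty {B : Point} (hB : Fam B) : B.strict.Nonempty :=
  nonempty_of_app (hB _ natEl_top).1

theorem rec_mem {C P Q n : Point} (hC : Fam C) (hP : P ∈ El (C ⬝ ptZero).lazy)
    (hQ : ∀ n, NatEl n → ∀ y ∈ El (C ⬝ n).lazy, Q ⬝ n ⬝ y ∈ El (C ⬝ ptS n).lazy)
    (hn : NatEl n) : fnPt .Rec ⬝ P ⬝ Q ⬝ n ∈ El (C ⬝ n).lazy := by
  have hP' := el_nonempty hP
  have hQ' : Q.strict.Nonempty := nonempty_of_app <| nonempty_of_app <| el_nonempty <|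
    hQ _ natEl_top _ (el_top (hC _ natEl_top).2.isTy top_mem_topPts)
  induction hn with
  | top hn => exact el_top (hC _ (.top hn)).2.isTy (rec_top hP' hQ' hn)
  | zero hn =>
    have h : (C ⬝ _).lazy = (C ⬝ _).lazy := congrArg C.lazy.app hn.2
    rw [h] at hP
    exact el_up (rec_zero hP' hQ' hn) hP
  | succ hx hn ih =>
    have h : (C ⬝ _).lazy = (C ⬝ _).lazy := congrArg C.lazy.app hn.2
    have h' := hQ _ hx _ ih
    rw [h] at h'
    exact el_up (rec_succ hP' hQ' hx.nonempty hn) h'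

theorem vec_mem {B n : Point} (hB : Fam B) (hn : NatEl n) : fnPt .vec ⬝ B ⬝ n ∈ univEl := by
  induction hn with
  | top hn => exact univEl_total.top (vec_top hB.nonempty hn)
  | zero hn => exact univEl_up (vec_zero hB.nonempty hn) conPt_N1_mem
  | succ hx hn ih =>
    refine univEl_up (vec_succ hB.nonempty hx.nonempty hn)
      ⟨times_nonempty ih.1 (hB _ hx).1, ?_⟩
    rw [lazy_times]
    exact isSmall_times ih.2 (hB _ hx).2

theorem el_vec_succ {B n x : Point} (hB : Fam B) (hx : NatEl x) (hn : ptS x ≤ n) :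
    El (fnPt .vec ⬝ B ⬝ n).lazy = prodEl (El (fnPt .vec ⬝ B ⬝ x).lazy) (El (B ⬝ x).lazy) := by
  rw [← (vec_succ hB.nonempty hx.nonempty hn).2, lazy_times,
    el_times (vec_mem hB hx).2.isTy (hB _ hx).2.isTy]

theorem head_mem {B x v : Point} (hB : Fam B) (hx : NatEl x)
    (hv : v ∈ El (fnPt .vec ⬝ B ⬝ ptS x).lazy) : fnPt .head ⬝ x ⬝ v ∈ El (B ⬝ x).lazy := by
  rw [el_vec_succ hB hx le_rfl] at hv
  obtain hv | ⟨q, hq, q', hq', hv⟩ := hv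
  · exact el_top (hB _ hx).2.isTy (head_top hx.nonempty hv)
  · exact el_up (head_pair hx.nonempty (el_nonempty hq) (el_nonempty hq') hv) hq'

theorem tail_mem {B x v : Point} (hB : Fam B) (hx : NatEl x)
    (hv : v ∈ El (fnPt .vec ⬝ B ⬝ ptS x).lazy) :
    fnPt .tail ⬝ x ⬝ v ∈ El (fnPt .vec ⬝ B ⬝ x).lazy := by
  rw [el_vec_succ hB hx le_rfl] at hv
  obtain hv | ⟨q, hq, q', hq', hv⟩ := hv
  · exact el_top (vec_mem hB hx).2.isTy (tail_top hx.nonempty hv)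
  · exact el_up (tail_pair hx.nonempty (el_nonempty hq) (el_nonempty hq') hv) hq

/-- The total elements of the type `T P`. -/
def stepEl (P : Point) : Set Point :=
  {h | ∀ k, NatEl k → ∀ y ∈ El (P ⬝ ptS k).lazy, h ⬝ k ⬝ y ∈ El (P ⬝ k).lazy}

theorem stepEl_nonempty {P h : Point} (hP : Fam P) (hh : h ∈ stepEl P) : h.strict.Nonempty :=
  nonempty_of_app <| nonempty_of_app <| el_nonempty <|
    hh _ natEl_top _ (el_top (hP _ natEl_top.ptS).2.isTy top_mem_topPts)

theorem el_app_congr {P m n : Point} (h : m ≤ n) : El (P ⬝ m).lazy = El (P ⬝ n).lazy := by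
  simp only [Point.app, h.2]

theorem exit_top_mem {e : LVal} (he : IsTy e) {p : Point} (hp : p.strict.Nonempty) :
    fnPt .exit ⬝ p ∈ El e := el_top he (exit_top hp)

/-- The last rule of `trim`, its two abstractions being described by their values. -/
theorem trim_succ_succ_shift {x y p P h v n m : Point} (hx : x.strict.Nonempty)
    (hy : y.strict.Nonempty) (hp : p.strict.Nonempty) (hP : P.strict.Nonempty)
    (hh : h.strict.Nonempty) (hv : v.strict.Nonempty) (hn : ptS x ≤ n) (hm : ptS y ≤ m) :
    ∃ P' h' : Point, (∀ k, k.strict.Nonempty → P ⬝ ptS k ≤ P' ⬝ k) ∧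
      (∀ k, k.strict.Nonempty → h ⬝ ptS k ≤ h' ⬝ k) ∧
      fnPt .trim ⬝ x ⬝ y ⬝ p ⬝ P' ⬝ h' ⬝ v ≤ fnPt .trim ⬝ n ⬝ m ⬝ p ⬝ P ⬝ h ⬝ v :=
  ⟨_, _, fun k hk => (Point.app_mono le_rfl (ptS_le k)).trans
      (lowVal_le_lam_app (.app (.var 4) (.tS (.var 0))) (envOf .bot ![x, y, p, P, h, v]) hk),
    fun k hk => (Point.app_mono le_rfl (ptS_le k)).trans
      (lowVal_le_lam_app (.app (.var 5) (.tS (.var 0))) (envOf .bot ![x, y, p, P, h, v]) hk),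
    trim_succ_succ hx hy hp hP hh hv hn hm⟩

theorem trim_mem {n m p P h v : Point} (hn : NatEl n) (hm : NatEl m)
    (hp : p ∈ El (fnPt .le ⬝ n ⬝ m).lazy) (hP : Fam P) (hh : h ∈ stepEl P)
    (hv : v ∈ El (P ⬝ m).lazy) :
    fnPt .trim ⬝ n ⬝ m ⬝ p ⬝ P ⬝ h ⬝ v ∈ El (P ⬝ n).lazy := by
  have hp' := el_nonempty hp
  induction hn generalizing m P h v with
  | top hn =>
    exact el_top (hP _ (.top hn)).2.isTy (trim_top_left hm.nonempty hp' hP.nonempty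
      (stepEl_nonempty hP hh) (el_nonempty hv) hn)
  | @zero n hn =>
    -- The induction on `m` changes `n` and `m`, hence the type of `p`; only `p ≠ ⊥` is needed.
    clear hp
    induction hm generalizing n v with
    | top hm =>
      exact el_top (hP _ (.zero hn)).2.isTy (trim_top_right (NatEl.zero hn).nonempty hp' hP.nonempty
        (stepEl_nonempty hP hh) (el_nonempty hv) hm)
    | zero hm =>
      rw [← el_app_congr hm, el_app_congr hn] at hv
      exact el_up (trim_zero_zero hp' hP.nonempty (stepEl_nonempty hP hh) (el_nonempty hv) hn hm) hv
    | succ hy hm ih =>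
      rw [← el_app_congr hm] at hv
      rw [← el_app_congr hn, el_app_congr ptZero_le]
      exact el_up (trim_zero_succ hy.nonempty hp' hP.nonempty (stepEl_nonempty hP hh)
        (el_nonempty hv) hn hm) (ih ptZero_le (hh _ hy _ hv))
  | @succ n x hx hn ih =>
    cases hm with
    | top hm =>
      exact el_top (hP _ (.succ hx hn)).2.isTy (trim_top_right (NatEl.succ hx hn).nonempty hp'
        hP.nonempty (stepEl_nonempty hP hh) (el_nonempty hv) hm)
    | zero hm =>
      exact el_up (trim_succ_zero hx.nonempty hp' hP.nonempty (stepEl_nonempty hP hh)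
        (el_nonempty hv) hn hm) (exit_top_mem (hP _ (.succ hx hn)).2.isTy hp')
    | @succ _ y hy hm =>
      obtain ⟨P', h', key, key', hle⟩ :=
        trim_succ_succ_shift hx.nonempty hy.nonempty hp' hP.nonempty
          (stepEl_nonempty hP hh) (el_nonempty hv) hn hm
      rw [← el_app_congr hn, (key _ hx.nonempty).2]
      refine el_up hle (ih hy ?_ (fun k hk => ?_) (fun k hk z hz => ?_) ?_)
      · rwa [el_le_succ_succ hx hy hn hm] at hp
      · exact univEl_up (key k hk.nonempty) (hP _ hk.ptS)
      · rw [← (key _ hk.ptS.nonempty).2] at hz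
        rw [← (key _ hk.nonempty).2]
        exact el_up (Point.app_mono (key' k hk.nonempty) le_rfl) (hh _ hk.ptS _ hz)
      · rwa [← (key _ hy.nonempty).2, el_app_congr hm]

theorem tail_mem_stepEl {B : Point} (hB : Fam B) : fnPt .tail ∈ stepEl (fnPt .vec ⬝ B) :=
  fun _ hk _ hy => tail_mem hB hk hy

theorem get_mem {B n x p v : Point} (hB : Fam B) (hn : NatEl n) (hx : NatEl x)
    (hp : p ∈ El (fnPt .le ⬝ ptS x ⬝ n).lazy) (hv : v ∈ El (fnPt .vec ⬝ B ⬝ n).lazy) :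
    fnPt .get ⬝ B ⬝ n ⬝ x ⬝ p ⬝ v ∈ El (B ⬝ x).lazy := by
  refine el_up (get_le hB.nonempty hn.nonempty hx.nonempty (el_nonempty hp) (el_nonempty hv))
    (head_mem hB hx ?_)
  have h : NatEl (conPt .S ⬝ x) := .succ hx (ptS_le x)
  rw [el_app_congr (ptS_le x)]
  refine trim_mem h hn ?_ (fun k hk => vec_mem hB hk) (tail_mem_stepEl hB) hv
  have h' : (fnPt .le ⬝ ptS x ⬝ n).lazy = (fnPt .le ⬝ (conPt .S ⬝ x) ⬝ n).lazy := by
    simp only [Point.app, (ptS_le x).2]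
  rwa [← h']

/-! ### Totality of bar recursion -/

/-- The numerals. -/
def num : ℕ → Point
  | 0 => ptZero
  | k + 1 => ptS (num k)

theorem natEl_num : ∀ k, NatEl (num k)
  | 0 => .zero le_rfl
  | k + 1 => (natEl_num k).ptS

theorem num_nonempty (k : ℕ) : (num k).strict.Nonempty := (natEl_num k).nonempty

theorem lazy_subset_of_ptS {p q : Point} (h : (ptS p).lazy ⊆ (ptS q).lazy) :
    p.lazy ⊆ q.lazy := fun t ht => by
  obtain h' | ⟨i, x, hx, h'⟩ := h (Or.inr ⟨(0 : Fin 1), t, ht, rfl⟩)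
  · cases h'
  · obtain rfl : i = (0 : Fin 1) := Subsingleton.elim (α := Fin 1) _ _
    cases h'
    exact hx

theorem ptS_lazy_congr {p q : Point} (h : p.lazy = q.lazy) : (ptS p).lazy = (ptS q).lazy := by
  change LVal.con .S _ = LVal.con .S _
  congr 1
  exact funext_fin_one h

theorem tag_S_mem_ptS (p : Point) : Tok.tag .S ∈ (ptS p).lazy := LVal.tag_mem_con.2 rfl

theorem tag_zero_not_mem_ptS (p : Point) : Tok.tag .zero ∉ (ptS p).lazy :=
  fun h => by cases LVal.tag_mem_con.1 h

theorem tag_S_not_mem_ptZero : Tok.tag .S ∉ ptZero.lazy :=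
  fun h => by cases LVal.tag_mem_con.1 h

theorem tag_zero_mem_ptZero : Tok.tag .zero ∈ ptZero.lazy := LVal.tag_mem_con.2 rfl

theorem eq_of_num_lazy_subset {i j : ℕ} (h : (num i).lazy ⊆ (num j).lazy) : i = j := by
  induction i generalizing j with
  | zero =>
    cases j with
    | zero => rfl
    | succ j => exact (tag_zero_not_mem_ptS _ (h tag_zero_mem_ptZero)).elim
  | succ i ih =>
    cases j with
    | zero => exact (tag_S_not_mem_ptZero (h (tag_S_mem_ptS _))).elim
    | succ j => rw [ih (lazy_subset_of_ptS h)]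

theorem num_lazy_finite (k : ℕ) : ∃ l : List Tok, {t | t ∈ l} = (num k).lazy := by
  induction k with
  | zero =>
    refine ⟨[.tag .zero], ?_⟩
    ext t
    have : IsEmpty (Fin Constr.zero.arity) := inferInstanceAs (IsEmpty (Fin 0))
    simp [num, ptZero, Point.con, LVal.con]
  | succ k ih =>
    obtain ⟨l, hl⟩ := ih
    refine ⟨.tag .S :: l.map (.arg .S 0), ?_⟩
    ext t
    have hl' : ∀ t, t ∈ l ↔ t ∈ (num k).lazy := fun t => by rw [← hl]; rfl
    have h : (∃ i : Fin Constr.S.arity, ∃ x ∈ (![num k] i).lazy, t = .arg .S i x) ↔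
        ∃ x ∈ (num k).lazy, t = .arg .S 0 x :=
      ⟨fun ⟨i, x, hx, ht⟩ => by
        obtain rfl : i = (0 : Fin 1) := Subsingleton.elim (α := Fin 1) _ _
        exact ⟨x, hx, ht⟩, fun ⟨x, hx, ht⟩ => ⟨(0 : Fin 1), x, hx, ht⟩⟩
    change t ∈ Tok.tag .S :: l.map (Tok.arg .S 0) ↔ t = .tag .S ∨
      ∃ i : Fin Constr.S.arity, ∃ x ∈ (![num k] i).lazy, t = .arg .S i x
    rw [h]
    simp [hl', eq_comm]

/-- Either `n` is a numeral, or it is not decided to be one, and then it is larger than every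
number. -/
theorem num_le_or_less {n : Point} (hn : NatEl n) : (∃ k, num k ≤ n) ∨
    ∀ x, NatEl x → fnPt .less ⬝ x ⬝ n ∈ topPts ∨
      ∃ p ∈ El (fnPt .le ⬝ ptS x ⬝ n).lazy, ptInl p ≤ fnPt .less ⬝ x ⬝ n := by
  induction hn with
  | top hn => exact .inr fun x hx => .inl (less_top hx.nonempty hn)
  | zero hn => exact .inl ⟨0, hn⟩
  | @succ n y hy hn ih =>
    obtain ⟨k, hk⟩ | ih := ih
    · exact .inl ⟨k + 1, (ptS_mono hk).trans hn⟩
    · refine .inr fun x hx => ?_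
      cases id hx with
      | top hx' => exact .inl (less_top_succ hy.nonempty hn hx')
      | zero hx' =>
        refine .inr ⟨ptZero, ?_, less_zero_succ hy.nonempty hx' hn⟩
        rw [el_le_succ_succ hx hy le_rfl hn, el_le_zero hx' hy]
        exact ptZero_mem_unitEl
      | @succ _ z hz hx' =>
        have hle := less_succ_succ hz.nonempty hy.nonempty hx' hn
        refine (ih z hz).imp (topPts_up hle) fun ⟨p, hp, h⟩ => ⟨p, ?_, h.trans hle⟩
        have h1 : (fnPt .le ⬝ x ⬝ y).lazy = (fnPt .le ⬝ ptS z ⬝ y).lazy := by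
          simp only [Point.app, hx'.2]
        rwa [el_le_succ_succ hx hy le_rfl hn, h1]

theorem Filt.prin_nonempty (U : Nbhd) : (prin U).Nonempty := ⟨U, Incl.refl U⟩

theorem ptS_prin_le (U : Nbhd) (e : LVal) :
    ptS ⟨.prin U, e⟩ ≤ ⟨.prin (.con .S ![U]), (ptS ⟨.prin U, e⟩).lazy⟩ := by
  refine ⟨?_, rfl⟩
  rintro V ⟨W, hW, hV⟩
  refine Incl.trans (.con ?_) hV
  change ∀ i : Fin 1, _
  exact fun i => by obtain rfl : i = 0 := Subsingleton.elim _ _; exact hW (0 : Fin 1)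

theorem ptZero_le_prin : ptZero ≤ ⟨.prin (.con .zero ![]), ptZero.lazy⟩ :=
  ⟨fun _ ⟨_, _, hV⟩ => Incl.trans (.con nofun) hV, rfl⟩

/-- Finite information on a total number `x` that suffices to compare it with large numerals. The
same neighbourhood `U` serves for all numerals, as the limit inferior in `eventually_safe` requires.
-/
theorem less_num {x : Point} (hx : NatEl x) : ∃ U ∈ x.strict, ∃ i,
    (num i ≤ ⟨.prin U, x.lazy⟩ ∧
      ∀ k > i, ptInl ptZero ≤ fnPt .less ⬝ ⟨.prin U, x.lazy⟩ ⬝ num k) ∨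
    ((∀ j, ¬ (num j).lazy ⊆ x.lazy) ∧
      ∀ k > i, fnPt .less ⬝ ⟨.prin U, x.lazy⟩ ⬝ num k ∈ topPts) := by
  induction hx with
  | top hx =>
    refine ⟨.nabla, hx.1, 0, .inr ⟨fun j h => ?_, fun k hk => ?_⟩⟩
    · rw [hx.2] at h
      cases j with
      | zero => exact h tag_zero_mem_ptZero
      | succ j => exact h (tag_S_mem_ptS _)
    · obtain ⟨k, rfl⟩ := Nat.exists_eq_succ_of_ne_zero hk.ne'
      exact less_top_succ (num_nonempty k) le_rfl ⟨Incl.refl _, hx.2⟩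
  | @zero x hx =>
    have h : ptZero ≤ ⟨.prin (.con .zero ![]), x.lazy⟩ := hx.2 ▸ ptZero_le_prin
    refine ⟨_, hx.1 ⟨![], nofun, .refl _⟩, 0, .inl ⟨h, fun k hk => ?_⟩⟩
    obtain ⟨k, rfl⟩ := Nat.exists_eq_succ_of_ne_zero hk.ne'
    exact less_zero_succ (num_nonempty k) h le_rfl
  | @succ x y _ hx ih =>
    obtain ⟨U, hU, i, ih⟩ := ih
    have h : ptS ⟨.prin U, y.lazy⟩ ≤ ⟨.prin (.con .S ![U]), x.lazy⟩ := by
      rw [← hx.2, ptS_lazy_congr (p := y) (q := ⟨.prin U, y.lazy⟩) rfl]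
      exact ptS_prin_le U y.lazy
    have hle : ∀ k, fnPt .less ⬝ ⟨.prin U, y.lazy⟩ ⬝ num k ≤
        fnPt .less ⬝ ⟨.prin (.con .S ![U]), x.lazy⟩ ⬝ num (k + 1) := fun k =>
      less_succ_succ (Filt.prin_nonempty U) (num_nonempty k) h le_rfl
    refine ⟨_, mem_of_ptS_le hx hU, i + 1, ih.imp ?_ ?_⟩
    · rintro ⟨hi, ih⟩
      refine ⟨(ptS_mono hi).trans h, fun k hk => ?_⟩
      obtain ⟨k, rfl⟩ := Nat.exists_eq_succ_of_ne_zero (Nat.ne_zero_of_lt hk)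
      exact (ih k (by omega)).trans (hle k)
    · rintro ⟨hj, ih⟩
      refine ⟨fun j h' => ?_, fun k hk => ?_⟩
      · rw [← hx.2] at h'
        cases j with
        | zero => exact tag_zero_not_mem_ptS _ (h' tag_zero_mem_ptZero)
        | succ j => exact hj j (lazy_subset_of_ptS h')
      · obtain ⟨k, rfl⟩ := Nat.exists_eq_succ_of_ne_zero (Nat.ne_zero_of_lt hk)
        exact topPts_up (hle k) (ih k (by omega))

/-- `trim` removes the last components of a vector one by one. -/
theorem le_trim {p : Point} (hp : p.strict.Nonempty) {j k : ℕ} (hjk : j ≤ k) {n P h : Point}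
    {v : ℕ → Point} (hn : num j ≤ n) (hP : Fam P) (hv : ∀ i, (v i).strict.Nonempty)
    (hh : ∀ i, v i ≤ h ⬝ num i ⬝ v (i + 1)) :
    v j ≤ fnPt .trim ⬝ n ⬝ num k ⬝ p ⬝ P ⬝ h ⬝ v k := by
  have hh' : h.strict.Nonempty :=
    nonempty_of_app (nonempty_of_app ((hv 0).mono (hh 0).1))
  induction j generalizing k n P h v with
  | zero =>
    clear hjk
    induction k generalizing n with
    | zero => exact trim_zero_zero hp hP.nonempty hh' (hv 0) hn le_rfl
    | succ k ih =>
      exact ((ih ptZero_le).trans (Point.app_mono le_rfl (hh k))).trans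
        (trim_zero_succ (num_nonempty k) hp hP.nonempty hh' (hv (k + 1)) hn le_rfl)
  | succ j ih =>
    obtain ⟨k, rfl⟩ := Nat.exists_eq_succ_of_ne_zero (Nat.ne_zero_of_lt hjk)
    obtain ⟨P', h', key, key', hle⟩ := trim_succ_succ_shift (num_nonempty j) (num_nonempty k) hp
      hP.nonempty hh' (hv (k + 1)) hn le_rfl
    have hv' : ∀ i, v (i + 1) ≤ h' ⬝ num i ⬝ v (i + 1 + 1) := fun i =>
      (hh (i + 1)).trans (Point.app_mono (key' _ (num_nonempty i)) le_rfl)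
    exact (ih (v := fun i => v (i + 1)) (Nat.le_of_succ_le_succ hjk) le_rfl
      (fun m hm => univEl_up (key m hm.nonempty) (hP _ hm.ptS)) (fun i => hv (i + 1)) hv'
      (nonempty_of_app (nonempty_of_app ((hv (0 + 1)).mono (hv' 0).1)))).trans hle

/-- The components of a vector are found by `get`. -/
theorem le_get {B p x : Point} (hB : Fam B) (hp : p.strict.Nonempty) {v : ℕ → Point}
    (hv : ∀ i, (v i).strict.Nonempty) (ht : ∀ i, v i ≤ fnPt .tail ⬝ num i ⬝ v (i + 1))
    {i k : ℕ} (hik : i < k) (hx : num i ≤ x) :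
    fnPt .head ⬝ num i ⬝ v (i + 1) ≤ fnPt .get ⬝ B ⬝ num k ⬝ x ⬝ p ⬝ v k :=
  (Point.app_mono (Point.app_mono le_rfl hx) (le_trim hp hik
    ((ptS_mono hx).trans (ptS_le x)) (fun _ hm => vec_mem hB hm) hv ht)).trans
    (get_le hB.nonempty (num_nonempty k) ((num_nonempty i).mono hx.1) hp (hv k))

/-- The hypotheses of bar recursion: `B` is a family of small types, `H` is total of type
`Π n. ¬¬ B n`, and `K` is total of type `¬ Π n. B n`. -/
structure BarHyp (B H K : Point) : Prop where
  fam : Fam B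
  H_mem : ∀ n, NatEl n → ∀ q : Point, (∀ y ∈ El (B ⬝ n).lazy, q ⬝ y ∈ emptyEl) →
    H ⬝ n ⬝ q ∈ emptyEl
  K_mem : ∀ f : Point, (∀ x, NatEl x → f ⬝ x ∈ El (B ⬝ x).lazy) → K ⬝ f ∈ emptyEl

theorem mem_emptyEl_of_topPts {p q : Point} (hp : p ∈ topPts) (hq : q.strict.Nonempty) :
    p ⬝ q ∈ emptyEl := (app_mem_topPts hp hq).1

theorem BarHyp.H_nonempty {B H K : Point} (h : BarHyp B H K) : H.strict.Nonempty :=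
  nonempty_of_app <| nonempty_of_app ⟨_, h.H_mem _ natEl_top ⟨⊤, ∅⟩ fun _ hy =>
    mem_emptyEl_of_topPts top_mem_topPts (el_nonempty hy)⟩

theorem BarHyp.K_nonempty {B H K : Point} (h : BarHyp B H K) : K.strict.Nonempty :=
  nonempty_of_app ⟨_, h.K_mem ⟨⊤, ∅⟩ fun _ hx =>
    el_top (h.fam _ hx).2.isTy (app_mem_topPts top_mem_topPts hx.nonempty)⟩

/-- The total elements of the type `vec B n`. -/
def vecEl (B n : Point) : Set Point := El (fnPt .vec ⬝ B ⬝ n).lazy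

/-- The function that `Φ B H K n v` passes to `K`. -/
def phiArg (B H K n v : Point) : Point := pval (.lam phiBody) (envOf .bot ![B, H, K, n, v])

theorem le_phiArg (B H K n v : Point) {x : Point} (hx : x.strict.Nonempty) :
    fnPt .Psi ⬝ B ⬝ H ⬝ K ⬝ n ⬝ v ⬝ x ⬝ (fnPt .less ⬝ x ⬝ n) ≤ phiArg B H K n v ⬝ x :=
  lowVal_le_lam_app phiBody (envOf .bot ![B, H, K, n, v]) hx

/-- The value of `Φ B H K n v` is total. -/
def Safe (B H K n v : Point) : Prop := fnPt .Phi ⬝ B ⬝ H ⬝ K ⬝ n ⬝ v ∈ emptyEl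

section
variable {B H K n v x s : Point}

theorem safe_of_phiArg (h : BarHyp B H K) (hn : NatEl n) (hv : v ∈ vecEl B n)
    (hg : K ⬝ phiArg B H K n v ∈ emptyEl) : Safe B H K n v :=
  emptyEl_total.up (Phi_le h.fam.nonempty h.H_nonempty h.K_nonempty hn.nonempty
    (el_nonempty hv)) hg

theorem psi_mem_of_top (h : BarHyp B H K) (hn : NatEl n) (hv : v ∈ vecEl B n) (hx : NatEl x)
    (hs : s ∈ topPts) : fnPt .Psi ⬝ B ⬝ H ⬝ K ⬝ n ⬝ v ⬝ x ⬝ s ∈ El (B ⬝ x).lazy :=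
  el_top (h.fam _ hx).2.isTy (Psi_top h.fam.nonempty h.H_nonempty h.K_nonempty hn.nonempty
    (el_nonempty hv) hx.nonempty hs)

theorem psi_mem_of_inl (h : BarHyp B H K) (hn : NatEl n) (hv : v ∈ vecEl B n) (hx : NatEl x)
    {p : Point} (hp : p ∈ El (fnPt .le ⬝ ptS x ⬝ n).lazy) (hs : ptInl p ≤ s) :
    fnPt .Psi ⬝ B ⬝ H ⬝ K ⬝ n ⬝ v ⬝ x ⬝ s ∈ El (B ⬝ x).lazy :=
  el_up (Psi_inl h.fam.nonempty h.H_nonempty h.K_nonempty hn.nonempty (el_nonempty hv) hx.nonempty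
    (el_nonempty hp) hs) (get_mem h.fam hn hx hp hv)

theorem psi_mem_of_inr (h : BarHyp B H K) (hn : NatEl n) (hv : v ∈ vecEl B n) (hx : NatEl x)
    (hsafe : ∀ y ∈ El (B ⬝ n).lazy, Safe B H K (ptS n) (ptPair v y))
    {p : Point} (hp : p.strict.Nonempty) (hs : ptInr p ≤ s) :
    fnPt .Psi ⬝ B ⬝ H ⬝ K ⬝ n ⬝ v ⬝ x ⬝ s ∈ El (B ⬝ x).lazy := by
  refine el_up (Psi_inr h.fam.nonempty h.H_nonempty h.K_nonempty hn.nonempty (el_nonempty hv)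
    hx.nonempty hp hs) (exit_top_mem (h.fam _ hx).2.isTy
    ⟨_, h.H_mem n hn _ fun y hy => emptyEl_total.up ?_ (hsafe y hy)⟩)
  exact (Point.app_mono (Point.app_mono le_rfl (ptS_le n)) (ptPair_le v y)).trans
    (lowVal_le_lam_app psiBody (envOf .bot ![B, H, K, n, v, x, p]) (el_nonempty hy))

theorem psi_mem_of_safe (h : BarHyp B H K) (hn : NatEl n) (hv : v ∈ vecEl B n) (hx : NatEl x)
    (hsafe : ∀ y ∈ El (B ⬝ n).lazy, Safe B H K (ptS n) (ptPair v y)) (hs : s ∈ lessEl x n) :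
    fnPt .Psi ⬝ B ⬝ H ⬝ K ⬝ n ⬝ v ⬝ x ⬝ s ∈ El (B ⬝ x).lazy := by
  obtain hs | ⟨p, hp, hs⟩ | ⟨p, hp, hs⟩ := hs
  · exact psi_mem_of_top h hn hv hx hs
  · exact psi_mem_of_inl h hn hv hx hp hs
  · exact psi_mem_of_inr h hn hv hx hsafe (el_nonempty hp) hs

/-- The value of `Φ` at a vector is total if it is so at all extensions of the vector. -/
theorem safe_of_extensions (h : BarHyp B H K) (hn : NatEl n) (hv : v ∈ vecEl B n)
    (hsafe : ∀ y ∈ El (B ⬝ n).lazy, Safe B H K (ptS n) (ptPair v y)) : Safe B H K n v :=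
  safe_of_phiArg h hn hv <| h.K_mem _ fun _ hx => el_up (le_phiArg B H K n v hx.nonempty)
    (psi_mem_of_safe h hn hv hx hsafe (less_mem hx hn))

theorem ptPair_mem_vecEl (hB : Fam B) (hn : NatEl n) (hv : v ∈ vecEl B n) {y : Point}
    (hy : y ∈ El (B ⬝ n).lazy) : ptPair v y ∈ vecEl B (ptS n) := by
  rw [vecEl, el_vec_succ hB hn le_rfl]
  exact .inr ⟨v, hv, y, hy, le_rfl⟩

end

/-- The pointwise limit inferior of a sequence of filters. -/
def Filt.liminf (d : ℕ → Filt) : Filt where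
  carrier := {U | ∃ k₀, ∀ k ≥ k₀, U ∈ d k}
  inter_mem := by
    rintro U V ⟨k, hk⟩ ⟨k', hk'⟩
    exact ⟨max k k', fun i hi => (d i).inter_mem (hk i (le_trans (le_max_left _ _) hi))
      (hk' i (le_trans (le_max_right _ _) hi))⟩
  up_mem := by
    rintro U V ⟨k, hk⟩ hV
    exact ⟨k, fun i hi => (d i).up_mem (hk i hi) hV⟩

/-- The function that maps the `i`-th numeral to `u i`. -/
def LVal.ofSeq (u : ℕ → LVal) : LVal :=
  {t | ∃ (l : List Tok) (b : Tok) (i : ℕ), t = .fn l b ∧ (num i).lazy ⊆ {x | x ∈ l} ∧ b ∈ u i}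

theorem LVal.ofSeq_num (u : ℕ → LVal) (i : ℕ) : app (ofSeq u) (num i).lazy = u i := by
  ext t
  constructor
  · rintro ⟨l, hl, l', b, j, he, hj, hb⟩
    cases he
    obtain rfl := eq_of_num_lazy_subset (hj.trans hl)
    exact hb
  · intro ht
    obtain ⟨l, hl⟩ := num_lazy_finite i
    exact ⟨l, fun x hx => hl ▸ hx, l, t, i, rfl, hl.ge, ht⟩

theorem LVal.ofSeq_of_not_num (u : ℕ → LVal) {e : LVal} (he : ∀ i, ¬ (num i).lazy ⊆ e) :
    app (ofSeq u) e = ∅ := by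
  refine Set.eq_empty_of_forall_notMem ?_
  rintro t ⟨l, hl, l', b, j, h, hj, hb⟩
  cases h
  exact he j (hj.trans hl)

/-- Along an infinite sequence of vectors, each extending the one before, the value of `Φ` is
eventually total. The arguments of `K` converge to the function that enumerates the components of
the vectors; it is total, and by continuity a finite part of it makes `K` total. -/
theorem eventually_safe {B H K : Point} (h : BarHyp B H K) {v : ℕ → Point}
    (hv : ∀ i, v i ∈ vecEl B (num i)) (ht : ∀ i, v i ≤ fnPt .tail ⬝ num i ⬝ v (i + 1)) :
    ∃ k₀, ∀ k ≥ k₀, Safe B H K (num k) (v k) := by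
  have hne : ∀ i, (v i).strict.Nonempty := fun i => el_nonempty (hv i)
  set u : ℕ → Point := fun i => fnPt .head ⬝ num i ⬝ v (i + 1) with hu
  have hu_mem : ∀ i, u i ∈ El (B ⬝ num i).lazy := fun i =>
    head_mem h.fam (natEl_num i) (hv (i + 1))
  set f : Point := ⟨.liminf fun k => (phiArg B H K (num k) (v k)).strict,
    .ofSeq fun i => (u i).lazy⟩ with hf
  have hf_mem : ∀ x, NatEl x → f ⬝ x ∈ El (B ⬝ x).lazy := fun x hx => by
    obtain ⟨U, hU, i, ⟨hi, hk⟩ | ⟨hi, hk⟩⟩ := less_num hx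
    · -- `x` is the numeral `i`: as soon as `k > i`, the answer of `less` is `Inl`, and the function
      -- passed to `K` returns the component `u i`.
      have hle : ∀ k > i, u i ≤ fnPt .Psi ⬝ B ⬝ H ⬝ K ⬝ num k ⬝ v k ⬝ ⟨.prin U, x.lazy⟩
          ⬝ (fnPt .less ⬝ ⟨.prin U, x.lazy⟩ ⬝ num k) := fun k hik =>
        (le_get h.fam ptZero_nonempty hne ht hik hi).trans
          (Psi_inl h.fam.nonempty h.H_nonempty h.K_nonempty (num_nonempty k) (hne k)
            (Filt.prin_nonempty U) ptZero_nonempty (hk k hik))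
      have hx' : (B ⬝ num i).lazy = (B ⬝ x).lazy := congrArg B.lazy.app hi.2
      rw [← hx']
      refine el_up ⟨fun V hV => ⟨U, hU, i + 1, fun k hik => ?_⟩, ?_⟩ (hu_mem i)
      · refine arrow_mem_val_lam ?_
        have hV' := ((hle k hik).trans (lowVal_le phiBody (scons ⟨.prin U, x.lazy⟩
          (envOf .bot ![B, H, K, num k, v k])))).1 hV
        rwa [pval, stricts_scons] at hV'
      · change _ = LVal.app _ x.lazy
        rw [← show (num i).lazy = x.lazy from hi.2, LVal.ofSeq_num]
    · -- `x` is not a numeral: neither `less` nor the lazy value of `f` is defined at `x`.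
      refine el_top (h.fam _ hx).2.isTy ⟨⟨U, hU, i + 1, fun k hik => ?_⟩, ?_⟩
      · refine arrow_mem_val_lam ?_
        have hV' := (lowVal_le phiBody (scons ⟨.prin U, x.lazy⟩
          (envOf .bot ![B, H, K, num k, v k]))).1 (Psi_top h.fam.nonempty h.H_nonempty h.K_nonempty
          (num_nonempty k) (hne k) (Filt.prin_nonempty U) (hk k hik)).1
        rwa [pval, stricts_scons] at hV'
      · exact LVal.ofSeq_of_not_num _ hi
  -- The neighbourhood `W` of `f` that makes `K f` total belongs to almost all arguments of `K`.
  obtain ⟨W, ⟨k₀, hW⟩, hK⟩ := h.K_mem f hf_mem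
  exact ⟨k₀, fun k hk => safe_of_phiArg h (natEl_num k) (hv k) ⟨W, hW k hk, hK⟩⟩

/-- The same for a sequence of vectors of lengths `j, j + 1, …`, which is completed downwards by
`tail`. -/
theorem eventually_safe_from {B H K : Point} (h : BarHyp B H K) (j : ℕ) {v : ℕ → Point}
    (hv : ∀ i, v i ∈ vecEl B (num (j + i)))
    (ht : ∀ i, v i ≤ fnPt .tail ⬝ num (j + i) ⬝ v (i + 1)) :
    ∃ k₀, ∀ k ≥ k₀, Safe B H K (num (j + k)) (v k) := by
  induction j generalizing v with
  | zero =>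
    simp only [Nat.zero_add] at hv ht ⊢
    exact eventually_safe h hv ht
  | succ j ih =>
    obtain ⟨k₀, hk⟩ := ih (v := scons (fnPt .tail ⬝ num j ⬝ v 0) v)
      (fun i => by
        cases i with
        | zero => exact tail_mem h.fam (natEl_num j) (hv 0)
        | succ i => rw [Nat.add_succ, ← Nat.succ_add]; exact hv i)
      (fun i => by
        cases i with
        | zero => exact le_rfl
        | succ i => rw [Nat.add_succ j i, ← Nat.succ_add]; exact ht i)
    refine ⟨k₀, fun k hk' => ?_⟩
    have := hk (k + 1) (by omega)
    rwa [Nat.add_succ, ← Nat.succ_add] at this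

/-- The type of `Φ`: otherwise dependent choice would give an infinite sequence of vectors, each
extending the one before, at which the value of `Φ` is not total. -/
theorem phi_mem {B H K n v : Point} (h : BarHyp B H K) (hn : NatEl n) (hv : v ∈ vecEl B n) :
    fnPt .Phi ⬝ B ⬝ H ⬝ K ⬝ n ⬝ v ∈ emptyEl := by
  obtain ⟨j, hj⟩ | hless := num_le_or_less hn
  · suffices hs : Safe B H K (num j) v from
      emptyEl_total.up (Point.app_mono (Point.app_mono le_rfl hj) le_rfl) hs
    by_contra hbad
    have step : ∀ k v, v ∈ vecEl B (num k) → ¬ Safe B H K (num k) v →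
        ∃ y ∈ El (B ⬝ num k).lazy, ¬ Safe B H K (num (k + 1)) (ptPair v y) := fun k v hv hbad => by
      by_contra hcon
      push Not at hcon
      exact hbad (safe_of_extensions h (natEl_num k) hv hcon)
    choose! y hy hbad' using step
    let w : ℕ → Point := Nat.rec v fun i p => ptPair p (y (j + i) p)
    have hv' : v ∈ vecEl B (num j) := by rwa [vecEl, el_app_congr hj]
    have hw : ∀ i, w i ∈ vecEl B (num (j + i)) ∧ ¬ Safe B H K (num (j + i)) (w i) := fun i => by
      induction i with
      | zero => exact ⟨hv', hbad⟩
      | succ i ih =>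
        exact ⟨ptPair_mem_vecEl h.fam (natEl_num _) ih.1 (hy _ _ ih.1 ih.2), hbad' _ _ ih.1 ih.2⟩
    obtain ⟨k, hk⟩ := eventually_safe_from h j (fun i => (hw i).1) fun i =>
      tail_pair (num_nonempty _) (el_nonempty (hw i).1)
        (el_nonempty (hy _ _ (hw i).1 (hw i).2)) le_rfl
    exact (hw k).2 (hk k le_rfl)
  · -- If `n` is not a numeral, then `Ψ` is never called with an argument `Inr p`.
    refine safe_of_phiArg h hn hv (h.K_mem _ fun x hx =>
      el_up (le_phiArg B H K n v hx.nonempty) ?_)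
    obtain hs | ⟨p, hp, hs⟩ := hless x hx
    · exact psi_mem_of_top h hn hv hx hs
    · exact psi_mem_of_inl h hn hv hx hp hs

theorem psi_mem {B H K n v x s : Point} (h : BarHyp B H K) (hn : NatEl n) (hv : v ∈ vecEl B n)
    (hx : NatEl x) (hs : s ∈ lessEl x n) :
    fnPt .Psi ⬝ B ⬝ H ⬝ K ⬝ n ⬝ v ⬝ x ⬝ s ∈ El (B ⬝ x).lazy :=
  psi_mem_of_safe h hn hv hx
    (fun _ hy => phi_mem h hn.ptS (ptPair_mem_vecEl h.fam hn hv hy)) hs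

/-! ### The types of the constants -/

open Term

variable {η : ℕ → LVal} {A B : Term} {p : Point}

theorem lazy_fun (p q : Point) : (conPt .Fun ⬝ p ⬝ q).lazy = .con .Fun ![p.lazy, q.lazy] :=
  apps_conVal .Fun ![p.lazy, q.lazy]

theorem lazy_plus (p q : Point) : (conPt .plus ⬝ p ⬝ q).lazy = .con .plus ![p.lazy, q.lazy] :=
  apps_conVal .plus ![p.lazy, q.lazy]

theorem plus_nonempty {p q : Point} (hp : p.strict.Nonempty) (hq : q.strict.Nonempty) :
    (conPt .plus ⬝ p ⬝ q).strict.Nonempty :=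
  (con_nonempty (by change ∀ i : Fin 2, _; simp [Fin.forall_fin_two, hp, hq])).mono
    (con_le_conPt_apps .plus ![p, q]).1

theorem den_pi (A B : Term) (η : ℕ → LVal) :
    den (pi A B) η = .con .Fun ![den A η, den (.lam B) η] :=
  apps_conVal .Fun ![den A η, den (.lam B) η]

theorem den_tplus (A B : Term) (η : ℕ → LVal) :
    den (tplus A B) η = .con .plus ![den A η, den B η] :=
  apps_conVal .plus ![den A η, den B η]

theorem den_ttimes (A B : Term) (η : ℕ → LVal) :
    den (ttimes A B) η = .con .times ![den A η, den B η] :=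
  apps_conVal .times ![den A η, den B η]

theorem den_tU (η : ℕ → LVal) : den tU η = .con .U ![] := conVal_of_arity_zero rfl _

theorem mem_pi : p ∈ El (den (pi A B) η) ↔
    IsTy (den A η) ∧ ∀ q ∈ El (den A η), p ⬝ q ∈ El (den B (scons q.lazy η)) := by
  simp only [den_pi, mem_el_pi, app_den_lam]

theorem isTy_den_pi (hA : IsTy (den A η))
    (hB : ∀ q ∈ El (den A η), IsTy (den B (scons q.lazy η))) : IsTy (den (pi A B) η) := by
  rw [den_pi]
  exact isTy_pi hA fun q hq => by rw [app_den_lam]; exact hB q hq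

theorem isSmall_den_pi (hA : IsSmall (den A η))
    (hB : ∀ q ∈ El (den A η), IsSmall (den B (scons q.lazy η))) : IsSmall (den (pi A B) η) := by
  rw [den_pi]
  exact isSmall_pi hA fun q hq => by rw [app_den_lam]; exact hB q hq

theorem den_shift_scons (B : Term) (a : LVal) (η : ℕ → LVal) :
    den (B.shift 1) (scons a η) = den B η := den_shift B 1 (scons a η)

theorem mem_arr : p ∈ El (den (arr A B) η) ↔
    IsTy (den A η) ∧ ∀ q ∈ El (den A η), p ⬝ q ∈ El (den B η) := by
  simp only [arr, mem_pi, den_shift_scons]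

theorem isTy_den_arr (hA : IsTy (den A η)) (hB : IsTy (den B η)) : IsTy (den (arr A B) η) :=
  isTy_den_pi hA fun q _ => by rwa [den_shift_scons]

theorem isSmall_den_arr (hA : IsSmall (den A η)) (hB : IsSmall (den B η)) :
    IsSmall (den (arr A B) η) :=
  isSmall_den_pi hA fun q _ => by rwa [den_shift_scons]

theorem isTy_tNat (η : ℕ → LVal) : IsTy (den tNat η) := conPt_Nat_mem.2.isTy

theorem el_tNat (η : ℕ → LVal) : El (den tNat η) = {p | NatEl p} := el_conPt_Nat

theorem isTy_tU (η : ℕ → LVal) : IsTy (den tU η) := by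
  rw [den_tU]
  exact isTy_U

theorem el_tU (η : ℕ → LVal) : El (den tU η) = univEl := by rw [den_tU, el_U]

theorem mem_pi_nat :
    p ∈ El (den (pi tNat B) η) ↔ ∀ n, NatEl n → p ⬝ n ∈ El (den B (scons n.lazy η)) := by
  simp only [mem_pi, isTy_tNat, el_tNat, true_and]
  rfl

theorem mem_arr_nat : p ∈ El (den (arr tNat B) η) ↔ ∀ n, NatEl n → p ⬝ n ∈ El (den B η) := by
  simp only [mem_arr, isTy_tNat, el_tNat, true_and]
  rfl

theorem mem_arr_univ : p ∈ El (den (arr tU B) η) ↔ ∀ q ∈ univEl, p ⬝ q ∈ El (den B η) := by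
  simp only [mem_arr, isTy_tU, el_tU, true_and]

theorem mem_fam : p ∈ El (den (arr tNat tU) η) ↔ Fam p := by
  simp only [mem_arr_nat, el_tU]
  rfl

theorem isTy_fam : IsTy (den (arr tNat tU) η) := isTy_den_arr (isTy_tNat η) (isTy_tU η)

theorem mem_pi_fam : p ∈ El (den (pi (arr tNat tU) B) η) ↔
    ∀ q, Fam q → p ⬝ q ∈ El (den B (scons q.lazy η)) := by
  simp only [mem_pi, isTy_fam, mem_fam, true_and]

theorem mem_arr_fam : p ∈ El (den (arr (arr tNat tU) B) η) ↔ ∀ q, Fam q → p ⬝ q ∈ El (den B η) := by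
  rw [mem_arr]
  exact ⟨fun h q hq => h.2 q (mem_fam.2 hq), fun h => ⟨isTy_fam, fun q hq => h q (mem_fam.1 hq)⟩⟩

theorem el_tplus (hA : IsTy (den A η)) (hB : IsTy (den B η)) :
    El (den (tplus A B) η) = sumEl (El (den A η)) (El (den B η)) := by
  rw [den_tplus, el_plus hA hB]

theorem el_ttimes (hA : IsTy (den A η)) (hB : IsTy (den B η)) :
    El (den (ttimes A B) η) = prodEl (El (den A η)) (El (den B η)) := by
  rw [den_ttimes, el_times hA hB]

theorem pval_lam_nonempty {M : Term} {ρ : ℕ → Point} (q : Point) (hq : q.strict.Nonempty)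
    (h : (lowVal M (scons q ρ)).strict.Nonempty) : (pval (.lam M) ρ).strict.Nonempty :=
  nonempty_of_app (h.mono (lowVal_le_lam_app M ρ hq).1)

theorem top_nonempty : (⟨⊤, ∅⟩ : Point).strict.Nonempty := topPts_nonempty top_mem_topPts

/-- The environment `η'` comes from the right-hand side of the rule for `¬`; the closed codomain
does not depend on it. -/
theorem den_tneg (A : Term) (η : ℕ → LVal) : ∃ η', den (tneg A) η =
    .con .Fun ![den A η, den (.lam tN0) η'] :=
  ⟨_, (neg_le (A := ⟨⊤, den A η⟩) ⟨.nabla, trivial⟩).2.symm.trans (lazy_fun _ _)⟩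

theorem mem_tneg : p ∈ El (den (tneg A) η) ↔
    IsTy (den A η) ∧ ∀ q ∈ El (den A η), p ⬝ q ∈ emptyEl := by
  obtain ⟨η', h⟩ := den_tneg A η
  have h' : ∀ η, El (den tN0 η) = emptyEl := fun _ => el_conPt_N0
  simp only [h, mem_el_pi, app_den_lam, h']

theorem isTy_tneg (hA : IsTy (den A η)) : IsTy (den (tneg A) η) := by
  obtain ⟨η', h⟩ := den_tneg A η
  rw [h]
  exact isTy_pi hA fun q _ => by rw [app_den_lam]; exact conPt_N0_mem.2.isTy

theorem neg_mem {a : Point} (ha : a ∈ univEl) : fnPt .neg ⬝ a ∈ univEl := by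
  refine univEl_up (neg_le ha.1) ⟨fun_nonempty ha.1
    (pval_lam_nonempty ⟨⊤, ∅⟩ top_nonempty (conPt_nonempty rfl)), ?_⟩
  rw [lazy_fun]
  refine isSmall_pi ha.2 fun q _ => ?_
  change IsSmall (LVal.app (den (.lam tN0) _) _)
  rw [app_den_lam]
  exact conPt_N0_mem.2

/-- The term `P (S k) → P k`, where `k` and `P` are the variables `0` and `1`. -/
def stepTerm : Term := arr (.app (.var 1) (tS (.var 0))) (.app (.var 1) (.var 0))

theorem lazy_T {P : Point} (hP : P.strict.Nonempty) : (fnPt .T ⬝ P).lazy =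
    den (pi tNat stepTerm) (lazies (envOf .bot ![P])) := (T_le hP).2.symm

theorem mem_fam_app_S {P k : Point} (hP : Fam P) (hk : NatEl k) : P ⬝ (conPt .S ⬝ k) ∈ univEl :=
  hP _ (.succ hk (ptS_le k))

theorem T_mem {P : Point} (hP : Fam P) : fnPt .T ⬝ P ∈ univEl := by
  constructor
  · have h : (lowVal stepTerm (scons ⟨⊤, ∅⟩ (envOf .bot ![P]))).strict.Nonempty :=
      fun_nonempty (mem_fam_app_S hP natEl_top).1 (pval_lam_nonempty
        (M := .app (.var 2) (.var 1)) ⟨⊤, ∅⟩ top_nonempty (hP _ natEl_top).1)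
    exact (fun_nonempty (conPt_nonempty rfl) (pval_lam_nonempty _ top_nonempty h)).mono
      (T_le hP.nonempty).1
  · rw [lazy_T hP.nonempty]
    refine isSmall_den_pi conPt_Nat_mem.2 fun k hk => ?_
    rw [el_tNat] at hk
    exact isSmall_den_arr (mem_fam_app_S hP hk).2 (hP _ hk).2

theorem el_T {P : Point} (hP : Fam P) : El (fnPt .T ⬝ P).lazy = stepEl P := by
  ext h
  rw [lazy_T hP.nonempty, mem_pi_nat]
  refine forall₂_congr fun k hk => ?_
  rw [stepTerm, mem_arr, el_app_congr (ptS_le k)]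
  exact ⟨fun h => h.2, fun h => ⟨(mem_fam_app_S hP hk).2.isTy, h⟩⟩

theorem isTy_app {P k : Point} (hP : Fam P) (hk : NatEl k) : IsTy (P ⬝ k).lazy := (hP k hk).2.isTy

theorem lazy_le_S (m n : Point) :
    (fnPt .le ⬝ (conPt .S ⬝ m) ⬝ n).lazy = (fnPt .le ⬝ ptS m ⬝ n).lazy := by
  simp only [Point.app, (ptS_le m).2]

theorem el_less_type {m n : Point} (hm : NatEl m) (hn : NatEl n) {A B : Term} {η : ℕ → LVal}
    (hA : den A η = (fnPt .le ⬝ (conPt .S ⬝ m) ⬝ n).lazy)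
    (hB : den B η = (fnPt .le ⬝ n ⬝ m).lazy) : El (den (tplus A B) η) = lessEl m n := by
  rw [lazy_le_S] at hA
  rw [el_tplus, hA, hB, lessEl]
  · rw [hA]; exact (le_mem hm.ptS hn).2.isTy
  · rw [hB]; exact (le_mem hn hm).2.isTy

theorem isTy_less_type {m n : Point} (hm : NatEl m) (hn : NatEl n) {A B : Term} {η : ℕ → LVal}
    (hA : den A η = (fnPt .le ⬝ (conPt .S ⬝ m) ⬝ n).lazy)
    (hB : den B η = (fnPt .le ⬝ n ⬝ m).lazy) : IsTy (den (tplus A B) η) := by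
  rw [lazy_le_S] at hA
  rw [den_tplus, hA, hB]
  exact (isSmall_plus (le_mem hm.ptS hn).2 (le_mem hn hm).2).isTy

/-- The type of the argument `H` of `Φ`. -/
theorem isTy_nn {B : Point} (hB : Fam B) {η : ℕ → LVal} (hη : η 0 = B.lazy) :
    IsTy (den (pi tNat (tneg (tneg (.app (.var 1) (.var 0))))) η) :=
  isTy_den_pi (isTy_tNat _) fun q hq => by
    rw [el_tNat] at hq
    refine isTy_tneg (isTy_tneg ?_)
    change IsTy (LVal.app (η 0) q.lazy)
    rw [hη]
    exact isTy_app hB hq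

/-- The type of the argument `K` of `Φ`. -/
theorem isTy_neg_pi {B : Point} (hB : Fam B) {η : ℕ → LVal} (hη : η 0 = B.lazy) :
    IsTy (den (tneg (pi tNat (.app (.var 1) (.var 0)))) η) :=
  isTy_tneg <| isTy_den_pi (isTy_tNat _) fun q hq => by
    rw [el_tNat] at hq
    change IsTy (LVal.app (η 0) q.lazy)
    rw [hη]
    exact isTy_app hB hq

theorem barHyp_of_mem {B H K : Point} (hB : Fam B) {η : ℕ → LVal} (hη : η 0 = B.lazy)
    (hH : H ∈ El (den (pi tNat (tneg (tneg (.app (.var 1) (.var 0))))) η))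
    (hK : K ∈ El (den (tneg (pi tNat (.app (.var 1) (.var 0)))) η)) : BarHyp B H K := by
  have h : ∀ n : Point, den (.app (.var 1) (.var 0)) (scons n.lazy η) = (B ⬝ n).lazy := fun n => by
    change LVal.app (η 0) n.lazy = _
    rw [hη]
    rfl
  refine ⟨hB, fun n hn q hq => ?_, fun f hf => ?_⟩
  · have hn' := (mem_tneg.1 (mem_pi_nat.1 hH n hn)).2
    refine hn' q (mem_tneg.2 ?_)
    rw [h]
    exact ⟨isTy_app hB hn, hq⟩
  · refine (mem_tneg.1 hK).2 f (mem_pi_nat.2 fun x hx => ?_)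
    rw [h]
    exact hf x hx

/-- Every constant is a total element of its type. -/
theorem const_mem {c A : Term} {Δ : List Term} (hc : ConstTy c Δ A) {η : ℕ → LVal}
    (w : ℕ → Point) (hw : ∀ i D, Δ[i]? = some D → w i ∈ El (den D η)) (ρ : ℕ → Point) :
    pval c ρ ∈ El (den A (lazies w)) := by
  cases hc with
  | Nat =>
    rw [el_tU]
    exact univEl_up (le_pval_con _ ρ) conPt_Nat_mem
  | zero =>
    rw [el_tNat]
    exact .zero (ptZero_le.trans (le_pval_con _ ρ))
  | S =>
    refine el_up (le_pval_con _ ρ) (mem_arr_nat.2 fun n hn => ?_)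
    rw [el_tNat]
    exact .succ hn (ptS_le n)
  | Rec =>
    have hC : Fam (w 0) := mem_fam.1 (hw 0 _ rfl)
    refine el_up (le_pval_fn _ ρ) (mem_arr.2 ⟨isTy_app hC (.zero ptZero_le), fun P hP =>
      mem_arr.2 ⟨isTy_den_pi (isTy_tNat _) fun n hn => ?_,
      fun Q hQ => mem_pi_nat.2 fun n hn => ?_⟩⟩)
    · rw [el_tNat] at hn
      exact isTy_den_arr (isTy_app hC hn) (mem_fam_app_S hC hn).2.isTy
    · refine rec_mem hC ?_ (fun n hn y hy => ?_) hn
      · rw [el_app_congr ptZero_le]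
        exact hP
      · rw [el_app_congr (ptS_le n)]
        exact (mem_arr.1 (mem_pi_nat.1 hQ n hn)).2 y hy
  | plus =>
    refine el_up (le_pval_con _ ρ) (mem_arr_univ.2 fun a ha => mem_arr_univ.2 fun b hb => ?_)
    rw [el_tU]
    refine ⟨plus_nonempty ha.1 hb.1, ?_⟩
    rw [lazy_plus]
    exact isSmall_plus ha.2 hb.2
  | Inl =>
    have h0 := hw 0 _ rfl
    have h1 := hw 1 _ rfl
    rw [el_tU] at h0 h1
    have h0' : IsTy (den (.var 0) (lazies w)) := h0.2.isTy
    have h1' : IsTy (den (.var 1) (lazies w)) := h1.2.isTy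
    refine el_up (le_pval_con _ ρ) (mem_arr.2 ⟨h0', fun q hq => ?_⟩)
    rw [el_tplus h0' h1']
    exact .inr (.inl ⟨q, hq, ptInl_le q⟩)
  | Inr =>
    have h0 := hw 0 _ rfl
    have h1 := hw 1 _ rfl
    rw [el_tU] at h0 h1
    have h0' : IsTy (den (.var 0) (lazies w)) := h0.2.isTy
    have h1' : IsTy (den (.var 1) (lazies w)) := h1.2.isTy
    refine el_up (le_pval_con _ ρ) (mem_arr.2 ⟨h1', fun q hq => ?_⟩)
    rw [el_tplus h0' h1']
    exact .inr (.inr ⟨q, hq, ptInr_le q⟩)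
  | times =>
    refine el_up (le_pval_con _ ρ) (mem_arr_univ.2 fun a ha => mem_arr_univ.2 fun b hb => ?_)
    rw [el_tU]
    refine ⟨times_nonempty ha.1 hb.1, ?_⟩
    rw [lazy_times]
    exact isSmall_times ha.2 hb.2
  | Pair =>
    have h0 := hw 0 _ rfl
    have h1 := hw 1 _ rfl
    rw [el_tU] at h0 h1
    have h0' : IsTy (den (.var 0) (lazies w)) := h0.2.isTy
    have h1' : IsTy (den (.var 1) (lazies w)) := h1.2.isTy
    refine el_up (le_pval_con _ ρ) (mem_arr.2 ⟨h0', fun q hq => mem_arr.2 ⟨h1',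
      fun q' hq' => ?_⟩⟩)
    rw [el_ttimes h0' h1']
    exact .inr ⟨q, hq, q', hq', ptPair_le q q'⟩
  | N0 =>
    rw [el_tU]
    exact univEl_up (le_pval_con _ ρ) conPt_N0_mem
  | exit =>
    have h0 := hw 0 _ rfl
    rw [el_tU] at h0
    exact el_up (le_pval_fn _ ρ) (mem_arr.2 ⟨conPt_N0_mem.2.isTy, fun q hq =>
      exit_top_mem h0.2.isTy (el_nonempty hq)⟩)
  | neg =>
    refine el_up (le_pval_fn _ ρ) (mem_arr_univ.2 fun a ha => ?_)
    rw [el_tU]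
    exact neg_mem ha
  | N1 =>
    rw [el_tU]
    exact univEl_up (le_pval_con _ ρ) conPt_N1_mem
  | zero' =>
    have h : El (den tN1 (lazies w)) = unitEl := el_conPt_N1
    rw [h]
    exact unitEl_total.up (ptZero_le.trans (le_pval_con _ ρ)) ptZero_mem_unitEl
  | le =>
    refine el_up (le_pval_fn _ ρ) (mem_arr_nat.2 fun m hm => mem_arr_nat.2 fun n hn => ?_)
    rw [el_tU]
    exact le_mem hm hn
  | less =>
    refine el_up (le_pval_fn _ ρ) (mem_pi_nat.2 fun m hm => mem_pi_nat.2 fun n hn => ?_)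
    rw [el_less_type hm hn rfl rfl]
    exact less_mem hm hn
  | vec =>
    refine el_up (le_pval_fn _ ρ) (mem_arr_fam.2 fun B hB => mem_arr_nat.2 fun n hn => ?_)
    rw [el_tU]
    exact vec_mem hB hn
  | head =>
    have hB : Fam (w 0) := mem_fam.1 (hw 0 _ rfl)
    refine el_up (le_pval_fn _ ρ) (mem_pi_nat.2 fun x hx => mem_arr.2
      ⟨(vec_mem hB (.succ hx (ptS_le x))).2.isTy, fun v hv => head_mem hB hx ?_⟩)
    rw [el_app_congr (ptS_le x)]
    exact hv
  | tail =>
    have hB : Fam (w 0) := mem_fam.1 (hw 0 _ rfl)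
    refine el_up (le_pval_fn _ ρ) (mem_pi_nat.2 fun x hx => mem_arr.2
      ⟨(vec_mem hB (.succ hx (ptS_le x))).2.isTy, fun v hv => tail_mem hB hx ?_⟩)
    rw [el_app_congr (ptS_le x)]
    exact hv
  | T =>
    refine el_up (le_pval_fn _ ρ) (mem_arr_fam.2 fun P hP => ?_)
    rw [el_tU]
    exact T_mem hP
  | trim =>
    refine el_up (le_pval_fn _ ρ) (mem_pi_nat.2 fun n hn => mem_pi_nat.2 fun m hm => mem_arr.2
      ⟨(le_mem hn hm).2.isTy, fun p hp => mem_pi_fam.2 fun P hP => mem_arr.2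
        ⟨(T_mem hP).2.isTy, fun h hh => mem_arr.2 ⟨isTy_app hP hm, fun v hv =>
          trim_mem hn hm hp hP ?_ hv⟩⟩⟩)
    rw [← el_T hP]
    exact hh
  | get =>
    refine el_up (le_pval_fn _ ρ) (mem_pi_fam.2 fun B hB => mem_pi_nat.2 fun n hn =>
      mem_pi_nat.2 fun x hx => mem_arr.2 ⟨(le_mem (.succ hx (ptS_le x)) hn).2.isTy, fun p hp =>
        mem_arr.2 ⟨(vec_mem hB hn).2.isTy, fun v hv => get_mem hB hn hx ?_ hv⟩⟩)
    rw [← lazy_le_S]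
    exact hp
  | Phi =>
    refine el_up (le_pval_fn _ ρ) (mem_pi_fam.2 fun B hB => mem_arr.2 ⟨isTy_nn hB rfl, fun H hH =>
      mem_arr.2 ⟨isTy_neg_pi hB rfl, fun K hK => mem_pi_nat.2 fun n hn => mem_tneg.2
        ⟨(vec_mem hB hn).2.isTy, fun v hv => phi_mem (barHyp_of_mem hB rfl hH hK) hn hv⟩⟩⟩)
  | Psi =>
    refine el_up (le_pval_fn _ ρ) (mem_pi_fam.2 fun B hB => mem_arr.2 ⟨isTy_nn hB rfl, fun H hH =>
      mem_arr.2 ⟨isTy_neg_pi hB rfl, fun K hK => mem_pi_nat.2 fun n hn => mem_arr.2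
        ⟨(vec_mem hB hn).2.isTy, fun v hv => mem_pi_nat.2 fun x hx => mem_arr.2
          ⟨isTy_less_type hx hn rfl rfl, fun s hs => ?_⟩⟩⟩⟩)
    rw [el_less_type hx hn rfl rfl] at hs
    exact psi_mem (barHyp_of_mem hB rfl hH hK) hn hv hx hs

/-! ### Well-typed terms denote total elements -/

/-- The environment assigns total elements to the variables of the context. -/
def Sat : List Term → (ℕ → Point) → Prop
  | [], _ => True
  | A :: Γ, ρ => Sat Γ (fun i => ρ (i + 1)) ∧ ρ 0 ∈ El (den A fun i => (ρ (i + 1)).lazy)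

/-- The term is interpreted as a type in all environments for the context. -/
def TotalType (Γ : List Term) (A : Term) : Prop :=
  ∀ ρ, Sat Γ ρ → (pval A ρ).strict.Nonempty ∧ IsTy (den A (lazies ρ))

/-- The entries of the context are interpreted as types. -/
def TotalCtx : List Term → Prop
  | [] => True
  | A :: Γ => TotalCtx Γ ∧ TotalType Γ A

theorem Sat.scons {Γ : List Term} {A : Term} {ρ : ℕ → Point} (h : Sat Γ ρ) {p : Point}
    (hp : p ∈ El (den A (lazies ρ))) : Sat (A :: Γ) (UPL.scons p ρ) := ⟨h, hp⟩

theorem Sat.mem {Γ : List Term} {ρ : ℕ → Point} (h : Sat Γ ρ) {i : ℕ} {A : Term}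
    (hA : Γ[i]? = some A) : ρ i ∈ El (den (A.shift (i + 1)) (lazies ρ)) := by
  rw [den_shift]
  induction Γ generalizing ρ i with
  | nil => simp at hA
  | cons C Γ ih =>
    cases i with
    | zero =>
      obtain rfl : C = A := by simpa using hA
      exact h.2
    | succ i => exact ih h.1 (by simpa using hA)

theorem pi_nonempty {Γ : List Term} {A B : Term} {ρ : ℕ → Point} (h : Sat Γ ρ)
    (hA : (pval A ρ).strict.Nonempty) (hA' : IsTy (den A (lazies ρ)))
    (hB : ∀ ρ, Sat (A :: Γ) ρ → (pval B ρ).strict.Nonempty) :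
    (pval (pi A B) ρ).strict.Nonempty := by
  have hlam : (pval (.lam B) ρ).strict.Nonempty := nonempty_of_app
    ((hB _ (h.scons (el_top hA' top_mem_topPts))).mono (le_pval_lam_app B ρ top_nonempty).1)
  refine (fun_nonempty hA hlam).mono (le_trans ?_ (le_pval_app _ _ _)).1
  exact Point.app_mono ((Point.app_mono (le_pval_con _ ρ) le_rfl).trans (le_pval_app _ _ _)) le_rfl

mutual

theorem WfCtx.total : ∀ {Γ : List Term}, WfCtx Γ → TotalCtx Γ
  | _, .nil => trivial
  | _, .cons h => h.total

theorem IsType.total : ∀ {Γ : List Term} {A : Term}, IsType Γ A → TotalCtx Γ ∧ TotalType Γ A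
  | _, _, .univ h =>
    ⟨h.total, fun ρ _ => ⟨(conPt_nonempty rfl).mono (le_pval_con .U ρ).1, isTy_tU _⟩⟩
  | _, _, .el h => ⟨h.total.1, fun ρ hρ => by
      have h' := h.total.2 ρ hρ
      rw [el_tU] at h'
      exact ⟨h'.1, h'.2.isTy⟩⟩
  | _, _, .pi h => by
    obtain ⟨⟨hΓ, hA⟩, hB⟩ := h.total
    exact ⟨hΓ, fun ρ hρ => ⟨pi_nonempty hρ (hA ρ hρ).1 (hA ρ hρ).2 fun ρ hρ => (hB ρ hρ).1,
      isTy_den_pi (hA ρ hρ).2 fun q hq => by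
        rw [← lazies_scons]
        exact (hB _ (hρ.scons hq)).2⟩⟩

theorem HasType.total : ∀ {Γ : List Term} {M A : Term}, HasType Γ M A →
    TotalCtx Γ ∧ ∀ ρ, Sat Γ ρ → pval M ρ ∈ El (den A (lazies ρ))
  | _, _, _, .var hA h => ⟨h.total, fun ρ hρ => el_up (lowVal_le (.var _) ρ) (hρ.mem hA)⟩
  | _, _, _, .lam h => by
    obtain ⟨⟨hΓ, hA⟩, hM⟩ := h.total
    refine ⟨hΓ, fun ρ hρ => mem_pi.2 ⟨(hA ρ hρ).2, fun q hq => ?_⟩⟩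
    rw [← lazies_scons]
    exact el_up (le_pval_lam_app _ ρ (el_nonempty hq)) (hM _ (hρ.scons hq))
  | _, _, _, .app h h' => by
    refine ⟨h.total.1, fun ρ hρ => ?_⟩
    rw [den_inst]
    exact el_up (le_pval_app _ _ ρ) ((mem_pi.1 (h.total.2 ρ hρ)).2 _ (h'.total.2 ρ hρ))
  | _, _, _, .conv h _ hAB => by
    refine ⟨h.total.1, fun ρ hρ => ?_⟩
    rw [← den_conv hAB]
    exact h.total.2 ρ hρ
  | _, _, _, .piU h h' => by
    refine ⟨h.total.1, fun ρ hρ => ?_⟩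
    have hA := h.total.2 ρ hρ
    have hB := h'.total.2
    simp only [el_tU] at hA hB ⊢
    exact ⟨pi_nonempty hρ hA.1 hA.2.isTy fun ρ hρ => (hB ρ hρ).1,
      isSmall_den_pi hA.2 fun q hq => by
        rw [← lazies_scons]
        exact (hB _ (hρ.scons hq)).2⟩
  | _, _, _, .const s hc hΓ h => by
    refine ⟨hΓ.total, fun ρ hρ => ?_⟩
    rw [den_subst]
    exact const_mem hc (fun i => pval (s i) ρ) (fun i D hD => (h i D hD).total.2 ρ hρ) ρ

end

/-- Only variables of the context occur free in a typed term. -/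
theorem NTy.isSome_of_mem_fv {Γ : NCtx} {M : Term} {U : Nbhd} (h : NTy Γ M U) {i : ℕ}
    (hi : i ∈ M.fv) : (Γ i).isSome := by
  induction h generalizing i with
  | var h =>
    obtain rfl := Set.mem_singleton_iff.1 hi
    simp [h]
  | con => exact hi.elim
  | lam _ ih => simpa [NCtx.ext] using ih hi
  | app _ _ ih ih' => exact hi.elim ih ih'
  | inter _ _ ih _ => exact ih hi
  | sub _ _ ih => exact ih hi
  | rule => exact hi.elim
  | noRule => exact hi.elim

theorem sem_ne_bot {M : Term} (h : (pval M fun _ => .bot).strict.Nonempty) (ρ : Env) :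
    sem M ρ ≠ ⊥ := by
  obtain ⟨U, Γ, hΓ, hU⟩ := h
  have hnone : ∀ i, Γ i = none := fun i => by
    cases h : Γ i with
    | none => rfl
    | some V => exact (hΓ i V h).elim
  have hmem : Nb.mk U ∈ sem M ρ := by
    refine ⟨Γ, U, fun i => ⟨fun h => ?_, hU.isSome_of_mem_fv⟩, fun i V h => ?_, hU, rfl⟩
    · simp [hnone i] at h
    · simp [hnone i] at h
  intro h
  rw [h] at hmem
  exact hmem

end UPL

theorem mainTheorem9 :
    (∀ A : UPL.Term, UPL.IsType [] A → ∀ ρ : UPL.Env, UPL.sem A ρ ≠ ⊥) ∧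
    (∀ M A : UPL.Term, UPL.HasType [] M A → ∀ ρ : UPL.Env, UPL.sem M ρ ≠ ⊥) :=
  ⟨fun _ h => UPL.sem_ne_bot (h.total.2 _ trivial).1,
    fun _ _ h => UPL.sem_ne_bot (UPL.el_nonempty (h.total.2 _ trivial))⟩
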